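/- A graph is a comparability graph if it has a transitive orientation: each edge $\{u,v\}$ can be replaced by exactly one of the ordered pairs $(u,v)$, $(v,u)$ so that the resulting set of arcs is transitive. A cocomparability graph is a graph whose complement is a comparability graph. A partial $k$-coloring of a (finite, simple, undirected) graph $G=(V,E)$ is a sequence $(X_1,\dots,X_k)$ of pairwise disjoint independent sets of $G$. Given $p_1,\dots,p_k:V\to\mathbb{Z}_+$, its profit profile is $(p_1(X_1),\dots,p_k(X_k))$, where $p_j(X)=\sum_{v\in X}p_j(v)$, and its satisfaction level is $\min_j p_j(X_j)$. The problem Fair $k$-Division Under Conflicts asks, given $G$ and $p_1,\dots,p_k$, for a partial $k$-coloring of $G$ with maximum satisfaction level. Let $n=|V|$ and $Q=\max_{1\le j\le k}p_j(V)$. Theorem. Let $k\ge 1$ be fixed. (a) There is an algorithm that, given a cocomparability graph $G$ (by its adjacency matrix) and functions $p_1,\dots,p_k:V(G)\to\mathbb{Z}_+$, computes in time $O(n^{k+2}(Q+1)^k)$ both the set of all profit profiles of partial $k$-colorings of $G$ (as a list without repetition) and a partial $k$-coloring of $G$ with maximum satisfaction level; in particular, Fair $k$-Division Under Conflicts is solvable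 in this time for cocomparability conflict graphs. Time is counted on a random access machine with unit cost per instruction and with words of $O(\log(n+Q+2))$ bits; the implied constants depend only on $k$, and for $n=0$ the time is bounded by a constant. (b) Let $G$ be a graph and let $D$ be a transitive orientation of its complement. Then $D$ has a topological sort, that is, an ordering $v_1,\dots,v_n$ of $V(G)$ such that $i<j$ for every arc $(v_i,v_j)$ of $D$. For every such ordering and every sequence of indices $(i_1,\dots,i_r)$, the sequence $(v_{i_1},\dots,v_{i_r})$ is a directed path in $D$ if and only if $i_1<\dots<i_r$ and $\{v_{i_1},\dots,v_{i_r}\}$ is an independent set of $G$. -/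

import Mathlib

namespace FairDivision

/-! ### Graphs and partial colourings -/

/-- `D` is a transitive orientation of `H`: its arcs are edges of `H`, every edge of `H` is
replaced by exactly one of its two ordered pairs, and the set of arcs is transitive. -/
structure IsTransitiveOrientation {V : Type*} (H : SimpleGraph V) (D : V → V → Prop) : Prop where
  adj_of_arc : ∀ u v, D u v → H.Adj u v
  exactly_one : ∀ u v, H.Adj u v → Xor (D u v) (D v u)
  trans : ∀ x y z, D x y → D y z → D x z

/-- Comparability graphs: the graphs that have a transitive orientation. -/
def IsComparabilityGraph {V : Type*} (H : SimpleGraph V) : Prop :=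
  ∃ D : V → V → Prop, IsTransitiveOrientation H D

/-- Cocomparability graphs: the complement is a comparability graph. -/
def IsCocomparabilityGraph {V : Type*} (G : SimpleGraph V) : Prop :=
  IsComparabilityGraph Gᶜ

/-- The enumeration `e 0, e 1, …` of the vertices is a topological sort of the digraph `D`. -/
def IsTopologicalSort {V : Type*} {m : ℕ} (D : V → V → Prop) (e : Fin m ≃ V) : Prop :=
  ∀ i j, D (e i) (e j) → i < j

/-- A partial `k`-colouring: `k` pairwise disjoint independent sets. -/
def IsPartialColoring {V : Type*} {k : ℕ} (G : SimpleGraph V) (X : Fin k → Finset V) : Prop :=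
  (∀ i j, i ≠ j → Disjoint (X i) (X j)) ∧ ∀ j, G.IsIndepSet (X j : Set V)

/-- The profit profile `(p₁(X₁), …, pₖ(Xₖ))`. -/
def profitProfile {V : Type*} {k : ℕ} (p : Fin k → V → ℕ) (X : Fin k → Finset V) : Fin k → ℕ :=
  fun j => ∑ v ∈ X j, p j v

/-- The satisfaction level `minⱼ pⱼ(Xⱼ)` (used for `k ≥ 1` only, where the infimum is a
minimum). -/
noncomputable def satisfactionLevel {V : Type*} {k : ℕ} (p : Fin k → V → ℕ)
    (X : Fin k → Finset V) : ℕ :=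
  ⨅ j, profitProfile p X j

/-- The set of all profit profiles of partial `k`-colourings of `G`. -/
def profitProfiles {V : Type*} {k : ℕ} (G : SimpleGraph V) (p : Fin k → V → ℕ) :
    Set (Fin k → ℕ) :=
  {q | ∃ X, IsPartialColoring G X ∧ profitProfile p X = q}

/-- `X` is a solution of Fair `k`-Division Under Conflicts for `(G, p)`: a partial
`k`-colouring of `G` with maximum satisfaction level. -/
def IsOptimalColoring {V : Type*} {k : ℕ} (G : SimpleGraph V) (p : Fin k → V → ℕ)
    (X : Fin k → Finset V) : Prop :=
  IsPartialColoring G X ∧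
    ∀ Y, IsPartialColoring G Y → satisfactionLevel p Y ≤ satisfactionLevel p X

/-- `Q = maxⱼ pⱼ(V)`. -/
def maxTotalProfit {V : Type*} [Fintype V] {k : ℕ} (p : Fin k → V → ℕ) : ℕ :=
  Finset.univ.sup fun j => ∑ v, p j v

/-! ### A random access machine with unit cost and bounded words

A program uses finitely many registers and finitely many random access arrays (finitely many
arrays amount to one memory whose cells are interleaved). All cells hold natural numbers. Every
elementary instruction, and every evaluation of a branching or loop condition, costs one step. -/

/-- The arithmetic instructions: sum, truncated difference, product, integer quotient,
remainder. -/
inductive ArithOp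
  | add | sub | mul | div | mod

/-- The result of an arithmetic instruction. Division by `0` gives `0`, and the remainder of `x`
modulo `0` is `x`. -/
def ArithOp.eval : ArithOp → ℕ → ℕ → ℕ
  | add, x, y => x + y
  | sub, x, y => x - y
  | mul, x, y => x * y
  | div, x, y => x / y
  | mod, x, y => x % y

/-- Programs. Register names, array names and constants are literal numbers in the program;
indices into arrays are taken from registers. -/
inductive Prog
  /-- do nothing -/
  | nop
  /-- `R[d] := c` -/
  | const (d c : ℕ)
  /-- `R[d] := R[a] ∘ R[b]` -/
  | arith (o : ArithOp) (d a b : ℕ)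
  /-- `R[d] := A[arr][R[i]]` -/
  | load (d arr i : ℕ)
  /-- `A[arr][R[i]] := R[s]` -/
  | store (arr i s : ℕ)
  /-- `P; P'` -/
  | seq (P P' : Prog)
  /-- `if R[a] < R[b] then P else P'` -/
  | ite (a b : ℕ) (P P' : Prog)
  /-- `while R[a] < R[b] do P` -/
  | loop (a b : ℕ) (P : Prog)

/-- The content of the registers and of the arrays. -/
structure State where
  reg : ℕ → ℕ
  arr : ℕ → ℕ → ℕ

/-- Write `x` to register `d`. -/
def State.setReg (s : State) (d x : ℕ) : State :=
  { s with reg := Function.update s.reg d x }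

/-- Write `x` to cell `i` of array `a`. -/
def State.setCell (s : State) (a i x : ℕ) : State :=
  { s with arr := Function.update s.arr a (Function.update (s.arr a) i x) }

/-- `Exec W P s t s'`: on a machine whose words hold the numbers `0, …, W`, the program `P`
started in state `s` halts in state `s'` after exactly `t` steps, without overflow: every number
that is written during the run is at most `W`. -/
inductive Exec (W : ℕ) : Prog → State → ℕ → State → Prop
  | nop (s : State) : Exec W .nop s 1 s
  | const (s : State) (d c : ℕ) (hW : c ≤ W) :
      Exec W (.const d c) s 1 (s.setReg d c)
  | arith (s : State) (o : ArithOp) (d a b : ℕ) (hW : o.eval (s.reg a) (s.reg b) ≤ W) :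
      Exec W (.arith o d a b) s 1 (s.setReg d (o.eval (s.reg a) (s.reg b)))
  | load (s : State) (d a i : ℕ) (hW : s.arr a (s.reg i) ≤ W) :
      Exec W (.load d a i) s 1 (s.setReg d (s.arr a (s.reg i)))
  | store (s : State) (a i r : ℕ) (hW : s.reg r ≤ W) :
      Exec W (.store a i r) s 1 (s.setCell a (s.reg i) (s.reg r))
  | seq {P P' : Prog} {s s' s'' : State} {t t' : ℕ}
      (h : Exec W P s t s') (h' : Exec W P' s' t' s'') :
      Exec W (.seq P P') s (t + t') s''
  | ite_true {a b : ℕ} {P P' : Prog} {s s' : State} {t : ℕ} (hc : s.reg a < s.reg b)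
      (h : Exec W P s t s') : Exec W (.ite a b P P') s (t + 1) s'
  | ite_false {a b : ℕ} {P P' : Prog} {s s' : State} {t : ℕ} (hc : ¬ s.reg a < s.reg b)
      (h : Exec W P' s t s') : Exec W (.ite a b P P') s (t + 1) s'
  | loop_true {a b : ℕ} {P : Prog} {s s' s'' : State} {t t' : ℕ} (hc : s.reg a < s.reg b)
      (h : Exec W P s t s') (h' : Exec W (.loop a b P) s' t' s'') :
      Exec W (.loop a b P) s (t + t' + 1) s''
  | loop_false {a b : ℕ} {P : Prog} {s : State} (hc : ¬ s.reg a < s.reg b) :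
      Exec W (.loop a b P) s 1 s

/-! ### Input and output -/

/-- A matrix written row by row: entry `(i, j)` is in cell `i * b + j`; all cells behind the
matrix hold `0`. -/
def matrixCells {a b : ℕ} (M : Fin a → Fin b → ℕ) (c : ℕ) : ℕ :=
  if h : c < a * b then
    M (finProdFinEquiv.symm ⟨c, h⟩).1 (finProdFinEquiv.symm ⟨c, h⟩).2
  else 0

open Classical in
/-- The initial state on the instance `(G, p)` with vertex set `{0, …, n - 1}`: register `0` holds
`n`, array `0` the adjacency matrix of `G`, array `1` the `k × n` matrix of the profits;
everything else is `0`. -/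
noncomputable def inputState {n k : ℕ} (G : SimpleGraph (Fin n)) (p : Fin k → Fin n → ℕ) :
    State where
  reg := fun r => if r = 0 then n else 0
  arr := fun a =>
    if a = 0 then matrixCells fun u v : Fin n => if G.Adj u v then 1 else 0
    else if a = 1 then matrixCells p
    else fun _ => 0

/-- The final state lists the elements of the set `S` of `k`-tuples, without repetition: register
`0` holds their number, and the tuples stand one after the other in array `2`. -/
def OutputsTuples {k : ℕ} (s : State) (S : Set (Fin k → ℕ)) : Prop :=
  Set.BijOn (fun (i : ℕ) (j : Fin k) => s.arr 2 (i * k + j)) (Set.Iio (s.reg 0)) S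

/-- The final state describes the sequence `X` of vertex sets: cell `v` of array `3` holds the
colour of `v`, where `0` stands for no colour and `j + 1` for membership in `X j`. -/
def OutputsColoring {n k : ℕ} (s : State) (X : Fin k → Finset (Fin n)) : Prop :=
  ∀ v : Fin n, s.arr 3 v ≤ k ∧ ∀ j : Fin k, v ∈ X j ↔ s.arr 3 v = j + 1

end FairDivision

open FairDivision

namespace FairDivision

/-! ### Program logic -/

/-! Let `D` be a transitive orientation of the complement of `G`. Two distinct vertices are joined
by an arc of `D` exactly when they are not adjacent in `G`, so an independent set is a chain of `D`.
Part (b) follows: by transitivity consecutive arcs give arcs between all pairs, and a topological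
sort fixes their direction (`isChain_map_iff`); a sort exists as a linear extension.

For part (a), insert the vertices in a topological order. By transitivity a vertex `v` may join a
colour class as soon as there is an arc to `v` from the last vertex of that class
(`arc_of_mayFollow`), and every colouring of the enlarged vertex set arises in this way
(`IsColoringOn.mayFollow`). The possible continuations of a partial colouring and their profits
therefore depend only on the `k` last vertices and the `k` profits, coded as two numbers in bases `n
+ 1` and `Q + 1` (`Represents.extend`). There are at most `(n + 1) ^ k * (Q + 1) ^ k` such states.
The table keeps one colouring per state reached, with a pointer to its parent; a visited array
excludes repetitions. At the end the profit codes are listed without repetition, the item with the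
greatest minimum is kept, and parent pointers recover its colouring.

Only `G` is given, so an orientation has to be computed. Edges that force each other's direction are
grouped into classes, and each class is directed like its lexicographically least pair. This is
transitive if any transitive orientation exists (`lexArc_isTransitiveOrientation`); the core is that
a cyclic triangle persists when one arc moves through its class (`implies_of_cyclic_triangle`).
Scanning the pairs in increasing order and closing each new class by a queue takes cubic time,
within the bound since `k ≥ 1`. In-degree increases strictly along the arcs (`columnSum_lt`), so
processing by in-degree is a topological order.

The machine part is a weakest-precondition calculus `Runs` with time and overflow conditions, a
frame rule, and loop rules. `bounds_pow` supplies the word size and `timeBound_le` the final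
constant. -/

@[simp] theorem State.reg_setReg (s : State) (d x r : ℕ) :
    (s.setReg d x).reg r = if r = d then x else s.reg r := by
  simp [State.setReg, Function.update_apply]

@[simp] theorem State.arr_setReg (s : State) (d x : ℕ) : (s.setReg d x).arr = s.arr := rfl

@[simp] theorem State.reg_setCell (s : State) (a i x : ℕ) : (s.setCell a i x).reg = s.reg := rfl

@[simp] theorem State.arr_setCell (s : State) (a i x b : ℕ) :
    (s.setCell a i x).arr b = if b = a then Function.update (s.arr b) i x else s.arr b := by
  by_cases h : b = a
  · subst h; simp [State.setCell]
  · simp [State.setCell, h]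

/-- `P` halts without overflow from `s`, with a running time and a final state satisfying `Q`. -/
def Runs (W : ℕ) (P : Prog) (s : State) (Q : ℕ → State → Prop) : Prop :=
  ∃ t s', Exec W P s t s' ∧ Q t s'

theorem Runs.mono {W : ℕ} {P : Prog} {s : State} {Q Q' : ℕ → State → Prop}
    (h : Runs W P s Q) (hQ : ∀ t s', Q t s' → Q' t s') : Runs W P s Q' := by
  obtain ⟨t, s', he, hq⟩ := h
  exact ⟨t, s', he, hQ _ _ hq⟩

@[simp] theorem runs_nop {W : ℕ} {s : State} {Q : ℕ → State → Prop} : Runs W .nop s Q ↔ Q 1 s := by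
  constructor
  · rintro ⟨t, s', he, hq⟩; cases he; exact hq
  · intro h; exact ⟨1, s, .nop s, h⟩

@[simp] theorem runs_const {W d c : ℕ} {s : State} {Q : ℕ → State → Prop} :
    Runs W (.const d c) s Q ↔ c ≤ W ∧ Q 1 (s.setReg d c) := by
  constructor
  · rintro ⟨t, s', he, hq⟩; cases he; exact ⟨by assumption, hq⟩
  · rintro ⟨hw, h⟩; exact ⟨1, _, .const s d c hw, h⟩

@[simp] theorem runs_arith {W d a b : ℕ} {o : ArithOp} {s : State} {Q : ℕ → State → Prop} :
    Runs W (.arith o d a b) s Q ↔ o.eval (s.reg a) (s.reg b) ≤ W ∧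
      Q 1 (s.setReg d (o.eval (s.reg a) (s.reg b))) := by
  constructor
  · rintro ⟨t, s', he, hq⟩; cases he; exact ⟨by assumption, hq⟩
  · rintro ⟨hw, h⟩; exact ⟨1, _, .arith s o d a b hw, h⟩

@[simp] theorem runs_load {W d a i : ℕ} {s : State} {Q : ℕ → State → Prop} :
    Runs W (.load d a i) s Q ↔ s.arr a (s.reg i) ≤ W ∧
      Q 1 (s.setReg d (s.arr a (s.reg i))) := by
  constructor
  · rintro ⟨t, s', he, hq⟩; cases he; exact ⟨by assumption, hq⟩
  · rintro ⟨hw, h⟩; exact ⟨1, _, .load s d a i hw, h⟩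

@[simp] theorem runs_store {W a i r : ℕ} {s : State} {Q : ℕ → State → Prop} :
    Runs W (.store a i r) s Q ↔ s.reg r ≤ W ∧ Q 1 (s.setCell a (s.reg i) (s.reg r)) := by
  constructor
  · rintro ⟨t, s', he, hq⟩; cases he; exact ⟨by assumption, hq⟩
  · rintro ⟨hw, h⟩; exact ⟨1, _, .store s a i r hw, h⟩

@[simp] theorem runs_seq {W : ℕ} {P P' : Prog} {s : State} {Q : ℕ → State → Prop} :
    Runs W (.seq P P') s Q ↔ Runs W P s fun t s' => Runs W P' s' fun t' => Q (t + t') := by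
  constructor
  · rintro ⟨t, s', he, hq⟩; cases he with | seq h h' => exact ⟨_, _, h, _, _, h', hq⟩
  · rintro ⟨t, s', h, t', s'', h', hq⟩; exact ⟨_, _, .seq h h', hq⟩

@[simp] theorem runs_ite {W a b : ℕ} {P P' : Prog} {s : State} {Q : ℕ → State → Prop} :
    Runs W (.ite a b P P') s Q ↔
      (s.reg a < s.reg b → Runs W P s fun t => Q (t + 1)) ∧
      (¬ s.reg a < s.reg b → Runs W P' s fun t => Q (t + 1)) := by
  constructor
  · rintro ⟨t, s', he, hq⟩
    cases he with
    | ite_true hc h => exact ⟨fun _ => ⟨_, _, h, hq⟩, fun h' => absurd hc h'⟩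
    | ite_false hc h => exact ⟨fun h' => absurd h' hc, fun _ => ⟨_, _, h, hq⟩⟩
  · rintro ⟨h1, h2⟩
    by_cases hc : s.reg a < s.reg b
    · obtain ⟨t, s', h, hq⟩ := h1 hc; exact ⟨_, _, .ite_true hc h, hq⟩
    · obtain ⟨t, s', h, hq⟩ := h2 hc; exact ⟨_, _, .ite_false hc h, hq⟩

attribute [simp] ArithOp.eval

/-! ### Frame rule: what a program cannot change. -/

/-- The registers that occur as a target in a program. -/
def Prog.writesReg : Prog → ℕ → Bool
  | .nop, _ => false
  | .const d _, r => r == d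
  | .arith _ d _ _, r => r == d
  | .load d _ _, r => r == d
  | .store _ _ _, _ => false
  | .seq P P', r => P.writesReg r || P'.writesReg r
  | .ite _ _ P P', r => P.writesReg r || P'.writesReg r
  | .loop _ _ P, r => P.writesReg r

/-- The arrays that occur as a target in a program. -/
def Prog.writesArr : Prog → ℕ → Bool
  | .nop, _ => false
  | .const _ _, _ => false
  | .arith _ _ _ _, _ => false
  | .load _ _ _, _ => false
  | .store a _ _, b => b == a
  | .seq P P', r => P.writesArr r || P'.writesArr r
  | .ite _ _ P P', r => P.writesArr r || P'.writesArr r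
  | .loop _ _ P, r => P.writesArr r

/-- `s` and `s'` agree on everything that `P` does not write. -/
structure Frame (P : Prog) (s s' : State) : Prop where
  reg' : ∀ r, P.writesReg r = false → s'.reg r = s.reg r
  arr' : ∀ a, P.writesArr a = false → s'.arr a = s.arr a

/-- On a concrete program the side condition is a Boolean that evaluates, so the default `rfl`
discharges it. -/
theorem Frame.reg {P : Prog} {s s' : State} (h : Frame P s s') (r : ℕ)
    (hr : P.writesReg r = false := by rfl) : s'.reg r = s.reg r := h.reg' r hr

theorem Frame.arr {P : Prog} {s s' : State} (h : Frame P s s') (a : ℕ)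
    (ha : P.writesArr a = false := by rfl) : s'.arr a = s.arr a := h.arr' a ha

theorem Frame.rfl {P : Prog} {s : State} : Frame P s s :=
  ⟨fun _ _ => Eq.refl _, fun _ _ => Eq.refl _⟩

theorem Frame.seq {P P' : Prog} {s s' s'' : State} (h : Frame P s s') (h' : Frame P' s' s'') :
    Frame (.seq P P') s s'' := by
  constructor
  · intro r hr
    simp only [Prog.writesReg, Bool.or_eq_false_iff] at hr
    rw [h'.reg' r hr.2, h.reg' r hr.1]
  · intro r hr
    simp only [Prog.writesArr, Bool.or_eq_false_iff] at hr
    rw [h'.arr' r hr.2, h.arr' r hr.1]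

theorem Exec.frame {W : ℕ} {P : Prog} {s s' : State} {t : ℕ} (h : Exec W P s t s') :
    Frame P s s' := by
  induction h with
  | nop s => exact Frame.rfl
  | const s d c =>
    refine ⟨fun r hr => ?_, fun a ha => Eq.refl _⟩
    simp [Prog.writesReg] at hr
    simp [State.reg_setReg, hr]
  | arith s o d a b =>
    refine ⟨fun r hr => ?_, fun a ha => Eq.refl _⟩
    simp [Prog.writesReg] at hr
    simp [State.reg_setReg, hr]
  | load s d a i =>
    refine ⟨fun r hr => ?_, fun a ha => Eq.refl _⟩
    simp [Prog.writesReg] at hr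
    simp [State.reg_setReg, hr]
  | store s a i r =>
    refine ⟨fun r hr => Eq.refl _, fun a ha => ?_⟩
    simp [Prog.writesArr] at ha
    simp [State.arr_setCell, ha]
  | seq _ _ ih ih' => exact ih.seq ih'
  | ite_true _ _ ih =>
    constructor
    · intro r hr
      simp only [Prog.writesReg, Bool.or_eq_false_iff] at hr
      exact ih.reg' r hr.1
    · intro r hr
      simp only [Prog.writesArr, Bool.or_eq_false_iff] at hr
      exact ih.arr' r hr.1
  | ite_false _ _ ih =>
    constructor
    · intro r hr
      simp only [Prog.writesReg, Bool.or_eq_false_iff] at hr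
      exact ih.reg' r hr.2
    · intro r hr
      simp only [Prog.writesArr, Bool.or_eq_false_iff] at hr
      exact ih.arr' r hr.2
  | loop_true _ _ _ ih ih' =>
    exact ⟨fun r hr => (ih'.reg' r hr).trans (ih.reg' r hr),
      fun r hr => (ih'.arr' r hr).trans (ih.arr' r hr)⟩
  | loop_false => exact Frame.rfl

theorem Runs.frame {W : ℕ} {P : Prog} {s : State} {Q : ℕ → State → Prop}
    (h : Runs W P s Q) : Runs W P s fun t s' => Q t s' ∧ Frame P s s' := by
  obtain ⟨t, s', he, hq⟩ := h
  exact ⟨t, s', he, hq, he.frame⟩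

/-! ### Loop rules with time bounds. -/

/-- Loops with an invariant `I` that is indexed by a decreasing measure. -/
theorem runs_loop {W a b : ℕ} {P : Prog} (T : ℕ) (I : ℕ → State → Prop)
    (hbody : ∀ m s, I m s → s.reg a < s.reg b →
      Runs W P s fun t s' => t ≤ T ∧ ∃ m' < m, I m' s') :
    ∀ m s, I m s → Runs W (.loop a b P) s fun t s' =>
      t ≤ m * (T + 1) + 1 ∧ ¬ s'.reg a < s'.reg b ∧ ∃ m', I m' s' := by
  intro m
  induction m using Nat.strong_induction_on with
  | _ m ih =>
    intro s hs
    by_cases hc : s.reg a < s.reg b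
    · obtain ⟨t, s', he, ht, m', hm, hI⟩ := hbody m s hs hc
      obtain ⟨t', s'', he', ht', h⟩ := ih m' hm s' hI
      refine ⟨_, _, .loop_true hc he he', ?_, h⟩
      have : (m' + 1) * (T + 1) ≤ m * (T + 1) := Nat.mul_le_mul_right _ hm
      rw [add_mul] at this
      omega
    · exact ⟨1, s, .loop_false hc, by omega, hc, m, hs⟩

/-- `for R[i] := 0 to R[b] - 1 do P`, on machines whose register `1` holds `1`. -/
def Prog.forLoop (i b : ℕ) (P : Prog) : Prog :=
  .seq (.const i 0) (.loop i b (.seq P (.arith .add i i 1)))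

/-- The measure is `N` minus the counter, and `T + 2` pays for the body, the increment and the test.
The body may assume the frame of the whole loop, so an invariant need only speak of what the loop
writes. -/
theorem runs_forLoop {W i b : ℕ} {P : Prog} {s : State} (N T : ℕ) (I : ℕ → State → Prop)
    (h1 : s.reg 1 = 1) (hN : s.reg b = N) (hW : N ≤ W)
    (hPi : P.writesReg i = false) (hPb : P.writesReg b = false) (hP1 : P.writesReg 1 = false)
    (hi1 : 1 ≠ i) (hib : b ≠ i)
    (h0 : I 0 (s.setReg i 0))
    (hbody : ∀ m s', m < N → Frame (Prog.forLoop i b P) s s' → s'.reg i = m → I m s' →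
      Runs W P s' fun t s'' => t ≤ T ∧ I (m + 1) (s''.setReg i (m + 1))) :
    Runs W (Prog.forLoop i b P) s fun t s' => t ≤ N * (T + 2) + 2 ∧ I N s' := by
  have key := runs_loop (W := W) (a := i) (b := b) (P := .seq P (.arith .add i i 1)) (T + 1)
    (fun m s' => m + s'.reg i = N ∧ Frame (Prog.forLoop i b P) s s' ∧ I (s'.reg i) s') ?_
    N (s.setReg i 0) ?_
  · rw [Prog.forLoop, runs_seq, runs_const]
    refine ⟨Nat.zero_le _, (key.mono ?_)⟩
    rintro t s' ⟨ht, hc, m', hm', hF, hI⟩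
    have hb : s'.reg b = N := by
      rw [hF.reg' b (by simp [Prog.forLoop, Prog.writesReg, hPb, hib]), hN]
    have : s'.reg i = N := by omega
    rw [this] at hI
    exact ⟨by linarith, hI⟩
  · rintro m s' ⟨hm, hF, hI⟩ hc
    have hb : s'.reg b = N := by
      rw [hF.reg' b (by simp [Prog.forLoop, Prog.writesReg, hPb, hib]), hN]
    rw [runs_seq]
    refine (hbody _ s' (by omega) hF rfl hI).frame.mono ?_
    rintro t s'' ⟨⟨ht, hI'⟩, hF'⟩
    have e1 : s''.reg 1 = 1 := by
      rw [hF'.reg' 1 hP1, hF.reg' 1 (by simp [Prog.forLoop, Prog.writesReg, hP1, hi1]), h1]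
    have ei : s''.reg i = s'.reg i := hF'.reg' i hPi
    rw [runs_arith]
    simp only [ArithOp.eval, e1, ei]
    refine ⟨by omega, by omega, m - 1, by omega, ?_, ?_, ?_⟩
    · simp [State.reg_setReg]; omega
    · constructor
      · intro r hr
        have : r ≠ i := by rintro rfl; simp [Prog.forLoop, Prog.writesReg] at hr
        rw [← hF.reg' r hr]
        simp only [Prog.forLoop, Prog.writesReg, Bool.or_eq_false_iff] at hr
        simp [State.reg_setReg, this, hF'.reg' r hr.2.1]
      · intro r hr
        rw [← hF.arr' r hr]
        simp only [Prog.forLoop, Prog.writesArr, Bool.or_eq_false_iff] at hr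
        simp [State.arr_setReg, hF'.arr' r hr.2.1]
    · simpa [State.reg_setReg] using hI'
  · refine ⟨by simp [State.reg_setReg], ?_, by simpa [State.reg_setReg] using h0⟩
    constructor
    · intro r hr
      have : r ≠ i := by rintro rfl; simp [Prog.forLoop, Prog.writesReg] at hr
      simp [State.reg_setReg, this]
    · intro r hr
      rfl

/-! ### The lexicographic orientation of a comparability graph -/

section Orientation

variable {n : ℕ} {H : SimpleGraph (Fin n)}

/-- The number of an ordered pair of vertices. -/
def pairCode (x : Fin n × Fin n) : ℕ := x.1 * n + x.2

theorem pairCode_injective : Function.Injective (pairCode (n := n)) := by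
  rintro ⟨a, b⟩ ⟨a', b'⟩ h
  simp only [pairCode] at h
  have hb : (b : ℕ) = b' := by
    have := congrArg (· % n) h
    simpa [Nat.mod_eq_of_lt] using this
  have ha : (a : ℕ) = a' := Nat.eq_of_mul_eq_mul_right a.pos (by omega)
  simp [Fin.ext_iff, ha, hb]

theorem pairCode_lt (x : Fin n × Fin n) : pairCode x < n * n := by
  have h1 := x.1.2
  have h2 := x.2.2
  have : ((x.1 : ℕ) + 1) * n ≤ n * n := Nat.mul_le_mul_right _ h1
  rw [add_mul] at this
  simp only [pairCode]
  omega

/-- Two edges with a common end whose other ends are equal or not adjacent: in a transitive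
orientation, the direction of one forces the direction of the other. -/
def Force (H : SimpleGraph (Fin n)) (x y : Fin n × Fin n) : Prop :=
  H.Adj x.1 x.2 ∧ H.Adj y.1 y.2 ∧
    ((x.1 = y.1 ∧ ¬ H.Adj x.2 y.2) ∨ (x.2 = y.2 ∧ ¬ H.Adj x.1 y.1))

theorem Force.symm {x y : Fin n × Fin n} (h : Force H x y) : Force H y x := by
  obtain ⟨h1, h2, h3⟩ := h
  refine ⟨h2, h1, ?_⟩
  rcases h3 with ⟨e, h⟩ | ⟨e, h⟩
  · exact Or.inl ⟨e.symm, fun h' => h h'.symm⟩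
  · exact Or.inr ⟨e.symm, fun h' => h h'.symm⟩

theorem Force.swap {x y : Fin n × Fin n} (h : Force H x y) : Force H x.swap y.swap :=
  ⟨h.1.symm, h.2.1.symm, h.2.2.symm⟩

/-- The equivalence relation generated by `Force`. -/
abbrev Implies (H : SimpleGraph (Fin n)) : Fin n × Fin n → Fin n × Fin n → Prop :=
  Relation.ReflTransGen (Force H)

theorem Implies.symm {x y : Fin n × Fin n} (h : Implies H x y) : Implies H y x := by
  induction h with
  | refl => exact .refl
  | tail _ h ih => exact .head h.symm ih

theorem Implies.swap {x y : Fin n × Fin n} (h : Implies H x y) : Implies H x.swap y.swap := by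
  induction h with
  | refl => exact .refl
  | tail _ h ih => exact ih.tail h.swap

theorem Implies.adj {x y : Fin n × Fin n} (h : Implies H x y) (hx : H.Adj x.1 x.2) :
    H.Adj y.1 y.2 := by
  induction h with
  | refl => exact hx
  | tail _ h _ => exact h.2.1

theorem IsTransitiveOrientation.asymm {V : Type*} {H : SimpleGraph V} {F : V → V → Prop}
    (hF : IsTransitiveOrientation H F) {u v : V} (h : F u v) : ¬ F v u := by
  rcases hF.exactly_one u v (hF.adj_of_arc u v h) with h' | h'
  · exact h'.2
  · exact absurd h h'.2

theorem IsTransitiveOrientation.arc_or_arc {V : Type*} {H : SimpleGraph V} {F : V → V → Prop}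
    (hF : IsTransitiveOrientation H F) {u v : V} (h : H.Adj u v) : F u v ∨ F v u := by
  rcases hF.exactly_one u v h with h' | h'
  · exact .inl h'.1
  · exact .inr h'.1

/-- If two edges of a forcing were directed inconsistently, transitivity through their common end
would make the two other ends adjacent. So every transitive orientation is constant on classes. -/
theorem Implies.arc {F : Fin n → Fin n → Prop} (hF : IsTransitiveOrientation H F)
    {x y : Fin n × Fin n} (h : Implies H x y) (hx : F x.1 x.2) : F y.1 y.2 := by
  induction h with
  | refl => exact hx
  | @tail y z _ h ih =>
    obtain ⟨y1, y2⟩ := y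
    obtain ⟨z1, z2⟩ := z
    obtain ⟨-, hz, ⟨e, h⟩ | ⟨e, h⟩⟩ := h
    · dsimp only at *
      subst e
      rcases hF.arc_or_arc hz with h' | h'
      · exact h'
      · exact absurd (hF.adj_of_arc _ _ (hF.trans _ _ _ h' ih)).symm h
    · dsimp only at *
      subst e
      rcases hF.arc_or_arc hz with h' | h'
      · exact h'
      · exact absurd (hF.adj_of_arc _ _ (hF.trans _ _ _ ih h')) h

/-- The least number of an ordered pair in the class of `x`. -/
noncomputable def leastCode (H : SimpleGraph (Fin n)) (x : Fin n × Fin n) : ℕ :=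
  sInf {c | ∃ y, Implies H x y ∧ pairCode y = c}

theorem exists_leastCode (x : Fin n × Fin n) :
    ∃ y, Implies H x y ∧ pairCode y = leastCode H x :=
  Nat.sInf_mem (s := {c | ∃ y, Implies H x y ∧ pairCode y = c}) ⟨_, x, .refl, rfl⟩

theorem leastCode_le {x y : Fin n × Fin n} (h : Implies H x y) : leastCode H x ≤ pairCode y :=
  Nat.sInf_le ⟨y, h, rfl⟩

theorem Implies.leastCode_eq {x y : Fin n × Fin n} (h : Implies H x y) :
    leastCode H x = leastCode H y := by
  apply le_antisymm
  · obtain ⟨z, hz, e⟩ := exists_leastCode (H := H) y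
    exact e ▸ leastCode_le (h.trans hz)
  · obtain ⟨z, hz, e⟩ := exists_leastCode (H := H) x
    exact e ▸ leastCode_le (h.symm.trans hz)

theorem implies_of_leastCode_eq {x y : Fin n × Fin n} (h : leastCode H x = leastCode H y) :
    Implies H x y := by
  obtain ⟨z, hz, e⟩ := exists_leastCode (H := H) x
  obtain ⟨z', hz', e'⟩ := exists_leastCode (H := H) y
  have : z = z' := pairCode_injective (by rw [e, e', h])
  subst this
  exact hz.trans hz'.symm

/-- Equal least codes would put an edge and its reversal into one class. The existence of some
transitive orientation enters the correctness of the lexicographic one only here. -/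
theorem leastCode_ne_swap (hH : IsComparabilityGraph H) {a b : Fin n} (h : H.Adj a b) :
    leastCode H (a, b) ≠ leastCode H (b, a) := by
  obtain ⟨F, hF⟩ := hH
  intro e
  have hi := implies_of_leastCode_eq e
  rcases hF.arc_or_arc h with h' | h'
  · exact hF.asymm h' (hi.arc hF h')
  · exact hF.asymm h' (hi.symm.arc hF h')

/-- The arcs of the lexicographic orientation: every class is directed like its least pair. -/
def LexArc (H : SimpleGraph (Fin n)) (a b : Fin n) : Prop :=
  H.Adj a b ∧ leastCode H (a, b) < leastCode H (b, a)

theorem LexArc.asymm {a b : Fin n} (h : LexArc H a b) : ¬ LexArc H b a :=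
  fun h' => lt_asymm h.2 h'.2

theorem Implies.lexArc {a b a' b' : Fin n} (h : Implies H (a, b) (a', b')) (hx : LexArc H a b) :
    LexArc H a' b' :=
  ⟨h.adj hx.1, by
    have h1 := h.leastCode_eq
    have h2 := h.swap.leastCode_eq
    simp only [Prod.swap_prod_mk] at h2
    rw [← h1, ← h2]; exact hx.2⟩

theorem lexArc_or_lexArc (hH : IsComparabilityGraph H) {a b : Fin n} (h : H.Adj a b) :
    LexArc H a b ∨ LexArc H b a := by
  rcases lt_or_gt_of_ne (leastCode_ne_swap hH h) with h' | h'
  · exact .inl ⟨h, h'⟩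
  · exact .inr ⟨h.symm, h'⟩

/-- The arc opposite to `a` can be moved through its whole class while the triangle stays cyclic,
and the two arcs at `a` stay in their classes. -/
theorem implies_of_cyclic_triangle {a b c : Fin n} (hab : LexArc H a b) (hca : LexArc H c a)
    (hbc : LexArc H b c) {y : Fin n × Fin n} (h : Implies H (b, c) y) :
    Implies H (a, b) (a, y.1) ∧ Implies H (a, c) (a, y.2) := by
  induction h with
  | refl => exact ⟨.refl, .refl⟩
  | @tail y z hy h ih =>
    obtain ⟨b1, c1⟩ := y
    obtain ⟨b2, c2⟩ := z
    obtain ⟨i1, i2⟩ := ih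
    have hz := Implies.lexArc (hy.tail h) hbc
    obtain ⟨hbc1, hbc2, ⟨e, h⟩ | ⟨e, h⟩⟩ := h
    · dsimp only at *
      subst e
      refine ⟨i1, ?_⟩
      have h1 : LexArc H a b1 := i1.lexArc hab
      -- Otherwise `(b1, c2)` forces `(b1, a)`, against the arc from `a` to `b1`.
      have h2 : H.Adj a c2 := by
        by_contra hn
        have : Force H (b1, c2) (b1, a) := ⟨hbc2, h1.1.symm, .inl ⟨rfl, fun h => hn h.symm⟩⟩
        exact h1.asymm (Implies.lexArc (.single this) hz)
      exact i2.tail ⟨i2.adj hca.1.symm, h2, .inl ⟨rfl, h⟩⟩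
    · dsimp only at *
      subst e
      refine ⟨?_, i2⟩
      have h1 : LexArc H c1 a := by
        have := i2.swap
        exact this.lexArc hca
      have h2 : H.Adj a b2 := by
        by_contra hn
        have : Force H (b2, c1) (a, c1) := ⟨hbc2, h1.1.symm, .inr ⟨rfl, fun h => hn h.symm⟩⟩
        exact h1.asymm (Implies.lexArc (.single this) hz)
      exact i1.tail ⟨i1.adj hab.1, h2, .inl ⟨rfl, h⟩⟩

/-- Move `(b, c)` to the least pair `(x, y)` of its class. The least pair of the class of `(a, x)`
is then squeezed between `(x, y)` and `(x, a)`, so it starts with `x`; moving the arc `(a, x)` to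
that pair yields a contradiction at `y`. -/
theorem no_cyclic_triangle_of_le {a b c : Fin n} (hab : LexArc H a b) (hbc : LexArc H b c)
    (hca : LexArc H c a) (hle : leastCode H (b, c) ≤ leastCode H (a, b)) : False := by
  obtain ⟨⟨x, y⟩, hxy, e⟩ := exists_leastCode (H := H) (b, c)
  obtain ⟨i1, i2⟩ := implies_of_cyclic_triangle hab hca hbc hxy
  have hax : LexArc H a x := i1.lexArc hab
  have hxy' : LexArc H x y := hxy.lexArc hbc
  have hya : LexArc H y a := by
    have := i2.swap
    exact this.lexArc hca
  obtain ⟨⟨r, s⟩, hrs, e'⟩ := exists_leastCode (H := H) (a, x)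
  have h1 : pairCode (x, y) ≤ pairCode (r, s) := by
    rw [e, e', ← i1.leastCode_eq]; exact hle
  have h2 : pairCode (r, s) < pairCode (x, a) := by
    rw [e']; exact hax.2.trans_le (leastCode_le .refl)
  simp only [pairCode] at h1 h2
  -- Both bounds on the code of `(r, s)` are codes of pairs with first entry `x`.
  have hrx : r = x := by
    have hs := s.2
    have ha := a.2
    rcases lt_trichotomy (r : ℕ) x with h | h | h
    · have : ((r : ℕ) + 1) * n ≤ x * n := Nat.mul_le_mul_right _ h
      rw [add_mul] at this
      omega
    · exact Fin.ext h
    · have : ((x : ℕ) + 1) * n ≤ r * n := Nat.mul_le_mul_right _ h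
      rw [add_mul] at this
      omega
  subst hrx
  -- Now `y` is the fixed vertex and `(a, x)` moves to `(x, s)`: the arc `(y, a)` lies in the class
  -- of `(y, x)`.
  have := (implies_of_cyclic_triangle hya hxy' hax hrs).1
  exact hxy'.asymm (this.lexArc hya)

/-- Least codes cannot increase strictly all the way around the triangle. -/
theorem no_cyclic_triangle {a b c : Fin n} (hab : LexArc H a b) (hbc : LexArc H b c)
    (hca : LexArc H c a) : False := by
  by_cases h1 : leastCode H (b, c) ≤ leastCode H (a, b)
  · exact no_cyclic_triangle_of_le hab hbc hca h1
  by_cases h2 : leastCode H (c, a) ≤ leastCode H (b, c)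
  · exact no_cyclic_triangle_of_le hbc hca hab h2
  exact no_cyclic_triangle_of_le hca hab hbc (by omega)

/-- If `a` and `c` are not adjacent, `(a, b)` forces `(c, b)`, against `b → c`; if they are, the
wrong direction would close a cyclic triangle. -/
theorem lexArc_isTransitiveOrientation (hH : IsComparabilityGraph H) :
    IsTransitiveOrientation H (LexArc H) where
  adj_of_arc _ _ h := h.1
  exactly_one u v h := by
    rcases lexArc_or_lexArc hH h with h' | h'
    · exact .inl ⟨h', h'.asymm⟩
    · exact .inr ⟨h', h'.asymm⟩
  trans a b c hab hbc := by
    by_cases hac : H.Adj a c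
    · exact (lexArc_or_lexArc hH hac).resolve_right fun h => no_cyclic_triangle hab hbc h
    · have : Force H (a, b) (c, b) := ⟨hab.1, hbc.1.symm, .inr ⟨rfl, hac⟩⟩
      exact absurd (Implies.lexArc (.single this) hab) hbc.asymm

/-- The arcs of the lexicographic orientation whose class has a pair with a number below `e`. -/
def LexArcBelow (H : SimpleGraph (Fin n)) (e : ℕ) (x : Fin n × Fin n) : Prop :=
  LexArc H x.1 x.2 ∧ leastCode H x < e

theorem LexArcBelow.of_implies {e : ℕ} {x y : Fin n × Fin n} (hx : LexArcBelow H e x)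
    (h : Implies H x y) : LexArcBelow H e y :=
  ⟨h.lexArc hx.1, h.leastCode_eq ▸ hx.2⟩

theorem LexArcBelow.mono {e e' : ℕ} {x : Fin n × Fin n} (hx : LexArcBelow H e x)
    (h : e ≤ e') : LexArcBelow H e' x :=
  ⟨hx.1, hx.2.trans_le h⟩

theorem lexArcBelow_all {x : Fin n × Fin n} : LexArcBelow H (n * n) x ↔ LexArc H x.1 x.2 :=
  ⟨fun h => h.1, fun h => ⟨h, (leastCode_le .refl).trans_lt (pairCode_lt x)⟩⟩

/-- An unmarked edge opens a new class. -/
theorem lexArcBelow_succ_pairCode (hH : IsComparabilityGraph H) {x : Fin n × Fin n}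
    (hx : H.Adj x.1 x.2)
    (h2 : ¬ LexArcBelow H (pairCode x) x.swap) : LexArcBelow H (pairCode x + 1) x := by
  have hle : leastCode H x ≤ pairCode x := leastCode_le .refl
  rcases lexArc_or_lexArc hH hx with h | h
  · exact ⟨h, by omega⟩
  -- Were the reversal the arc, its class would have the smaller least code and would already be
  -- open.
  · exact absurd ⟨h, lt_of_lt_of_le h.2 hle⟩ h2

/-- One step of the scan adds at most one class: the one whose least pair has number `e`, and only
if that pair is an edge with neither direction present. -/
theorem LexArcBelow.of_succ {e : ℕ} {y : Fin n × Fin n} (hy : LexArcBelow H (e + 1) y) :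
    LexArcBelow H e y ∨ leastCode H y = e ∧ ∃ x : Fin n × Fin n, pairCode x = e ∧
      H.Adj x.1 x.2 ∧ ¬ LexArcBelow H e x ∧ ¬ LexArcBelow H e x.swap := by
  by_cases h : leastCode H y < e
  · exact .inl ⟨hy.1, h⟩
  · have he : leastCode H y = e := by have := hy.2; omega
    obtain ⟨x, hx, ex⟩ := exists_leastCode (H := H) y
    refine .inr ⟨he, x, ex.trans he, hx.adj hy.1.1, ?_, ?_⟩
    · rintro ⟨-, h'⟩
      rw [← hx.leastCode_eq] at h'
      exact h h'
    · rintro ⟨h', -⟩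
      exact (hx.lexArc hy.1).asymm h'

end Orientation

/-! ### Computing the complement -/

section Complement

variable {n : ℕ}

theorem matrixCells_apply {a b : ℕ} (M : Fin a → Fin b → ℕ) (i : Fin a) (j : Fin b) :
    matrixCells M (i * b + j) = M i j := by
  have e : (⟨i * b + j, by
      have h1 := i.2
      have h2 := j.2
      have : ((i : ℕ) + 1) * b ≤ a * b := Nat.mul_le_mul_right _ h1
      rw [add_mul] at this
      omega⟩ : Fin (a * b)) = finProdFinEquiv (i, j) := by
    ext
    simp [finProdFinEquiv, mul_comm, add_comm]
  have hlt : (i * b + j : ℕ) < a * b := by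
    have := (finProdFinEquiv (i, j)).2
    rwa [← e] at this
  rw [matrixCells, dif_pos hlt, e, Equiv.symm_apply_apply]

/-- `f` is the matrix of the non-edges (loops included) of `H`. -/
def NonadjCells (H : SimpleGraph (Fin n)) (f : ℕ → ℕ) : Prop :=
  ∀ a b : Fin n, (H.Adj a b → f (pairCode (a, b)) = 0) ∧ (¬ H.Adj a b → f (pairCode (a, b)) = 1)

/-- Write `1` on the diagonal of the matrix in array `0`. -/
def diagProg : Prog :=
  .forLoop 4 0 (.seq (.arith .mul 5 4 0) (.seq (.arith .add 5 5 4) (.store 0 5 1)))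

-- The adjacency matrix of `G` with ones on the diagonal is the matrix of non-edges of the
-- complement, so no new matrix has to be built.
open Classical in
theorem runs_diagProg {W : ℕ} (G : SimpleGraph (Fin n)) {s : State} (hW : n * n + 1 ≤ W)
    (h0 : s.reg 0 = n) (h1 : s.reg 1 = 1)
    (hA : s.arr 0 = matrixCells fun u v : Fin n => if G.Adj u v then 1 else 0) :
    Runs W diagProg s fun t s' => t ≤ n * 5 + 2 ∧ NonadjCells Gᶜ (s'.arr 0) := by
  have hn : n ≤ W := by nlinarith
  refine (runs_forLoop n 3 (fun m s' => ∀ a b : Fin n, s'.arr 0 (pairCode (a, b)) =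
    if G.Adj a b ∨ (a = b ∧ a < m) then 1 else 0) h1 h0 hn rfl rfl rfl (by decide) (by decide)
    ?_ ?_).mono ?_
  · intro a b
    simp only [State.arr_setReg, hA]
    have := matrixCells_apply (fun u v : Fin n => if G.Adj u v then 1 else 0) a b
    simp [pairCode, this]
  · intro m s' hm hF hi hI
    have e0 : s'.reg 0 = n := by rw [hF.reg 0, h0]
    have e1 : s'.reg 1 = 1 := by rw [hF.reg 1, h1]
    have hlt := pairCode_lt ((⟨m, hm⟩, ⟨m, hm⟩) : Fin n × Fin n)
    simp only [pairCode] at hlt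
    simp [e0, e1, hi]
    refine ⟨by omega, by omega, by omega, ?_⟩
    intro a b
    rw [Function.update_apply, hI]
    have : pairCode (a, b) = m * n + m ↔ a = ⟨m, hm⟩ ∧ b = ⟨m, hm⟩ := by
      rw [← Prod.mk.injEq, ← pairCode_injective.eq_iff]; rfl
    simp only [this]
    by_cases hab : a = b
    · subst hab
      simp only [and_self, true_and, G.irrefl, false_or, Fin.ext_iff]
      split_ifs <;> omega
    · rw [if_neg (by rintro ⟨rfl, rfl⟩; exact hab rfl)]
      simp [hab]
  · rintro t s' ⟨ht, hI⟩
    refine ⟨ht, fun a b => ⟨fun h => ?_, fun h => ?_⟩⟩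
    · rw [hI, if_neg]
      rintro (h' | ⟨h', -⟩)
      · exact (SimpleGraph.compl_adj _ _ _ |>.1 h).2 h'
      · exact h.ne h'
    · rw [hI, if_pos]
      rw [SimpleGraph.compl_adj] at h
      by_cases hab : a = b
      · exact .inr ⟨hab, a.2⟩
      · exact .inl (by_contra fun h' => h ⟨hab, h'⟩)

end Complement

/-! ### Computing the lexicographic orientation -/

section Queue

/-- The cells of `M` that hold `1` are listed without repetition in the first `m` cells of `q`,
and satisfy `S`. -/
structure Queue (S : ℕ → Prop) (M q : ℕ → ℕ) (m : ℕ) : Prop where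
  le_one : ∀ c, M c ≤ 1
  marked : ∀ i < m, M (q i) = 1
  mem : ∀ c, M c = 1 → S c ∧ ∃ i < m, q i = c
  inj : ∀ i < m, ∀ j < m, q i = q j → i = j

theorem Queue.push {S : ℕ → Prop} {M q : ℕ → ℕ} {m c : ℕ} (h : Queue S M q m) (hc : M c = 0)
    (hS : S c) : Queue S (Function.update M c 1) (Function.update q m c) (m + 1) where
  le_one c' := by
    rw [Function.update_apply]
    split_ifs
    · exact le_rfl
    · exact h.le_one c'
  marked i hi := by
    simp only [Function.update_apply]
    by_cases him : i = m
    · simp [him]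
    · have := h.marked i (by omega)
      rw [if_neg him, if_neg, this]
      intro e; rw [e, hc] at this; omega
  mem c' hc' := by
    rw [Function.update_apply] at hc'
    split_ifs at hc' with e
    · exact ⟨e ▸ hS, m, by omega, by simp [e]⟩
    · obtain ⟨h1, i, hi, h2⟩ := h.mem c' hc'
      exact ⟨h1, i, by omega, by rw [Function.update_apply, if_neg (by omega), h2]⟩
  inj i hi j hj hij := by
    have key : ∀ i < m, q i ≠ c := fun i hi e => by
      have := h.marked i hi
      rw [e, hc] at this; omega
    simp only [Function.update_apply] at hij
    split_ifs at hij with h1 h2 h2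
    · omega
    · exact absurd hij.symm (key j (by omega))
    · exact absurd hij (key i (by omega))
    · exact h.inj i (by omega) j (by omega) hij

/-- The entries are distinct and satisfy `S`. This bounds the queue length, both against overflow
and for the termination of the orientation loop. -/
theorem Queue.le {S : ℕ → Prop} {M q : ℕ → ℕ} {m N : ℕ} (h : Queue S M q m)
    (hS : ∀ c, S c → c < N) : m ≤ N := by
  have := Finset.card_le_card_of_injOn (s := Finset.range m) (t := Finset.range N) q
    (fun i hi => by
      have := h.mem _ (h.marked i (by simpa using hi))
      simpa using hS _ this.1)
    (fun i hi j hj => h.inj i (by simpa using hi) j (by simpa using hj))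
  simpa using this

theorem Queue.weaken {S S' : ℕ → Prop} {M q : ℕ → ℕ} {m : ℕ} (h : Queue S M q m)
    (hS : ∀ c, S c → S' c) : Queue S' M q m :=
  { h with mem := fun c hc => ⟨hS c (h.mem c hc).1, (h.mem c hc).2⟩ }

/-- The marks and the queue of `s'` extend those of `s`. -/
structure QueueExt (s s' : State) : Prop where
  marked : ∀ c, s.arr 4 c = 1 → s'.arr 4 c = 1
  le : s.reg 12 ≤ s'.reg 12
  eq : ∀ i < s.reg 12, s'.arr 5 i = s.arr 5 i

theorem QueueExt.trans {s s' s'' : State} (h : QueueExt s s') (h' : QueueExt s' s'') :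
    QueueExt s s'' :=
  ⟨fun c hc => h'.marked c (h.marked c hc), h.le.trans h'.le, fun i hi => by
    rw [h'.eq i (hi.trans_le h.le), h.eq i hi]⟩

/-- Mark cell `R[r]` of array `4` and append it to the queue in array `5`, whose length is in
register `12`. -/
def markProg (r : ℕ) : Prog :=
  .seq (.store 4 r 1) (.seq (.store 5 12 r) (.arith .add 12 12 1))

theorem runs_markProg {W r c : ℕ} {S : ℕ → Prop} {s : State} (h1 : s.reg 1 = 1)
    (hr : s.reg r = c) (hc : c < W) (hm : s.reg 12 < W) (hQ : Queue S (s.arr 4) (s.arr 5) (s.reg 12))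
    (hM : s.arr 4 c = 0) (hS : S c) :
    Runs W (markProg r) s fun t s' => t = 3 ∧ Queue S (s'.arr 4) (s'.arr 5) (s'.reg 12) ∧
      QueueExt s s' ∧ s'.arr 4 c = 1 := by
  simp only [markProg, runs_seq, runs_store, runs_arith, h1, hr, ArithOp.eval, State.reg_setCell]
  refine ⟨by omega, by omega, by simpa using hm, trivial, ?_, ?_, ?_⟩
  · simpa using hQ.push hM hS
  · constructor
    · intro c' h
      simp [Function.update_apply, h]
    · simp
    · intro i hi
      simp [hi.ne]
  · simp

/-- Mark the pair `(R[u], R[v])` if it is an unmarked edge and `(R[x], R[y])` is not an edge. -/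
def tryMarkProg (u v x y : ℕ) : Prog :=
  .seq (.arith .mul 20 u 0) <| .seq (.arith .add 20 20 v) <|
  .seq (.arith .mul 21 x 0) <| .seq (.arith .add 21 21 y) <|
  .seq (.load 22 0 20) <| .seq (.load 23 4 20) <| .seq (.load 24 0 21) <|
  .seq (.arith .add 22 22 23) <| .ite 22 24 (markProg 20) .nop

theorem runs_tryMarkProg {W n u v x y : ℕ} {H : SimpleGraph (Fin n)} {S : ℕ → Prop} {s : State}
    (a b c d : Fin n) (hW : n * n + 2 ≤ W)
    (hv : v ≠ 20) (hx : x ≠ 20) (hy : y ≠ 20) (hy' : y ≠ 21)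
    (h0 : s.reg 0 = n) (h1 : s.reg 1 = 1) (hu : s.reg u = a) (hv' : s.reg v = b)
    (hx' : s.reg x = c) (hy'' : s.reg y = d) (hA : NonadjCells H (s.arr 0))
    (hQ : Queue S (s.arr 4) (s.arr 5) (s.reg 12)) (hlt : ∀ c, S c → c < n * n)
    (hS : H.Adj a b → ¬ H.Adj c d → S (pairCode (a, b))) :
    Runs W (tryMarkProg u v x y) s fun t s' => t ≤ 12 ∧
      Queue S (s'.arr 4) (s'.arr 5) (s'.reg 12) ∧ QueueExt s s' ∧
      (H.Adj a b → ¬ H.Adj c d → s'.arr 4 (pairCode (a, b)) = 1) := by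
  have hab := pairCode_lt (a, b)
  have hcd := pairCode_lt (c, d)
  have hm := hQ.le hlt
  have hM := hQ.le_one (pairCode (a, b))
  have hAab : s.arr 0 (pairCode (a, b)) ≤ 1 := by
    by_cases h : H.Adj a b
    · rw [(hA a b).1 h]; omega
    · rw [(hA a b).2 h]
  have hAcd : s.arr 0 (pairCode (c, d)) ≤ 1 := by
    by_cases h : H.Adj c d
    · rw [(hA c d).1 h]; omega
    · rw [(hA c d).2 h]
  have e1 : (a : ℕ) * n + b = pairCode (a, b) := rfl
  have e2 : (c : ℕ) * n + d = pairCode (c, d) := rfl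
  have l1 : (a : ℕ) * n ≤ pairCode (a, b) := Nat.le_add_right _ _
  have l2 : (c : ℕ) * n ≤ pairCode (c, d) := Nat.le_add_right _ _
  simp only [tryMarkProg, runs_seq, runs_arith, runs_load, runs_ite, runs_nop, ArithOp.eval,
    State.reg_setReg, State.arr_setReg]
  simp [hv, hx, hy, hy', h0, hu, hv', hx', hy'', e1, e2]
  refine ⟨by omega, by omega, by omega, by omega, by omega, by omega, by omega, by omega,
    ?_, ?_⟩
  -- All three cells hold `0` or `1`, so the sum of the first two is below the third only for an
  -- unmarked edge `(a, b)` and a non-edge `(c, d)`.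
  · intro hc
    have hz : s.arr 4 (pairCode (a, b)) = 0 := by omega
    have hadj : H.Adj a b := by
      by_contra h
      have := (hA a b).2 h; omega
    have hnadj : ¬ H.Adj c d := by
      intro h
      have := (hA c d).1 h; omega
    refine Runs.mono (runs_markProg (r := 20) (c := pairCode (a, b)) (S := S) ?_ ?_ (by omega)
      ?_ ?_ hz (hS hadj hnadj)) ?_
    · simpa using h1
    · simp
    · simpa using by omega
    · simpa using hQ
    · rintro t s' ⟨ht, hQ', hE, hm'⟩
      refine ⟨by omega, hQ', ⟨fun c hc => hE.marked c hc, ?_, fun i hi => hE.eq i ?_⟩, fun _ _ => hm'⟩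
      · simpa using hE.le
      · simpa using hi
  · intro hc
    refine ⟨hQ, ⟨fun _ h => h, by simp, fun _ _ => rfl⟩, fun h h' => ?_⟩
    have h3 := (hA a b).1 h
    have h4 := (hA c d).2 h'
    omega

end Queue

/-! ### Opening classes in lexicographic order and closing them under forcing. -/

section Orient

variable {n : ℕ} {H : SimpleGraph (Fin n)}

theorem pairCode_div {x : Fin n × Fin n} : pairCode x / n = x.1 := by
  have hn : 0 < n := x.1.pos
  rw [pairCode, mul_comm, Nat.mul_add_div hn, Nat.div_eq_of_lt x.2.2, add_zero]

theorem pairCode_mod {x : Fin n × Fin n} : pairCode x % n = x.2 := by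
  rw [pairCode, mul_comm, Nat.mul_add_mod, Nat.mod_eq_of_lt x.2.2]

theorem exists_pairCode_eq {c : ℕ} (hc : c < n * n) : ∃ x : Fin n × Fin n, pairCode x = c := by
  have hn : 0 < n := Nat.pos_of_ne_zero (by rintro rfl; simp at hc)
  refine ⟨(⟨c / n, Nat.div_lt_of_lt_mul hc⟩, ⟨c % n, Nat.mod_lt _ hn⟩), ?_⟩
  simp only [pairCode]
  rw [mul_comm]; exact Nat.div_add_mod c n

/-- The numbers of the pairs in `LexArcBelow H e`. -/
def BelowCode (H : SimpleGraph (Fin n)) (e c : ℕ) : Prop :=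
  ∃ x : Fin n × Fin n, pairCode x = c ∧ LexArcBelow H e x

theorem BelowCode.lt {e c : ℕ} (h : BelowCode H e c) : c < n * n := by
  obtain ⟨x, rfl, -⟩ := h
  exact pairCode_lt x

theorem belowCode_pairCode {e : ℕ} {x : Fin n × Fin n} :
    BelowCode H e (pairCode x) ↔ LexArcBelow H e x :=
  ⟨fun ⟨_, hy, h⟩ => pairCode_injective hy ▸ h, fun h => ⟨x, rfl, h⟩⟩

/-- Try to mark the pairs that the marked pair `(R[16], R[17])` forces with the vertex `R[18]`. -/
def forceProg : Prog := .seq (tryMarkProg 16 18 17 18) (tryMarkProg 18 17 16 18)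

/-- Take the next pair from the queue, and mark all pairs that it forces. -/
def popProg : Prog :=
  .seq (.load 15 5 11) <| .seq (.arith .add 11 11 1) <| .seq (.arith .div 16 15 0) <|
  .seq (.arith .mod 17 15 0) <| .forLoop 18 0 forceProg

theorem runs_popProg {W e : ℕ} {s : State} (hW : n * n + 2 ≤ W)
    (h0 : s.reg 0 = n) (h1 : s.reg 1 = 1) (hA : NonadjCells H (s.arr 0))
    (hQ : Queue (BelowCode H e) (s.arr 4) (s.arr 5) (s.reg 12)) (hlt : s.reg 11 < s.reg 12) :
    Runs W popProg s fun t s' => t ≤ n * 26 + 6 ∧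
      Queue (BelowCode H e) (s'.arr 4) (s'.arr 5) (s'.reg 12) ∧ QueueExt s s' ∧
      s'.reg 11 = s.reg 11 + 1 ∧
      ∀ x y, pairCode x = s.arr 5 (s.reg 11) → Force H x y → s'.arr 4 (pairCode y) = 1 := by
  have hnW : n ≤ W := by nlinarith
  obtain ⟨⟨x, hx, hxe⟩, -⟩ := hQ.mem _ (hQ.marked _ hlt)
  have hxlt := pairCode_lt x
  have hm : s.reg 12 ≤ n * n := hQ.le fun c => BelowCode.lt
  have hx1 := x.1.2
  have hx2 := x.2.2
  simp only [popProg, runs_seq, runs_load, runs_arith, ArithOp.eval, State.reg_setReg]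
  simp [h0, h1, ← hx, pairCode_div, pairCode_mod]
  refine ⟨by omega, by omega, by omega, by omega, ?_⟩
  refine Runs.mono (Runs.frame (runs_forLoop n 24
    (fun m s' => Queue (BelowCode H e) (s'.arr 4) (s'.arr 5) (s'.reg 12) ∧ QueueExt s s' ∧
      ∀ w : Fin n, w < m → (Force H x (x.1, w) → s'.arr 4 (pairCode (x.1, w)) = 1) ∧
        (Force H x (w, x.2) → s'.arr 4 (pairCode (w, x.2)) = 1))
    ?_ ?_ hnW rfl rfl rfl (by decide) (by decide) ?_ ?_)) ?_
  · simpa using h1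
  · simpa using h0
  · refine ⟨by simpa using hQ, ⟨fun _ h => h, by simp, fun _ _ => rfl⟩, ?_⟩
    intro w hw
    omega
  · rintro m s' hm' hF hi ⟨hQ', hE, hw⟩
    have e0 : s'.reg 0 = n := by rw [hF.reg 0]; simpa using h0
    have e1 : s'.reg 1 = 1 := by rw [hF.reg 1]; simpa using h1
    have e16 : s'.reg 16 = x.1 := by rw [hF.reg 16]; simp
    have e17 : s'.reg 17 = x.2 := by rw [hF.reg 17]; simp
    have eA : s'.arr 0 = s.arr 0 := by rw [hF.arr 0]; simp
    rw [forceProg, runs_seq]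
    refine Runs.mono (Runs.frame (runs_tryMarkProg x.1 ⟨m, hm'⟩ x.2 ⟨m, hm'⟩ hW (by decide)
      (by decide) (by decide) (by decide) e0 e1 e16 hi e17 hi (eA ▸ hA) hQ' (fun c => BelowCode.lt)
      fun ha hb => ⟨_, rfl, hxe.of_implies (.single ⟨hxe.1.1, ha, .inl ⟨rfl, hb⟩⟩)⟩)) ?_
    rintro t1 s1 ⟨⟨ht1, hQ1, hE1, hm1⟩, hF1⟩
    refine Runs.mono (runs_tryMarkProg ⟨m, hm'⟩ x.2 x.1 ⟨m, hm'⟩ hW (by decide)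
      (by decide) (by decide) (by decide) (by rw [hF1.reg 0, e0]) (by rw [hF1.reg 1, e1])
      (by rw [hF1.reg 18, hi]) (by rw [hF1.reg 17, e17]) (by rw [hF1.reg 16, e16])
      (by rw [hF1.reg 18, hi]) (by rw [hF1.arr 0, eA]; exact hA) hQ1 (fun c => BelowCode.lt)
      fun ha hb => ⟨_, rfl, hxe.of_implies (.single ⟨hxe.1.1, ha, .inr ⟨rfl, hb⟩⟩)⟩) ?_
    rintro t2 s2 ⟨ht2, hQ2, hE2, hm2⟩
    have hE3 := hE1.trans hE2
    refine ⟨by omega, by simpa using hQ2, ?_, ?_⟩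
    · have := hE.trans hE3
      exact ⟨this.marked, by simpa using this.le, this.eq⟩
    · intro w hwm
      simp only [State.arr_setReg]
      by_cases hwm' : (w : ℕ) < m
      · exact ⟨fun h => hE3.marked _ ((hw w hwm').1 h), fun h => hE3.marked _ ((hw w hwm').2 h)⟩
      · have : w = ⟨m, hm'⟩ := by ext; simp; omega
        subst this
        refine ⟨fun h => hE2.marked _ ?_, fun h => ?_⟩
        -- The pair may also be forced through the other end; then `w = x.2`, and the test still
        -- succeeds because the diagonal counts as non-adjacent.
        · rcases h.2.2 with ⟨-, h'⟩ | ⟨h', -⟩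
          · exact hm1 h.2.1 h'
          · have := h.2.1
            dsimp only at h' this ⊢
            exact hm1 this (by rw [h']; exact H.irrefl)
        · rcases h.2.2 with ⟨h', -⟩ | ⟨-, h'⟩
          · have := h.2.1
            dsimp only at h' this ⊢
            exact hm2 this (by rw [h']; exact H.irrefl)
          · exact hm2 h.2.1 h'
  · rintro t s' ⟨⟨ht, hQ', hE, hw⟩, hF⟩
    refine ⟨by omega, hQ', hE, ?_, ?_⟩
    · rw [hF.reg 11]; simp
    · rintro z1 z2 y1 y2 hz hf
      have : x = (z1, z2) := (pairCode_injective hz).symm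
      subst this
      have hf' := hf
      obtain ⟨-, -, ⟨h, -⟩ | ⟨h, -⟩⟩ := hf
      · dsimp only at h; subst h
        exact (hw y2 y2.2).1 hf'
      · dsimp only at h; subst h
        exact (hw y1 y1.2).2 hf'

/-- The invariant of the orientation loop. -/
structure OrientInv (H : SimpleGraph (Fin n)) (s : State) : Prop where
  le : s.reg 10 ≤ n * n
  head_le : s.reg 11 ≤ s.reg 12
  queue : Queue (BelowCode H (s.reg 10)) (s.arr 4) (s.arr 5) (s.reg 12)
  started : ∀ x, LexArcBelow H (s.reg 10) x → s.arr 4 (leastCode H x) = 1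
  closed : ∀ i < s.reg 11, ∀ x y, pairCode x = s.arr 5 i → Force H x y → s.arr 4 (pairCode y) = 1

/-- With an empty queue the marks are closed under forcing. They contain the least pair of every
opened class, hence the whole class. -/
theorem OrientInv.marked_iff {s : State} (h : OrientInv H s) (he : s.reg 11 = s.reg 12)
    (x : Fin n × Fin n) : s.arr 4 (pairCode x) = 1 ↔ LexArcBelow H (s.reg 10) x := by
  constructor
  · intro hx
    exact belowCode_pairCode.1 (h.queue.mem _ hx).1
  · intro hx
    obtain ⟨y, hy, ey⟩ := exists_leastCode (H := H) x
    have h1 := h.started x hx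
    rw [← ey] at h1
    have key : ∀ z, Implies H y z → s.arr 4 (pairCode z) = 1 := by
      intro z hz
      induction hz with
      | refl => exact h1
      | tail _ hf ih =>
        obtain ⟨-, i, hi, e⟩ := h.queue.mem _ ih
        exact h.closed i (he ▸ hi) _ _ e.symm hf
    exact key x hy.symm

/-- Consider the pair with number `R[10]`, and start a new class if it is an edge that has no
direction yet. -/
def considerProg : Prog :=
  .seq (.arith .div 16 10 0) <| .seq (.arith .mod 17 10 0) <| .seq (.arith .mul 20 17 0) <|
  .seq (.arith .add 20 20 16) <| .seq (.load 22 0 10) <| .seq (.load 23 4 10) <|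
  .seq (.load 24 4 20) <| .seq (.arith .add 22 22 23) <| .seq (.arith .add 22 22 24) <|
  .seq (.ite 22 1 (markProg 10) .nop) (.arith .add 10 10 1)

theorem runs_considerProg {W : ℕ} {s : State} (hH : IsComparabilityGraph H) (hW : n * n + 3 ≤ W)
    (h0 : s.reg 0 = n) (h1 : s.reg 1 = 1) (hA : NonadjCells H (s.arr 0)) (hI : OrientInv H s)
    (hq : s.reg 11 = s.reg 12) (hlt : s.reg 10 < n * n) :
    Runs W considerProg s fun t s' => t ≤ 14 ∧ OrientInv H s' ∧
      s'.reg 10 = s.reg 10 + 1 ∧ s'.reg 11 = s.reg 11 := by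
  obtain ⟨x, hx⟩ := exists_pairCode_eq hlt
  have hx1 := x.1.2
  have hx2 := x.2.2
  have hm : s.reg 12 ≤ n * n := hI.queue.le fun c => BelowCode.lt
  have hswap := pairCode_lt x.swap
  have e1 : (x.2 : ℕ) * n + x.1 = pairCode x.swap := rfl
  have l1 : (x.2 : ℕ) * n ≤ pairCode x.swap := Nat.le_add_right _ _
  have hAx : s.arr 0 (pairCode x) ≤ 1 := by
    by_cases h : H.Adj x.1 x.2
    · rw [(hA x.1 x.2).1 h]; omega
    · rw [(hA x.1 x.2).2 h]
  have hM := hI.queue.le_one (pairCode x)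
  have hM' := hI.queue.le_one (pairCode x.swap)
  have hiff := hI.marked_iff hq
  have hnW : n ≤ W := by nlinarith
  simp only [considerProg, runs_seq, runs_arith, runs_load, runs_ite, runs_nop, ArithOp.eval,
    State.reg_setReg, State.arr_setReg]
  simp only [← hx, pairCode_div, pairCode_mod, h0, h1, Nat.reduceEqDiff, if_true, if_false, e1]
  refine ⟨by omega, by omega, by omega, by omega, by omega, by omega, by omega, by omega,
    by omega, ?_, ?_⟩
  -- A sum below `1` means that the pair is an edge and that neither it nor its reversal is marked.
  · intro hc
    have hadj : H.Adj x.1 x.2 := by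
      by_contra h
      have := (hA x.1 x.2).2 h
      simp only [Prod.mk.eta] at this
      omega
    have n1 : ¬ LexArcBelow H (pairCode x) x := by rw [hx, ← hiff]; omega
    have n2 : ¬ LexArcBelow H (pairCode x) x.swap := by rw [hx, ← hiff]; omega
    have hnew := lexArcBelow_succ_pairCode hH hadj n2
    refine Runs.mono (Runs.frame (runs_markProg (r := 10) (c := pairCode x)
      (S := BelowCode H (s.reg 10 + 1)) ?_ ?_ (by omega) ?_ ?_ ?_ ?_)) ?_
    · simpa using h1
    · simpa using hx.symm
    · simpa using by omega
    · simp only [State.arr_setReg, State.reg_setReg, Nat.reduceEqDiff, if_false]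
      exact hI.queue.weaken fun c ⟨y, hy, h⟩ => ⟨y, hy, h.mono (Nat.le_succ _)⟩
    · simpa using by omega
    · rw [← hx]; exact ⟨x, rfl, hnew⟩
    · rintro t s' ⟨⟨ht, hQ, hE, hm1⟩, hF⟩
      have e10 : s'.reg 10 = s.reg 10 := by rw [hF.reg 10]; simp
      have e1 : s'.reg 1 = 1 := by rw [hF.reg 1]; simpa using h1
      have e11 : s'.reg 11 = s.reg 11 := by rw [hF.reg 11]; simp
      have hle : s.reg 12 ≤ s'.reg 12 := by simpa using hE.le
      have hM : ∀ c, s.arr 4 c = 1 → s'.arr 4 c = 1 := fun c h => hE.marked c h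
      have hq' : ∀ i < s.reg 12, s'.arr 5 i = s.arr 5 i := fun i hi => hE.eq i (by simpa using hi)
      rw [e10, e1]
      refine ⟨by omega, by omega, ⟨?_, ?_, ?_, ?_, ?_⟩, ?_, ?_⟩
      · simpa using hlt
      · simpa [e11, hq] using hle
      · simpa using hQ
      · intro y hy
        simp only [State.arr_setReg]
        simp only [State.reg_setReg, if_true] at hy
        rcases hy.of_succ with h | ⟨h, -⟩
        · exact hM _ (hI.started y h)
        · rw [h, ← hx]; exact hm1
      · intro i hi y z hy hf
        simp [e11] at hi hy ⊢
        rw [hq' i (by omega)] at hy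
        exact hM _ (hI.closed i hi y z hy hf)
      · simp [hx]
      · simp [e11]
  · intro hc
    have hno : ¬ ∃ y : Fin n × Fin n, pairCode y = s.reg 10 ∧ H.Adj y.1 y.2 ∧
        ¬ LexArcBelow H (s.reg 10) y ∧ ¬ LexArcBelow H (s.reg 10) y.swap := by
      rintro ⟨y, hy, h1, h2, h3⟩
      have : y = x := pairCode_injective (hy.trans hx.symm)
      subst this
      rw [← hiff] at h2 h3
      have := (hA y.1 y.2).1 h1
      simp only [Prod.mk.eta] at this
      omega
    refine ⟨by omega, by omega, ⟨?_, ?_, ?_, ?_, ?_⟩, ?_, ?_⟩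
    · simpa [hx] using hlt
    · simpa using hI.head_le
    · simp only [State.arr_setReg, State.reg_setReg, Nat.reduceEqDiff, if_true, if_false, hx]
      exact hI.queue.weaken fun c ⟨y, hy, h⟩ => ⟨y, hy, h.mono (Nat.le_succ _)⟩
    · intro y hy
      simp only [State.arr_setReg, State.reg_setReg, if_true, hx] at hy ⊢
      rcases hy.of_succ with h | ⟨-, h⟩
      · exact hI.started y h
      · exact absurd h hno
    · intro i hi y z hy hf
      simp at hi hy ⊢
      exact hI.closed i hi y z hy hf
    · simp
    · simp

/-- Update the number of remaining iterations of the orientation loop. -/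
def remainingProg : Prog :=
  .seq (.arith .sub 14 13 10) <| .seq (.arith .sub 25 12 11) (.arith .add 14 14 25)

/-- Compute the lexicographic orientation in array `4`. -/
def orientProg : Prog :=
  .seq (.arith .mul 13 0 0) <| .seq remainingProg <|
  .loop 2 14 (.seq (.ite 11 12 popProg considerProg) remainingProg)

theorem runs_remainingProg {W : ℕ} {s : State} (hW : 2 * (n * n) ≤ W) (hI : OrientInv H s)
    (h13 : s.reg 13 = n * n) :
    Runs W remainingProg s fun t s' => t = 3 ∧ OrientInv H s' ∧ s'.reg 10 = s.reg 10 ∧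
      s'.reg 11 = s.reg 11 ∧ s'.reg 14 = n * n - s'.reg 10 + (s'.reg 12 - s'.reg 11) := by
  have hm : s.reg 12 ≤ n * n := hI.queue.le fun c => BelowCode.lt
  simp [remainingProg, h13]
  refine ⟨by omega, by omega, by omega, ?_⟩
  exact ⟨by simpa using hI.le, by simpa using hI.head_le, by simpa using hI.queue,
    by simpa using hI.started, by simpa using hI.closed⟩

/-- Every round advances either the scan or the head of the queue by one, and neither exceeds `n *
n`: at most `2 * (n * n)` rounds of linear cost. Register `14` is `0` exactly when the scan is over
and the queue is empty. -/
theorem runs_orientProg {W : ℕ} {s : State} (hH : IsComparabilityGraph H)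
    (hW : 2 * (n * n) + 3 ≤ W) (h0 : s.reg 0 = n) (h1 : s.reg 1 = 1) (h2 : s.reg 2 = 0)
    (hA : NonadjCells H (s.arr 0)) (h10 : s.reg 10 = 0) (h11 : s.reg 11 = 0) (h12 : s.reg 12 = 0)
    (h4 : ∀ c, s.arr 4 c = 0) :
    Runs W orientProg s fun t s' => t ≤ 2 * (n * n) * (n * 26 + 25) + 5 ∧
      ∀ x : Fin n × Fin n, s'.arr 4 (pairCode x) ≤ 1 ∧
        (s'.arr 4 (pairCode x) = 1 ↔ LexArc H x.1 x.2) := by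
  have hI0 : OrientInv H s := by
    refine ⟨by omega, by omega, ⟨fun c => by simp [h4], by omega, fun c hc => ?_, by omega⟩,
      fun x hx => ?_, by omega⟩
    · rw [h4] at hc; omega
    · have := hx.2; omega
  have hI1 : OrientInv H (s.setReg 13 (n * n)) :=
    ⟨by simpa using hI0.le, by simpa using hI0.head_le, by simpa using hI0.queue,
    by simpa using hI0.started, by simpa using hI0.closed⟩
  rw [orientProg, runs_seq, runs_arith]
  simp only [ArithOp.eval, h0]
  refine ⟨by omega, ?_⟩
  rw [runs_seq]
  refine Runs.mono (Runs.frame (runs_remainingProg (by omega) hI1 (by simp))) ?_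
  rintro t1 s1 ⟨⟨rfl, hI2, h10', h11', h14⟩, hF⟩
  have e0 : s1.reg 0 = n := by rw [hF.reg 0]; simpa using h0
  have e1 : s1.reg 1 = 1 := by rw [hF.reg 1]; simpa using h1
  have e2 : s1.reg 2 = 0 := by rw [hF.reg 2]; simpa using h2
  have e13 : s1.reg 13 = n * n := by rw [hF.reg 13]; simp
  have eA : s1.arr 0 = s.arr 0 := by rw [hF.arr 0]; simp
  refine Runs.mono (runs_loop (n * 26 + 6 + 14 + 4)
    (fun m s' => m + s'.reg 10 + s'.reg 11 = 2 * (n * n) ∧ OrientInv H s' ∧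
      s'.reg 14 = n * n - s'.reg 10 + (s'.reg 12 - s'.reg 11) ∧ s'.reg 0 = n ∧ s'.reg 1 = 1 ∧
      s'.reg 2 = 0 ∧ s'.reg 13 = n * n ∧ s'.arr 0 = s.arr 0) ?_ (2 * (n * n)) s1 ?_) ?_
  · rintro m s' ⟨hm, hI, f14, f0, f1, f2, f13, fA⟩ hc
    rw [f2] at hc
    rw [runs_seq]
    have hmle : s'.reg 12 ≤ n * n := hI.queue.le fun c => BelowCode.lt
    have hmpos : 0 < m := by
      have := hI.le
      have := hI.head_le
      omega
    have hbody : Runs W (.ite 11 12 popProg considerProg) s' fun t s'' =>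
        t ≤ n * 26 + 21 ∧ OrientInv H s'' ∧
          s''.reg 10 + s''.reg 11 = s'.reg 10 + s'.reg 11 + 1 := by
      rw [runs_ite]
      refine ⟨fun hlt => ?_, fun hlt => ?_⟩
      · refine (runs_popProg (by omega) f0 f1 (fA ▸ hA) hI.queue hlt).frame.mono ?_
        rintro t s'' ⟨⟨ht, hQ, hE, g11, hf⟩, hF'⟩
        have g10 : s''.reg 10 = s'.reg 10 := hF'.reg 10
        refine ⟨by omega, ⟨g10 ▸ hI.le, ?_, by rwa [g10], ?_, ?_⟩, by omega⟩
        · have := hE.le; omega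
        · rw [g10]; exact fun x hx => hE.marked _ (hI.started x hx)
        · intro i hi x y hx hxy
          rw [hE.eq i (by omega)] at hx
          by_cases h : i < s'.reg 11
          · exact hE.marked _ (hI.closed i h x y hx hxy)
          · have : i = s'.reg 11 := by omega
            subst this
            exact hf x y hx hxy
      · have := hI.head_le
        refine (runs_considerProg hH (by omega) f0 f1 (fA ▸ hA) hI (by omega) (by omega)).mono ?_
        rintro t s'' ⟨ht, hI', g10, g11⟩
        exact ⟨by omega, hI', by omega⟩
    refine hbody.frame.mono ?_
    rintro t s'' ⟨⟨ht, hI', hsum⟩, hF'⟩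
    have g13 : s''.reg 13 = n * n := by rw [hF'.reg 13, f13]
    refine (runs_remainingProg (by omega) hI' g13).frame.mono ?_
    rintro t' s3 ⟨⟨rfl, hI3, k10, k11, k14⟩, hF3⟩
    refine ⟨by omega, m - 1, by omega, ?_, hI3, k14, ?_, ?_, ?_, ?_, ?_⟩
    · have := hI3.le
      have := hI3.head_le
      have := hI3.queue.le fun c => BelowCode.lt
      omega
    · rw [hF3.reg 0, hF'.reg 0, f0]
    · rw [hF3.reg 1, hF'.reg 1, f1]
    · rw [hF3.reg 2, hF'.reg 2, f2]
    · rw [hF3.reg 13, g13]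
    · rw [hF3.arr 0, hF'.arr 0, fA]
  · refine ⟨?_, hI2, h14, e0, e1, e2, e13, eA⟩
    rw [h10', h11']; simp [h10, h11]
  · rintro t s' ⟨ht, hc, m', hm', hI, f14, f0, f1, f2, f13, fA⟩
    have := hI.head_le
    have := hI.le
    have h10 : s'.reg 10 = n * n := by omega
    refine ⟨by linarith, fun x => ⟨hI.queue.le_one _, ?_⟩⟩
    rw [hI.marked_iff (by omega), h10, lexArcBelow_all]

end Orient

/-! ### In-degrees, total profits and powers -/

/-- Write the column sums of the `n × n` matrix in array `4` to array `6`. -/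
def columnSumProg : Prog :=
  .forLoop 30 0 <| .forLoop 31 0 <|
    .seq (.arith .mul 32 30 0) <| .seq (.arith .add 32 32 31) <| .seq (.load 33 4 32) <|
    .seq (.load 34 6 31) <| .seq (.arith .add 34 34 33) (.store 6 31 34)

theorem runs_columnSumProg {W n : ℕ} {s : State} (hW : n * n + n + 1 ≤ W)
    (h0 : s.reg 0 = n) (h1 : s.reg 1 = 1) (hM : ∀ a < n, ∀ b < n, s.arr 4 (a * n + b) ≤ 1)
    (h6 : ∀ c, s.arr 6 c = 0) :
    Runs W columnSumProg s fun t s' => t ≤ n * (n * 8 + 4) + 2 ∧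
      ∀ b < n, s'.arr 6 b = ∑ a ∈ Finset.range n, s.arr 4 (a * n + b) := by
  have hn : n ≤ W := by nlinarith
  have hle : ∀ b < n, ∀ m ≤ n, ∑ a ∈ Finset.range m, s.arr 4 (a * n + b) ≤ m := by
    intro b hb m hm
    calc _ ≤ ∑ a ∈ Finset.range m, 1 :=
          Finset.sum_le_sum fun a ha => hM a ((Finset.mem_range.1 ha).trans_le hm) b hb
      _ = m := by simp
  refine (runs_forLoop n (n * 8 + 2) (fun m s' => ∀ b < n, s'.arr 6 b =
    ∑ a ∈ Finset.range m, s.arr 4 (a * n + b)) h1 h0 hn rfl rfl rfl (by decide) (by decide)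
    ?_ ?_).mono ?_
  · simpa using fun b _ => h6 b
  · intro a s' ha hF hi hI
    have e0 : s'.reg 0 = n := by rw [hF.reg 0, h0]
    have e1 : s'.reg 1 = 1 := by rw [hF.reg 1, h1]
    refine (runs_forLoop n 6 (fun m s'' => ∀ b < n, s''.arr 6 b =
      ∑ a' ∈ Finset.range a, s.arr 4 (a' * n + b) + if b < m then s.arr 4 (a * n + b) else 0)
      e1 e0 hn rfl rfl rfl (by decide) (by decide) ?_ ?_).mono ?_
    · simpa using hI
    · intro b s'' hb hF' hi' hI'
      have f0 : s''.reg 0 = n := by rw [hF'.reg 0, e0]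
      have f4 : s''.arr 4 = s.arr 4 := by rw [hF'.arr 4, hF.arr 4]
      have f30 : s''.reg 30 = a := by rw [hF'.reg 30, hi]
      have hlt := pairCode_lt ((⟨a, ha⟩, ⟨b, hb⟩) : Fin n × Fin n)
      have hlM := hM a ha b hb
      have hl := hle b hb a ha.le
      have hI6 := hI' b hb
      simp only [lt_irrefl, if_false, add_zero] at hI6
      simp only [pairCode] at hlt
      simp [f0, f4, f30, hi', hI6]
      refine ⟨by omega, by omega, by omega, by omega, by omega, ?_⟩
      intro c hc
      rw [Function.update_apply]
      split_ifs with h1 h2 h2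
      · rw [h1]
      · omega
      · rw [hI' c hc, if_pos (by omega)]
      · rw [hI' c hc, if_neg (by omega)]
    · rintro t s'' ⟨ht, hI''⟩
      refine ⟨by omega, ?_⟩
      intro b hb
      simp only [State.arr_setReg]
      rw [hI'' b hb, if_pos hb, Finset.sum_range_succ]
  · rintro t s' ⟨ht, hI⟩
    exact ⟨by linarith, hI⟩

/-- Compute the greatest row sum of the `R[3] × n` matrix in array `1` in register `40`. -/
def maxRowSumProg : Prog :=
  .forLoop 35 3 <| .seq (.const 36 0) <| .seq (.forLoop 37 0 <|
    .seq (.arith .mul 38 35 0) <| .seq (.arith .add 38 38 37) <| .seq (.load 39 1 38) <|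
    .arith .add 36 36 39) <| .ite 40 36 (.arith .add 40 36 2) .nop

theorem runs_maxRowSumProg {W n k Q : ℕ} {s : State} (hn : n ≤ W) (hk : k ≤ W)
    (hnk : k * n ≤ W) (hQ : Q ≤ W) (h0 : s.reg 0 = n) (h1 : s.reg 1 = 1) (h2 : s.reg 2 = 0)
    (h3 : s.reg 3 = k) (h40 : s.reg 40 = 0)
    (hA : (Finset.range k).sup (fun j => ∑ v ∈ Finset.range n, s.arr 1 (j * n + v)) = Q) :
    Runs W maxRowSumProg s fun t s' => t ≤ k * (n * 6 + 7) + 2 ∧ s'.reg 40 = Q := by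
  have hrow : ∀ j < k, ∑ v ∈ Finset.range n, s.arr 1 (j * n + v) ≤ Q := fun j hj =>
    hA ▸ Finset.le_sup (f := fun j => ∑ v ∈ Finset.range n, s.arr 1 (j * n + v))
      (Finset.mem_range.2 hj)
  refine (runs_forLoop k (n * 6 + 5) (fun m s' => s'.reg 40 =
    (Finset.range m).sup fun j => ∑ v ∈ Finset.range n, s.arr 1 (j * n + v))
    h1 h3 hk rfl rfl rfl (by decide) (by decide) ?_ ?_).mono ?_
  · simpa using h40
  · intro j s' hj hF hi hI
    have e0 : s'.reg 0 = n := by rw [hF.reg 0, h0]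
    have e1 : s'.reg 1 = 1 := by rw [hF.reg 1, h1]
    have e2 : s'.reg 2 = 0 := by rw [hF.reg 2, h2]
    have eA : s'.arr 1 = s.arr 1 := hF.arr 1
    have hj1 : (j + 1) * n ≤ k * n := Nat.mul_le_mul_right _ hj
    rw [add_mul] at hj1
    rw [runs_seq, runs_const]
    refine ⟨Nat.zero_le _, ?_⟩
    rw [runs_seq]
    refine Runs.mono (Runs.frame (runs_forLoop n 4 (fun m s'' => s''.reg 36 =
      ∑ v ∈ Finset.range m, s.arr 1 (j * n + v))
      ?_ ?_ hn rfl rfl rfl (by decide) (by decide) ?_ ?_)) ?_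
    · simpa using e1
    · simpa using e0
    · simp
    · intro v s'' hv hF' hi' hI'
      have f0 : s''.reg 0 = n := by rw [hF'.reg 0]; simpa using e0
      have f35 : s''.reg 35 = j := by rw [hF'.reg 35]; simpa using hi
      have fA : s''.arr 1 = s.arr 1 := by rw [hF'.arr 1]; simpa using eA
      have hp : ∑ v' ∈ Finset.range (v + 1), s.arr 1 (j * n + v') ≤ Q :=
        (Finset.sum_le_sum_of_subset (Finset.range_mono hv)).trans (hrow j hj)
      rw [Finset.sum_range_succ] at hp
      simp [f0, f35, fA, hi', hI', Finset.sum_range_succ]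
      refine ⟨by omega, by omega, by omega, by omega⟩
    · rintro t s'' ⟨⟨ht, hI''⟩, hF''⟩
      have f2 : s''.reg 2 = 0 := by rw [hF''.reg 2]; simpa using e2
      have f40 : s''.reg 40 = s'.reg 40 := by rw [hF''.reg 40]; simp
      have hr := hrow j hj
      rw [Finset.range_add_one, Finset.sup_insert, ← hI]
      simp [f2, f40, hI'']
      refine ⟨fun h => ⟨by omega, by omega, ?_⟩, fun h => ⟨by omega, ?_⟩⟩
      · exact h.le
      · exact h
  · rintro t s' ⟨ht, hI⟩
    exact ⟨by linarith, hI.trans hA⟩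

/-- Write the powers of `R[0] + 1` and `R[40] + 1` with exponents below `R[3]` to arrays `7` and
`8`, and those with exponent `R[3]` to registers `43` and `44`. -/
def powProg : Prog :=
  .seq (.arith .add 41 0 1) <| .seq (.arith .add 42 40 1) <| .seq (.const 43 1) <|
  .seq (.const 44 1) <| .forLoop 45 3 <| .seq (.store 7 45 43) <| .seq (.store 8 45 44) <|
  .seq (.arith .mul 43 43 41) (.arith .mul 44 44 42)

theorem runs_powProg {W n k Q : ℕ} {s : State} (hn : n + 1 ≤ W) (hk : k ≤ W) (hQ : Q + 1 ≤ W)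
    (hnW : (n + 1) ^ k ≤ W) (hQW : (Q + 1) ^ k ≤ W)
    (h0 : s.reg 0 = n) (h1 : s.reg 1 = 1) (h3 : s.reg 3 = k) (h40 : s.reg 40 = Q) :
    Runs W powProg s fun t s' => t ≤ k * 6 + 6 ∧ s'.reg 41 = n + 1 ∧ s'.reg 42 = Q + 1 ∧
      s'.reg 44 = (Q + 1) ^ k ∧
      (∀ j < k, s'.arr 7 j = (n + 1) ^ j) ∧ ∀ j < k, s'.arr 8 j = (Q + 1) ^ j := by
  have hpn : ∀ j ≤ k, (n + 1) ^ j ≤ W := fun j hj =>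
    (Nat.pow_le_pow_right (Nat.succ_pos _) hj).trans hnW
  have hpQ : ∀ j ≤ k, (Q + 1) ^ j ≤ W := fun j hj =>
    (Nat.pow_le_pow_right (Nat.succ_pos _) hj).trans hQW
  simp only [powProg, runs_seq, runs_arith, runs_const, ArithOp.eval, State.reg_setReg]
  simp [h0, h1, h40]
  refine ⟨hn, hQ, by omega, ?_⟩
  refine Runs.mono (Runs.frame (runs_forLoop k 4 (fun m s' => s'.reg 43 = (n + 1) ^ m ∧
    s'.reg 44 = (Q + 1) ^ m ∧ (∀ j < m, s'.arr 7 j = (n + 1) ^ j) ∧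
    ∀ j < m, s'.arr 8 j = (Q + 1) ^ j)
    ?_ ?_ hk rfl rfl rfl (by decide) (by decide) ?_ ?_)) ?_
  · simpa using h1
  · simpa using h3
  · simp
  · rintro m s' hm hF hi ⟨i1, i2, i3, i4⟩
    have e41 : s'.reg 41 = n + 1 := by rw [hF.reg 41]; simp
    have e42 : s'.reg 42 = Q + 1 := by rw [hF.reg 42]; simp
    have a1 := hpn m hm.le
    have a2 := hpQ m hm.le
    have a3 := hpn (m + 1) hm
    have a4 := hpQ (m + 1) hm
    rw [pow_succ] at a3 a4
    simp [i1, i2, hi, e41, e42, a1, a2, a3, a4, pow_succ]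
    constructor
    · intro j hj
      rw [Function.update_apply]
      split_ifs with h
      · rw [h]
      · exact i3 j (by omega)
    · intro j hj
      rw [Function.update_apply]
      split_ifs with h
      · rw [h]
      · exact i4 j (by omega)
  · rintro t s' ⟨⟨ht, -, i2, i3, i4⟩, hF⟩
    refine ⟨by omega, ?_, ?_, i2, i3, i4⟩
    · rw [hF.reg 41]; simp
    · rw [hF.reg 42]; simp

/-! ### Digits -/

/-- The digit of `c` at position `j` in base `b`. -/
def digit (b c j : ℕ) : ℕ := c / b ^ j % b

theorem digit_lt {b c j : ℕ} (hb : 0 < b) : digit b c j < b := Nat.mod_lt _ hb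

theorem digit_mul_pow_le {b c j : ℕ} : digit b c j * b ^ j ≤ c :=
  (Nat.mul_le_mul_right _ (Nat.mod_le _ _)).trans (Nat.div_mul_le_self _ _)

theorem digit_finFunctionFinEquiv {b k : ℕ} (d : Fin k → Fin b) (j : Fin k) :
    digit b (finFunctionFinEquiv d) j = d j := by
  have := congrFun (finFunctionFinEquiv.symm_apply_apply d) j
  rw [← this]
  rfl

theorem digit_ext {b k c c' : ℕ} (hc : c < b ^ k) (hc' : c' < b ^ k)
    (h : ∀ j < k, digit b c j = digit b c' j) : c = c' := by
  have : (finFunctionFinEquiv.symm ⟨c, hc⟩ : Fin k → Fin b) = finFunctionFinEquiv.symm ⟨c', hc'⟩ := by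
    ext j
    exact h j j.2
  simpa using finFunctionFinEquiv.symm.injective this

/-- The number is the code of the digit tuple with entry `j` updated. Adding before subtracting
keeps the truncated difference exact. -/
theorem digit_replace {b k c x : ℕ} (hc : c < b ^ k) (j : Fin k) (hx : x < b) :
    c + x * b ^ (j : ℕ) - digit b c j * b ^ (j : ℕ) < b ^ k ∧
    ∀ i : Fin k, digit b (c + x * b ^ (j : ℕ) - digit b c j * b ^ (j : ℕ)) i =
      if i = j then x else digit b c i := by
  obtain ⟨d, hd⟩ := finFunctionFinEquiv.surjective (⟨c, hc⟩ : Fin (b ^ k))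
  have hd' : ((finFunctionFinEquiv d : Fin (b ^ k)) : ℕ) = c := by rw [hd]
  have hdig : ∀ i : Fin k, digit b c i = d i := fun i => by rw [← hd', digit_finFunctionFinEquiv]
  have key : c + x * b ^ (j : ℕ) - digit b c j * b ^ (j : ℕ) =
      (finFunctionFinEquiv (Function.update d j ⟨x, hx⟩) : Fin (b ^ k)) := by
    rw [hdig, ← hd', finFunctionFinEquiv_apply, finFunctionFinEquiv_apply,
      ← Finset.add_sum_erase _ _ (Finset.mem_univ j),
      ← Finset.add_sum_erase Finset.univ (fun i => ((Function.update d j ⟨x, hx⟩ i : Fin b) : ℕ) *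
        b ^ (i : ℕ)) (Finset.mem_univ j)]
    have : ∑ i ∈ Finset.univ.erase j, ((Function.update d j ⟨x, hx⟩ i : Fin b) : ℕ) * b ^ (i : ℕ) =
        ∑ i ∈ Finset.univ.erase j, (d i : ℕ) * b ^ (i : ℕ) := by
      refine Finset.sum_congr rfl fun i hi => ?_
      rw [Function.update_of_ne (Finset.ne_of_mem_erase hi)]
    rw [this, Function.update_self]
    dsimp only
    omega
  rw [key]
  refine ⟨Fin.is_lt _, fun i => ?_⟩
  rw [digit_finFunctionFinEquiv, Function.update_apply, hdig]
  split_ifs <;> rfl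

/-! ### Extending colourings along a topological sort -/

section Coloring

variable {n k : ℕ} {G : SimpleGraph (Fin n)} {D : Fin n → Fin n → Prop} {p : Fin k → Fin n → ℕ}

/-- `χ` describes a partial `k`-colouring of `G` with all coloured vertices in `U`; the colours are
`1, …, k`, and `0` stands for no colour. -/
structure IsColoringOn (G : SimpleGraph (Fin n)) (k : ℕ) (U : Finset (Fin n)) (χ : Fin n → ℕ) :
    Prop where
  le : ∀ v, χ v ≤ k
  zero : ∀ v ∉ U, χ v = 0
  indep : ∀ u v, χ u = χ v → χ u ≠ 0 → ¬ G.Adj u v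

/-- `l` is the number, plus one, of the last vertex of colour `c`, or `0` if there is none. -/
def IsLast (D : Fin n → Fin n → Prop) (χ : Fin n → ℕ) (c l : ℕ) : Prop :=
  (l = 0 ∧ ∀ u, χ u ≠ c) ∨ ∃ v : Fin n, l = v + 1 ∧ χ v = c ∧ ∀ u, χ u = c → u ≠ v → D u v

/-- The profit of the colour `j + 1`. -/
def colorProfit (p : Fin k → Fin n → ℕ) (χ : Fin n → ℕ) (j : Fin k) : ℕ :=
  ∑ v, if χ v = j + 1 then p j v else 0

theorem colorProfit_le (χ : Fin n → ℕ) (j : Fin k) : colorProfit p χ j ≤ maxTotalProfit p :=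
  (Finset.sum_le_sum fun v _ => by split_ifs <;> simp).trans
    (Finset.le_sup (f := fun j => ∑ v, p j v) (Finset.mem_univ j))

/-- The codes of the last vertices and of the profit profile of `χ`. -/
structure Represents (D : Fin n → Fin n → Prop) (p : Fin k → Fin n → ℕ) (χ : Fin n → ℕ)
    (l q : ℕ) : Prop where
  l_lt : l < (n + 1) ^ k
  q_lt : q < (maxTotalProfit p + 1) ^ k
  last : ∀ j : Fin k, IsLast D χ (j + 1) (digit (n + 1) l j)
  profit : ∀ j : Fin k, digit (maxTotalProfit p + 1) q j = colorProfit p χ j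

theorem represents_zero : Represents D p (fun _ => 0) 0 0 where
  l_lt := by positivity
  q_lt := by positivity
  last j := .inl ⟨by simp [digit], by simp⟩
  profit j := by simp [digit, colorProfit]

/-- The vertex `v` may follow the last vertex of colour `j + 1`. -/
def MayFollow (D : Fin n → Fin n → Prop) (l : ℕ) (v : Fin n) (j : ℕ) : Prop :=
  digit (n + 1) l j = 0 ∨ ∃ u : Fin n, digit (n + 1) l j = u + 1 ∧ D u v

/-- The code of the last vertices after `v` has received the colour `j + 1`. -/
def nextLast (n l v j : ℕ) : ℕ :=
  l + (v + 1) * (n + 1) ^ j - digit (n + 1) l j * (n + 1) ^ j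

/-- The code of the profit profile after the profit `x` has been added to colour `j + 1`. -/
def nextProfit (Q q x j : ℕ) : ℕ := q + x * (Q + 1) ^ j

/-- Every vertex of the colour is the last one or has an arc to it; transitivity does the rest. -/
theorem arc_of_mayFollow (hD : IsTransitiveOrientation Gᶜ D) {χ : Fin n → ℕ} {l c : ℕ} {v : Fin n}
    {j : ℕ} (hl : IsLast D χ c (digit (n + 1) l j)) (h : MayFollow D l v j) {u : Fin n}
    (hu : χ u = c) : D u v := by
  rcases hl with ⟨-, h'⟩ | ⟨w, hw, -, h'⟩
  · exact absurd hu (h' u)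
  · rcases h with h | ⟨w', hw', h⟩
    · omega
    · have : w = w' := Fin.ext (by omega)
      subst this
      by_cases huw : u = w
      · rwa [huw]
      · exact hD.trans _ _ _ (h' u hu huw) h

theorem not_adj_of_arc (hD : IsTransitiveOrientation Gᶜ D) {u v : Fin n} (h : D u v) :
    ¬ G.Adj u v :=
  ((SimpleGraph.compl_adj _ _ _).1 (hD.adj_of_arc u v h)).2

theorem IsColoringOn.extend (hD : IsTransitiveOrientation Gᶜ D) {U : Finset (Fin n)}
    {χ : Fin n → ℕ} {l q : ℕ} (hχ : IsColoringOn G k U χ) (hr : Represents D p χ l q) {v : Fin n}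
    (j : Fin k) (h : MayFollow D l v j) :
    IsColoringOn G k (insert v U) (Function.update χ v (j + 1)) := by
  have key : ∀ u, χ u = j + 1 → ¬ G.Adj u v := fun u hu =>
    not_adj_of_arc hD (arc_of_mayFollow hD (hr.last j) h hu)
  refine ⟨fun u => ?_, fun u hu => ?_, fun u w huw hu => ?_⟩
  · rw [Function.update_apply]
    split_ifs
    · exact j.2
    · exact hχ.le u
  · rw [Finset.mem_insert, not_or] at hu
    rw [Function.update_of_ne hu.1, hχ.zero u hu.2]
  · simp only [Function.update_apply] at huw hu
    split_ifs at huw hu with h1 h2 h2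
    · rw [h1, h2]; exact G.irrefl
    · rw [h1, G.adj_comm]; exact key w huw.symm
    · rw [h2]; exact key u huw
    · exact hχ.indep u w huw hu

theorem colorProfit_update {χ : Fin n → ℕ} {v : Fin n} (hv : χ v = 0) (i j : Fin k) :
    colorProfit p (Function.update χ v (j + 1)) i =
      if i = j then colorProfit p χ j + p j v else colorProfit p χ i := by
  unfold colorProfit
  rw [← Finset.add_sum_erase _ _ (Finset.mem_univ v),
    ← Finset.add_sum_erase Finset.univ (fun u => if χ u = j + 1 then p j u else 0)
      (Finset.mem_univ v), ← Finset.add_sum_erase Finset.univ (fun u => if χ u = i + 1 then p i u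
      else 0) (Finset.mem_univ v)]
  have : ∑ u ∈ Finset.univ.erase v, (if Function.update χ v (j + 1) u = i + 1 then p i u else 0) =
      ∑ u ∈ Finset.univ.erase v, (if χ u = i + 1 then p i u else 0) := by
    refine Finset.sum_congr rfl fun u hu => ?_
    rw [Function.update_of_ne (Finset.ne_of_mem_erase hu)]
  rw [this, Function.update_self, hv]
  by_cases hij : i = j
  · subst hij; simp [add_comm]
  · have : (j : ℕ) ≠ i := fun h => hij (Fin.ext h.symm)
    simp [hij, this]

/-- The new codes are functions of the old codes, `v` and `j` alone. This is why one colouring per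
code pair suffices in the table. -/
theorem Represents.extend (hD : IsTransitiveOrientation Gᶜ D) {U : Finset (Fin n)}
    {χ : Fin n → ℕ} {l q : ℕ} (hχ : IsColoringOn G k U χ) (hr : Represents D p χ l q) {v : Fin n}
    (hv : v ∉ U) (j : Fin k) (h : MayFollow D l v j) :
    Represents D p (Function.update χ v (j + 1)) (nextLast n l v j)
      (nextProfit (maxTotalProfit p) q (p j v) j) := by
  have hv0 := hχ.zero v hv
  have h1 := digit_replace hr.l_lt j (x := v + 1) (by omega)
  -- The new profit is still at most `Q`, so the addition does not carry into the next digit.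
  have hle := colorProfit_le (p := p) (Function.update χ v (j + 1)) j
  rw [colorProfit_update hv0, if_pos rfl] at hle
  have h2 := digit_replace hr.q_lt j (x := colorProfit p χ j + p j v) (by omega)
  have e : q + (colorProfit p χ j + p j v) * (maxTotalProfit p + 1) ^ (j : ℕ) -
      digit (maxTotalProfit p + 1) q j * (maxTotalProfit p + 1) ^ (j : ℕ) =
      nextProfit (maxTotalProfit p) q (p j v) j := by
    rw [hr.profit j, nextProfit, add_mul]
    omega
  rw [e] at h2
  refine ⟨h1.1, h2.1, fun i => ?_, fun i => ?_⟩
  · rw [nextLast, h1.2]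
    split_ifs with hij
    · subst hij
      refine .inr ⟨v, rfl, by simp, fun u hu huv => ?_⟩
      rw [Function.update_of_ne huv] at hu
      exact arc_of_mayFollow hD (hr.last i) h hu
    · have hij' : (j : ℕ) ≠ i := fun h => hij (Fin.ext h.symm)
      have hiff : ∀ u, Function.update χ v (j + 1) u = i + 1 ↔ χ u = i + 1 := by
        intro u
        rw [Function.update_apply]
        split_ifs with huv
        · subst huv; rw [hv0]; omega
        · rfl
      have := hr.last i
      simp only [IsLast, ne_eq, hiff] at this ⊢
      exact this
  · rw [h2.2, colorProfit_update hv0]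
    split_ifs
    · rfl
    · exact hr.profit i

theorem IsColoringOn.restrict {U : Finset (Fin n)} {χ : Fin n → ℕ} {v : Fin n}
    (hχ : IsColoringOn G k (insert v U) χ) : IsColoringOn G k U (Function.update χ v 0) := by
  refine ⟨fun u => ?_, fun u hu => ?_, fun u w huw hu => ?_⟩
  · rw [Function.update_apply]
    split_ifs
    · exact Nat.zero_le _
    · exact hχ.le u
  · rw [Function.update_apply]
    split_ifs with h
    · rfl
    · exact hχ.zero u (by simp [h, hu])
  · have hu' : u ≠ v := by rintro rfl; simp at hu
    rw [Function.update_of_ne hu'] at huw hu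
    have hw : w ≠ v := by rintro rfl; simp [hu] at huw
    rw [Function.update_of_ne hw] at huw
    exact hχ.indep u w huw hu

theorem IsColoringOn.mono {U U' : Finset (Fin n)} {χ : Fin n → ℕ} (hχ : IsColoringOn G k U χ)
    (h : U ⊆ U') : IsColoringOn G k U' χ :=
  ⟨hχ.le, fun v hv => hχ.zero v fun h' => hv (h h'), hχ.indep⟩

/-- The last vertex `u` of the colour and `v` are not adjacent in `G`, so an arc joins them; it
cannot leave `v`, because `U` contains no successor of `v`. -/
theorem IsColoringOn.mayFollow (hD : IsTransitiveOrientation Gᶜ D) {U : Finset (Fin n)}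
    {χ : Fin n → ℕ} {l q : ℕ} {v : Fin n} {j : Fin k} (hχ : IsColoringOn G k (insert v U) χ)
    (hU : ∀ u ∈ U, ¬ D v u) (hr : Represents D p (Function.update χ v 0) l q)
    (hj : χ v = j + 1) : MayFollow D l v j := by
  rcases hr.last j with ⟨h, -⟩ | ⟨u, h1, h2, -⟩
  · exact .inl h
  · refine .inr ⟨u, h1, ?_⟩
    have huv : u ≠ v := by rintro rfl; simp at h2
    rw [Function.update_of_ne huv] at h2
    have huU : u ∈ U := by
      by_contra h
      have := hχ.zero u (by simp [huv, h])
      omega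
    have hadj : Gᶜ.Adj u v :=
      (SimpleGraph.compl_adj _ _ _).2 ⟨huv, hχ.indep u v (h2.trans hj.symm) (by omega)⟩
    exact (hD.arc_or_arc hadj).resolve_right (hU u huU)

/-! ### Colourings as sequences of sets -/

/-- The colour classes of `χ`. -/
def colorClasses (k : ℕ) (χ : Fin n → ℕ) (j : Fin k) : Finset (Fin n) :=
  Finset.univ.filter fun v => χ v = j + 1

theorem profitProfile_colorClasses (χ : Fin n → ℕ) :
    profitProfile p (colorClasses k χ) = colorProfit p χ := by
  ext j
  simp [profitProfile, colorClasses, colorProfit, Finset.sum_filter]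

theorem IsColoringOn.isPartialColoring {U : Finset (Fin n)} {χ : Fin n → ℕ}
    (hχ : IsColoringOn G k U χ) : IsPartialColoring G (colorClasses k χ) := by
  constructor
  · intro i j hij
    rw [Finset.disjoint_left]
    intro v hi hj
    simp only [colorClasses, Finset.mem_filter, Finset.mem_univ, true_and] at hi hj
    exact hij (Fin.ext (by omega))
  · intro j u hu v hv _
    simp only [colorClasses, Finset.coe_filter, Finset.mem_univ, true_and,
      Set.mem_ofPred_eq] at hu hv
    exact hχ.indep u v (hu.trans hv.symm) (by omega)

theorem exists_isColoringOn {X : Fin k → Finset (Fin n)} (hX : IsPartialColoring G X) :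
    ∃ χ, IsColoringOn G k Finset.univ χ ∧ colorClasses k χ = X := by
  classical
  let χ : Fin n → ℕ := fun v => if h : ∃ j, v ∈ X j then (h.choose : ℕ) + 1 else 0
  have hχ : ∀ v (j : Fin k), χ v = (j : ℕ) + 1 ↔ v ∈ X j := by
    intro v j
    dsimp only [χ]
    split_ifs with h
    · have hc := h.choose_spec
      constructor
      · intro e
        have : h.choose = j := Fin.ext (by omega)
        rwa [← this]
      · intro hv
        by_contra hne
        have hne' : h.choose ≠ j := fun e => hne (by rw [e])
        exact Finset.disjoint_left.1 (hX.1 _ _ hne') hc hv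
    · simp only [not_exists] at h
      simp [h j]
  have hcase : ∀ v, χ v ≠ 0 → ∃ j : Fin k, χ v = j + 1 := by
    intro v hv
    dsimp only [χ] at hv ⊢
    split_ifs at hv ⊢ with h
    · exact ⟨_, rfl⟩
    · exact absurd rfl hv
  refine ⟨χ, ⟨fun v => ?_, fun v hv => absurd (Finset.mem_univ v) hv, fun u v huv hu => ?_⟩, ?_⟩
  · by_cases h : χ v = 0
    · omega
    · obtain ⟨j, hj⟩ := hcase v h
      omega
  · obtain ⟨j, hj⟩ := hcase u hu
    by_cases he : u = v
    · rw [he]; exact G.irrefl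
    · exact hX.2 j ((hχ u j).1 hj) ((hχ v j).1 (huv ▸ hj)) he
  · ext j v
    simp [colorClasses, hχ]

end Coloring

/-! ### The dynamic program -/

section DynamicProgram

variable {n k : ℕ} {G : SimpleGraph (Fin n)} {D : Fin n → Fin n → Prop} {p : Fin k → Fin n → ℕ}

/-- The numbers that the machine has to be able to hold. -/
structure Bounds (W n k Q : ℕ) : Prop where
  n_lt : n < W
  k_lt : k < W
  n_mul : n * n ≤ W
  k_mul : k * n ≤ W
  last : (n + 1) * (n + 1) ^ k ≤ W
  profit : (Q + 1) ^ k ≤ W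
  code : (n + 1) ^ k * (Q + 1) ^ k < W

/-- The quantities that are computed before the dynamic program. -/
structure Prepared (D : Fin n → Fin n → Prop) (p : Fin k → Fin n → ℕ) (s : State) : Prop where
  reg0 : s.reg 0 = n
  reg1 : s.reg 1 = 1
  reg2 : s.reg 2 = 0
  reg3 : s.reg 3 = k
  reg41 : s.reg 41 = n + 1
  reg42 : s.reg 42 = maxTotalProfit p + 1
  reg44 : s.reg 44 = (maxTotalProfit p + 1) ^ k
  arr1 : s.arr 1 = matrixCells p
  arr4_le : ∀ x : Fin n × Fin n, s.arr 4 (pairCode x) ≤ 1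
  arr4 : ∀ x : Fin n × Fin n, s.arr 4 (pairCode x) = 1 ↔ D x.1 x.2
  arr7 : ∀ j < k, s.arr 7 j = (n + 1) ^ j
  arr8 : ∀ j < k, s.arr 8 j = (maxTotalProfit p + 1) ^ j

/-- The side conditions are Boolean so that `rfl` decides them for each concrete program. -/
theorem Prepared.of_frame {P : Prog} {s s' : State} (h : Prepared D p s) (hF : Frame P s s')
    (hr : [0, 1, 2, 3, 41, 42, 44].all (fun r => !P.writesReg r) = true)
    (ha : [1, 4, 7, 8].all (fun r => !P.writesArr r) = true) : Prepared D p s' := by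
  simp at hr ha
  obtain ⟨r0, r1, r2, r3, r41, r42, r44⟩ := hr
  obtain ⟨a1, a4, a7, a8⟩ := ha
  constructor
  · rw [hF.reg' 0 r0, h.reg0]
  · rw [hF.reg' 1 r1, h.reg1]
  · rw [hF.reg' 2 r2, h.reg2]
  · rw [hF.reg' 3 r3, h.reg3]
  · rw [hF.reg' 41 r41, h.reg41]
  · rw [hF.reg' 42 r42, h.reg42]
  · rw [hF.reg' 44 r44, h.reg44]
  · rw [hF.arr' 1 a1, h.arr1]
  · rw [hF.arr' 4 a4]; exact h.arr4_le
  · rw [hF.arr' 4 a4]; exact h.arr4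
  · rw [hF.arr' 7 a7]; exact h.arr7
  · rw [hF.arr' 8 a8]; exact h.arr8

/-- The table of the dynamic program: item `i` holds the codes of the colouring `X i`, which arises
from that of its parent by giving a colour to one vertex. -/
structure Items (G : SimpleGraph (Fin n)) (D : Fin n → Fin n → Prop) (p : Fin k → Fin n → ℕ)
    (U : Finset (Fin n)) (X : ℕ → Fin n → ℕ) (s : State) : Prop where
  pos : 0 < s.reg 54
  zero : X 0 = fun _ => 0
  coloring : ∀ i < s.reg 54, IsColoringOn G k U (X i)
  rep : ∀ i < s.reg 54, Represents D p (X i) (s.arr 9 i) (s.arr 10 i)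
  parent : ∀ i < s.reg 54, 0 < i → s.arr 12 i < i ∧ s.arr 14 i ≤ k ∧ 0 < s.arr 14 i ∧
    ∃ v : Fin n, s.arr 13 i = v ∧ X (s.arr 12 i) v = 0 ∧
      X i = Function.update (X (s.arr 12 i)) v (s.arr 14 i)
  visited_le : ∀ c, s.arr 11 c ≤ 1
  visited : ∀ c, s.arr 11 c = 1 ↔
    ∃ i < s.reg 54, s.arr 9 i * (maxTotalProfit p + 1) ^ k + s.arr 10 i = c
  inj : ∀ i < s.reg 54, ∀ i' < s.reg 54, s.arr 9 i = s.arr 9 i' → s.arr 10 i = s.arr 10 i' → i = i'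

/-- Every colouring of `U` is represented by an item. -/
def Complete (G : SimpleGraph (Fin n)) (D : Fin n → Fin n → Prop) (p : Fin k → Fin n → ℕ)
    (U : Finset (Fin n)) (s : State) : Prop :=
  ∀ χ, IsColoringOn G k U χ → ∃ i < s.reg 54, Represents D p χ (s.arr 9 i) (s.arr 10 i)

theorem Items.congr {U : Finset (Fin n)} {X : ℕ → Fin n → ℕ} {s s' : State} (h : Items G D p U X s)
    (h54 : s'.reg 54 = s.reg 54) (h9 : s'.arr 9 = s.arr 9) (h10 : s'.arr 10 = s.arr 10)
    (h11 : s'.arr 11 = s.arr 11) (h12 : s'.arr 12 = s.arr 12) (h13 : s'.arr 13 = s.arr 13)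
    (h14 : s'.arr 14 = s.arr 14) : Items G D p U X s' := by
  constructor
  · rw [h54]; exact h.pos
  · exact h.zero
  · rw [h54]; exact h.coloring
  · rw [h54, h9, h10]; exact h.rep
  · rw [h54, h12, h13, h14]; exact h.parent
  · rw [h11]; exact h.visited_le
  · rw [h11, h54, h9, h10]; exact h.visited
  · rw [h54, h9, h10]; exact h.inj

theorem mul_add_lt_mul {a b A R : ℕ} (ha : a < A) (hb : b < R) : a * R + b < A * R := by
  have : (a + 1) * R ≤ A * R := Nat.mul_le_mul_right _ ha
  rw [add_mul] at this
  omega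

theorem mul_add_inj {a b a' b' R : ℕ} (hb : b < R) (hb' : b' < R) (h : a * R + b = a' * R + b') :
    a = a' ∧ b = b' := by
  have hb2 : b = b' := by
    have := congrArg (· % R) h
    simpa [Nat.mod_eq_of_lt hb, Nat.mod_eq_of_lt hb'] using this
  exact ⟨Nat.eq_of_mul_eq_mul_right (by omega) (by omega : a * R = a' * R), hb2⟩

/-- Distinct items have distinct code pairs; the bound is the number of states that drives the
running time. -/
theorem Items.count_le {U : Finset (Fin n)} {X : ℕ → Fin n → ℕ} {s : State}
    (h : Items G D p U X s) : s.reg 54 ≤ (n + 1) ^ k * (maxTotalProfit p + 1) ^ k := by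
  have := Finset.card_le_card_of_injOn (s := Finset.range (s.reg 54))
    (t := Finset.range ((n + 1) ^ k * (maxTotalProfit p + 1) ^ k))
    (fun i => s.arr 9 i * (maxTotalProfit p + 1) ^ k + s.arr 10 i)
    (fun i hi => by
      have := h.rep i (by simpa using hi)
      simpa using mul_add_lt_mul this.l_lt this.q_lt)
    (fun i hi j hj hij => by
      have hi' := by simpa using hi
      have hj' := by simpa using hj
      have := mul_add_inj (h.rep i hi').q_lt (h.rep j hj').q_lt hij
      exact h.inj i hi' j hj' this.1 this.2)
  simpa using this

/-- Load the codes of item `R[56]` and its last vertex of colour `R[57] + 1`. -/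
def loadItemProg : Prog :=
  .seq (.load 58 9 56) <| .seq (.load 59 10 56) <| .seq (.load 60 7 57) <|
  .seq (.load 61 8 57) <| .seq (.arith .div 62 58 60) (.arith .mod 62 62 41)

theorem runs_loadItemProg {W i : ℕ} {s : State} (hB : Bounds W n k (maxTotalProfit p))
    (hp : Prepared D p s) {χ : Fin n → ℕ} (hr : Represents D p χ (s.arr 9 i) (s.arr 10 i))
    (hi : s.reg 56 = i) (j : Fin k) (hj : s.reg 57 = j) :
    Runs W loadItemProg s fun t s' => t = 6 ∧ s'.reg 58 = s.arr 9 i ∧ s'.reg 59 = s.arr 10 i ∧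
      s'.reg 60 = (n + 1) ^ (j : ℕ) ∧ s'.reg 61 = (maxTotalProfit p + 1) ^ (j : ℕ) ∧
      s'.reg 62 = digit (n + 1) (s.arr 9 i) j := by
  have h7 := hp.arr7 j j.2
  have h8 := hp.arr8 j j.2
  have b1 : (n + 1) ^ (j : ℕ) ≤ (n + 1) ^ k := Nat.pow_le_pow_right (Nat.succ_pos _) j.2.le
  have b2 : (maxTotalProfit p + 1) ^ (j : ℕ) ≤ (maxTotalProfit p + 1) ^ k :=
    Nat.pow_le_pow_right (Nat.succ_pos _) j.2.le
  have b3 : (n + 1) ^ k ≤ (n + 1) * (n + 1) ^ k := Nat.le_mul_of_pos_left _ (Nat.succ_pos _)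
  have h1 := hr.l_lt
  have h2 := hr.q_lt
  have h3 := hB.last
  have h4 := hB.profit
  have h5 : s.arr 9 i / (n + 1) ^ (j : ℕ) ≤ s.arr 9 i := Nat.div_le_self _ _
  have h6 : digit (n + 1) (s.arr 9 i) j ≤ s.arr 9 i / (n + 1) ^ (j : ℕ) := Nat.mod_le _ _
  rw [digit] at h6
  simp [loadItemProg, hi, hj, h7, h8, hp.reg41]
  exact ⟨by omega, by omega, by omega, by omega, by omega, by omega, rfl⟩

/-- Decide whether vertex `R[51]` may follow the vertex with number `R[62] - 1`. -/
def mayFollowProg : Prog :=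
  .ite 62 1 (.const 64 1) <| .seq (.arith .sub 63 62 1) <| .seq (.arith .mul 63 63 0) <|
    .seq (.arith .add 63 63 51) (.load 64 4 63)

theorem runs_mayFollowProg {W l j : ℕ} {s : State} (hB : Bounds W n k (maxTotalProfit p))
    (hp : Prepared D p s) (v : Fin n) (hv : s.reg 51 = v)
    (h62 : s.reg 62 = digit (n + 1) l j) :
    Runs W mayFollowProg s fun t s' => t ≤ 5 ∧ (0 < s'.reg 64 ↔ MayFollow D l v j) := by
  have hd : digit (n + 1) l j < n + 1 := digit_lt (Nat.succ_pos _)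
  have hnW := hB.n_lt
  simp only [mayFollowProg, runs_ite, hp.reg1, h62]
  constructor
  · intro h
    simp
    exact ⟨by omega, .inl (by omega)⟩
  · intro h
    obtain ⟨u, hu⟩ : ∃ u : Fin n, digit (n + 1) l j = u + 1 :=
      ⟨⟨digit (n + 1) l j - 1, by omega⟩, by simp; omega⟩
    have hlt := pairCode_lt (u, v)
    have e : (u : ℕ) * n + v = pairCode (u, v) := rfl
    have hle := hp.arr4_le (u, v)
    have hiff := hp.arr4 (u, v)
    have := hB.n_mul
    have hun : (u : ℕ) * n ≤ pairCode (u, v) := Nat.le_add_right _ _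
    have hu2 := u.2
    simp [hp.reg1, h62, hu, hp.reg0, hv, e]
    refine ⟨by omega, by omega, by omega, by omega, ?_⟩
    rw [show 0 < s.arr 4 (pairCode (u, v)) ↔ s.arr 4 (pairCode (u, v)) = 1 by omega, hiff]
    constructor
    · intro h'
      exact .inr ⟨u, hu, h'⟩
    · rintro (h' | ⟨u', hu', h'⟩)
      · omega
      · have : u = u' := Fin.ext (by omega)
        rwa [this]

/-- Compute the codes of the extended colouring. -/
def nextCodeProg : Prog :=
  .seq (.arith .add 65 51 1) <| .seq (.arith .mul 65 65 60) <| .seq (.arith .add 65 58 65) <|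
  .seq (.arith .mul 66 62 60) <| .seq (.arith .sub 65 65 66) <| .seq (.arith .mul 63 57 0) <|
  .seq (.arith .add 63 63 51) <| .seq (.load 66 1 63) <| .seq (.arith .mul 66 66 61) <|
  .seq (.arith .add 67 59 66) <| .seq (.arith .mul 68 65 44) <| .seq (.arith .add 68 68 67)
  (.load 66 11 68)

theorem runs_nextCodeProg {W l q : ℕ} {s : State} (hB : Bounds W n k (maxTotalProfit p))
    (hp : Prepared D p s) (v : Fin n) (hv : s.reg 51 = v) (j : Fin k) (hj : s.reg 57 = j)
    (h58 : s.reg 58 = l) (h59 : s.reg 59 = q) (h60 : s.reg 60 = (n + 1) ^ (j : ℕ))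
    (h61 : s.reg 61 = (maxTotalProfit p + 1) ^ (j : ℕ)) (h62 : s.reg 62 = digit (n + 1) l j)
    (hl : l < (n + 1) ^ k) (hvis : ∀ c, s.arr 11 c ≤ 1) (hl' : nextLast n l v j < (n + 1) ^ k)
    (hq' : nextProfit (maxTotalProfit p) q (p j v) j < (maxTotalProfit p + 1) ^ k) :
    Runs W nextCodeProg s fun t s' => t = 13 ∧ s'.reg 65 = nextLast n l v j ∧
      s'.reg 67 = nextProfit (maxTotalProfit p) q (p j v) j ∧
      s'.reg 68 = nextLast n l v j * (maxTotalProfit p + 1) ^ k +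
        nextProfit (maxTotalProfit p) q (p j v) j ∧
      s'.reg 66 = s.arr 11 (s'.reg 68) := by
  have hb1 := hB.n_lt
  have hb2 := hB.k_mul
  have hb3 := hB.last
  have hb4 := hB.profit
  have hb5 := hB.code
  have hpm : s.arr 1 (j * n + v) = p j v := by rw [hp.arr1, matrixCells_apply]
  have c1 : digit (n + 1) l j * (n + 1) ^ (j : ℕ) ≤ l := digit_mul_pow_le
  have c2 : ((v : ℕ) + 1) * (n + 1) ^ (j : ℕ) ≤ n * (n + 1) ^ k :=
    Nat.mul_le_mul v.2 (Nat.pow_le_pow_right (Nat.succ_pos _) j.2.le)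
  have c3 : (n + 1) * (n + 1) ^ k = n * (n + 1) ^ k + (n + 1) ^ k := by ring
  have c4 := mul_add_lt_mul hl' hq'
  have c5 := mul_add_lt_mul j.2 v.2
  -- The loaded profit fits into a word because it is at most its contribution to the new profit
  -- code.
  have c6 : p j v ≤ p j v * (maxTotalProfit p + 1) ^ (j : ℕ) :=
    Nat.le_mul_of_pos_right _ (by positivity)
  have hvW := hvis (nextLast n l v j * (maxTotalProfit p + 1) ^ k +
        nextProfit (maxTotalProfit p) q (p j v) j)
  have hv2 := v.2
  simp only [nextCodeProg, runs_seq, runs_arith, runs_load, ArithOp.eval, State.reg_setReg,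
    State.arr_setReg]
  simp only [Nat.reduceEqDiff, if_true, if_false, hv, hp.reg1, h60, h58, h62, hj, hp.reg0, hpm, h61, h59, hp.reg44]
  have e1 : l + ((v : ℕ) + 1) * (n + 1) ^ (j : ℕ) - digit (n + 1) l j * (n + 1) ^ (j : ℕ) =
      nextLast n l v j := rfl
  have e2 : q + p j v * (maxTotalProfit p + 1) ^ (j : ℕ) =
      nextProfit (maxTotalProfit p) q (p j v) j := rfl
  rw [e1, e2]
  exact ⟨by omega, by omega, by omega, by omega, by omega, by omega, by omega, by omega,
    by omega, by omega, by omega, by omega, by omega, trivial, rfl, rfl, rfl, trivial⟩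

/-- Append a new item. -/
def pushItemProg : Prog :=
  .seq (.store 11 68 1) <| .seq (.store 9 54 65) <| .seq (.store 10 54 67) <|
  .seq (.store 12 54 56) <| .seq (.store 13 54 51) <| .seq (.arith .add 69 57 1) <|
  .seq (.store 14 54 69) (.arith .add 54 54 1)

theorem runs_pushItemProg {W l q i : ℕ} {s : State} (hB : Bounds W n k (maxTotalProfit p))
    {U : Finset (Fin n)} {X : ℕ → Fin n → ℕ} (hI : Items G D p U X s) (h1 : s.reg 1 = 1)
    (hi : s.reg 56 = i) (hi' : i < s.reg 54) (v : Fin n) (hv : s.reg 51 = v) (j : Fin k)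
    (hj : s.reg 57 = j) (h65 : s.reg 65 = l) (h67 : s.reg 67 = q)
    (h68 : s.reg 68 = l * (maxTotalProfit p + 1) ^ k + q) (h11 : s.arr 11 (s.reg 68) = 0)
    (hv0 : X i v = 0) (hχ : IsColoringOn G k U (Function.update (X i) v (j + 1)))
    (hr : Represents D p (Function.update (X i) v (j + 1)) l q) :
    Runs W pushItemProg s fun t s' => t = 8 ∧
      Items G D p U (Function.update X (s.reg 54) (Function.update (X i) v (j + 1))) s' ∧
      s'.reg 54 = s.reg 54 + 1 ∧ s'.arr 9 = Function.update (s.arr 9) (s.reg 54) l ∧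
      s'.arr 10 = Function.update (s.arr 10) (s.reg 54) q := by
  have hb1 := hB.n_lt
  have hb2 := hB.k_lt
  have hb3 := hB.last
  have hb4 := hB.profit
  have hb5 := hB.code
  have hcnt := hI.count_le
  have hl := hr.l_lt
  have hq := hr.q_lt
  have c3 : (n + 1) ^ k ≤ (n + 1) * (n + 1) ^ k := Nat.le_mul_of_pos_left _ (Nat.succ_pos _)
  have hv2 := v.2
  have hj2 := j.2
  have hpos := hI.pos
  rw [h68] at h11
  have hnew : ∀ i' < s.reg 54,
      s.arr 9 i' * (maxTotalProfit p + 1) ^ k + s.arr 10 i' ≠ l * (maxTotalProfit p + 1) ^ k + q := by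
    intro i' hi' e
    have := (hI.visited _).2 ⟨i', hi', e⟩
    omega
  simp [pushItemProg, h1, hi, hv, hj, h65, h67, h68]
  refine ⟨by omega, by omega, by omega, by omega, by omega, by omega, by omega, ?_⟩
  constructor
  · simp
  · simp [Function.update_of_ne hpos.ne, hI.zero]
  · intro i' hi'
    simp at hi'
    rw [Function.update_apply]
    split_ifs with h
    · exact hχ
    · exact hI.coloring i' (by omega)
  · intro i' hi'
    simp at hi' ⊢
    simp only [Function.update_apply]
    split_ifs with h
    · exact hr
    · exact hI.rep i' (by omega)
  · intro i' hi'' hi0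
    simp at hi'' ⊢
    by_cases h : i' = s.reg 54
    · subst h
      simp only [Function.update_self]
      exact ⟨hi', by omega, by omega, v, rfl, by rw [Function.update_of_ne hi'.ne]; exact hv0,
        by rw [Function.update_of_ne hi'.ne]⟩
    · obtain ⟨a1, a2, a3, w, a4, a5, a6⟩ := hI.parent i' (by omega) hi0
      simp only [Function.update_of_ne h]
      rw [Function.update_of_ne (by omega : s.arr 12 i' ≠ s.reg 54)]
      exact ⟨a1, a2, a3, w, a4, a5, a6⟩
  · intro c
    simp [Function.update_apply]
    split_ifs
    · exact le_rfl
    · exact hI.visited_le c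
  · intro c
    simp
    rw [Function.update_apply]
    constructor
    · intro hc
      split_ifs at hc with h
      · exact ⟨s.reg 54, by omega, by simp [h]⟩
      · obtain ⟨i', h1, h2⟩ := (hI.visited c).1 hc
        exact ⟨i', by omega, by simp [Function.update_of_ne h1.ne, h2]⟩
    · rintro ⟨i', h1, h2⟩
      split_ifs with h
      · rfl
      · by_cases hi' : i' = s.reg 54
        · subst hi'
          simp at h2
          exact absurd h2.symm h
        · simp only [Function.update_of_ne hi'] at h2
          exact (hI.visited c).2 ⟨i', by omega, h2⟩
  · intro a ha b hb
    simp at ha hb ⊢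
    by_cases h1 : a = s.reg 54
    · by_cases h2 : b = s.reg 54
      · omega
      · subst h1
        simp only [Function.update_self, Function.update_of_ne h2]
        intro e1 e2
        exact absurd (by rw [e1, e2]) (hnew b (by omega))
    · by_cases h2 : b = s.reg 54
      · subst h2
        simp only [Function.update_self, Function.update_of_ne h1]
        intro e1 e2
        exact absurd (by rw [e1, e2]) (hnew a (by omega))
      · simp only [Function.update_of_ne h1, Function.update_of_ne h2]
        exact hI.inj a (by omega) b (by omega)

/-- Give the colour `R[57] + 1` to vertex `R[51]` in the colouring of item `R[56]`, if this is
possible and leads to new codes. -/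
def tryExtendProg : Prog :=
  .seq loadItemProg <| .seq mayFollowProg <|
    .ite 2 64 (.seq nextCodeProg (.ite 66 1 pushItemProg .nop)) .nop

/-- The table of `s'` extends that of `s`. -/
structure ItemsExt (X X' : ℕ → Fin n → ℕ) (s s' : State) : Prop where
  le : s.reg 54 ≤ s'.reg 54
  eq : ∀ i < s.reg 54, X' i = X i ∧ s'.arr 9 i = s.arr 9 i ∧ s'.arr 10 i = s.arr 10 i

theorem ItemsExt.of_eq {X : ℕ → Fin n → ℕ} {s s' : State} (h54 : s'.reg 54 = s.reg 54)
    (h9 : s'.arr 9 = s.arr 9) (h10 : s'.arr 10 = s.arr 10) : ItemsExt X X s s' :=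
  ⟨h54.ge, fun i _ => ⟨rfl, by rw [h9], by rw [h10]⟩⟩

theorem ItemsExt.trans {X X' X'' : ℕ → Fin n → ℕ} {s s' s'' : State} (h : ItemsExt X X' s s')
    (h' : ItemsExt X' X'' s' s'') : ItemsExt X X'' s s'' :=
  ⟨h.le.trans h'.le, fun i hi => by
    obtain ⟨a1, a2, a3⟩ := h.eq i hi
    obtain ⟨b1, b2, b3⟩ := h'.eq i (hi.trans_le h.le)
    exact ⟨b1.trans a1, b2.trans a2, b3.trans a3⟩⟩

/-- Some item has the codes `l` and `q`. -/
def HasItem (s : State) (l q : ℕ) : Prop := ∃ i < s.reg 54, s.arr 9 i = l ∧ s.arr 10 i = q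

theorem HasItem.ext {X X' : ℕ → Fin n → ℕ} {s s' : State} {l q : ℕ} (h : HasItem s l q)
    (hE : ItemsExt X X' s s') : HasItem s' l q := by
  obtain ⟨i, hi, h1, h2⟩ := h
  obtain ⟨-, a2, a3⟩ := hE.eq i hi
  exact ⟨i, hi.trans_le hE.le, a2.trans h1, a3.trans h2⟩

/-- The table may already hold colourings that use `v`, but the item being extended is an old one,
coloured inside `U`; hence the separate hypothesis `hXi`. -/
theorem runs_tryExtendProg {W i : ℕ} {s : State} (hB : Bounds W n k (maxTotalProfit p))
    (hD : IsTransitiveOrientation Gᶜ D) (hp : Prepared D p s)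
    {U : Finset (Fin n)} {X : ℕ → Fin n → ℕ} (v : Fin n) (hvU : v ∉ U)
    (hI : Items G D p (insert v U) X s) (hi : s.reg 56 = i) (hi' : i < s.reg 54)
    (hXi : IsColoringOn G k U (X i)) (hv : s.reg 51 = v) (j : Fin k) (hj : s.reg 57 = j) :
    Runs W tryExtendProg s fun t s' => t ≤ 36 ∧ ∃ X', Items G D p (insert v U) X' s' ∧
      ItemsExt X X' s s' ∧ (MayFollow D (s.arr 9 i) v j →
        HasItem s' (nextLast n (s.arr 9 i) v j)
          (nextProfit (maxTotalProfit p) (s.arr 10 i) (p j v) j)) := by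
  have hrep := hI.rep i hi'
  rw [tryExtendProg, runs_seq]
  refine (runs_loadItemProg hB hp hrep hi j hj).frame.mono ?_
  rintro t1 s1 ⟨⟨rfl, a58, a59, a60, a61, a62⟩, hF1⟩
  rw [runs_seq]
  have hp1 := hp.of_frame hF1 rfl rfl
  have v1 : s1.reg 51 = v := by rw [hF1.reg 51, hv]
  refine (runs_mayFollowProg (l := s.arr 9 i) (j := j) hB hp1 v v1 a62).frame.mono ?_
  rintro t2 s2 ⟨⟨ht2, h64⟩, hF2⟩
  have hp2 := hp1.of_frame hF2 rfl rfl
  have v2 : s2.reg 51 = v := by rw [hF2.reg 51, v1]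
  rw [runs_ite, hp2.reg2, h64]
  constructor
  · intro hmay
    have hχ := hXi.extend hD hrep j hmay
    have hr' := hrep.extend hD hXi hvU j hmay
    rw [runs_seq]
    refine (runs_nextCodeProg (l := s.arr 9 i) (q := s.arr 10 i) hB hp2 v v2 j
      (by rw [hF2.reg 57, hF1.reg 57, hj]) (by rw [hF2.reg 58, a58]) (by rw [hF2.reg 59, a59])
      (by rw [hF2.reg 60, a60]) (by rw [hF2.reg 61, a61]) (by rw [hF2.reg 62, a62])
      hrep.l_lt (by rw [hF2.arr 11, hF1.arr 11]; exact hI.visited_le) hr'.l_lt hr'.q_lt).frame.mono ?_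
    rintro t3 s3 ⟨⟨rfl, c65, c67, c68, c66⟩, hF3⟩
    have hp3 := hp2.of_frame hF3 rfl rfl
    have v3 : s3.reg 51 = v := by rw [hF3.reg 51, v2]
    have d54 : s3.reg 54 = s.reg 54 := by rw [hF3.reg 54, hF2.reg 54, hF1.reg 54]
    have d9 : s3.arr 9 = s.arr 9 := by rw [hF3.arr 9, hF2.arr 9, hF1.arr 9]
    have d10 : s3.arr 10 = s.arr 10 := by rw [hF3.arr 10, hF2.arr 10, hF1.arr 10]
    have d11 : s2.arr 11 = s3.arr 11 := by rw [hF3.arr 11]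
    have hI3 : Items G D p (insert v U) X s3 := hI.congr d54 d9 d10
      (by rw [hF3.arr 11, hF2.arr 11, hF1.arr 11]) (by rw [hF3.arr 12, hF2.arr 12, hF1.arr 12])
      (by rw [hF3.arr 13, hF2.arr 13, hF1.arr 13]) (by rw [hF3.arr 14, hF2.arr 14, hF1.arr 14])
    rw [runs_ite, hp3.reg1, c66, d11]
    constructor
    · intro hnv
      refine (runs_pushItemProg hB hI3 hp3.reg1
        (by rw [hF3.reg 56, hF2.reg 56, hF1.reg 56, hi]) (by rwa [d54]) v v3 j
        (by rw [hF3.reg 57, hF2.reg 57, hF1.reg 57, hj]) c65 c67 c68 (by omega)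
        (hXi.zero v hvU) hχ hr').mono ?_
      rintro t4 s4 ⟨rfl, hI4, e54, e9, e10⟩
      refine ⟨by omega, _, hI4, ⟨by omega, fun i' hi' => ?_⟩, fun _ => ⟨s.reg 54, by omega, ?_, ?_⟩⟩
      · rw [e9, e10, d54, d9, d10]
        simp [Function.update_of_ne hi'.ne]
      · rw [e9, d54]; simp
      · rw [e10, d54]; simp
    -- A visited code belongs to an existing item, and the combined code determines both of its
    -- parts.
    · intro hvis
      rw [runs_nop]
      refine ⟨by omega, X, hI3, .of_eq d54 d9 d10, fun _ => ?_⟩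
      have hle := hI3.visited_le (s3.reg 68)
      obtain ⟨i', h1, h2⟩ := (hI3.visited (s3.reg 68)).1 (by omega)
      rw [c68] at h2
      obtain ⟨h3, h4⟩ := mul_add_inj (hI3.rep i' h1).q_lt hr'.q_lt h2
      exact ⟨i', h1, h3, h4⟩
  · intro hno
    rw [runs_nop]
    have d54 : s2.reg 54 = s.reg 54 := by rw [hF2.reg 54, hF1.reg 54]
    have d9 : s2.arr 9 = s.arr 9 := by rw [hF2.arr 9, hF1.arr 9]
    have d10 : s2.arr 10 = s.arr 10 := by rw [hF2.arr 10, hF1.arr 10]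
    refine ⟨by omega, X, hI.congr d54 d9 d10 (by rw [hF2.arr 11, hF1.arr 11])
      (by rw [hF2.arr 12, hF1.arr 12]) (by rw [hF2.arr 13, hF1.arr 13])
      (by rw [hF2.arr 14, hF1.arr 14]), .of_eq d54 d9 d10, fun h => absurd h hno⟩

end DynamicProgram

/-! ### Sweeping over items, colours and vertices. -/

section DynamicProgramLoops

variable {n k : ℕ} {G : SimpleGraph (Fin n)} {D : Fin n → Fin n → Prop} {p : Fin k → Fin n → ℕ}

theorem Items.setReg {U : Finset (Fin n)} {X : ℕ → Fin n → ℕ} {s : State} (h : Items G D p U X s)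
    {d x : ℕ} (hd : 54 ≠ d) : Items G D p U X (s.setReg d x) :=
  h.congr (by simp [hd]) rfl rfl rfl rfl rfl rfl

theorem ItemsExt.setReg {X X' : ℕ → Fin n → ℕ} {s s' : State} (h : ItemsExt X X' s s')
    {d x : ℕ} (hd : 54 ≠ d) : ItemsExt X X' s (s'.setReg d x) :=
  h.trans (.of_eq (by simp [hd]) rfl rfl)

theorem HasItem.setReg {s : State} {l q d x : ℕ} (h : HasItem s l q) (hd : 54 ≠ d) :
    HasItem (s.setReg d x) l q :=
  -- Only codes matter for `HasItem`, so any family of colourings serves.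
  h.ext (X := fun _ (_ : Fin 0) => 0) (.of_eq (by simp [hd]) rfl rfl)

theorem Complete.setReg {U : Finset (Fin n)} {s : State} (h : Complete G D p U s)
    {d x : ℕ} (hd : 54 ≠ d) : Complete G D p U (s.setReg d x) := by
  intro χ hχ
  obtain ⟨i, hi, hr⟩ := h χ hχ
  exact ⟨i, by simpa [hd] using hi, by simpa using hr⟩

theorem Items.insert {U : Finset (Fin n)} {X : ℕ → Fin n → ℕ} {s : State}
    (h : Items G D p U X s) (v : Fin n) : Items G D p (insert v U) X s :=
  { h with coloring := fun i hi => (h.coloring i hi).mono (Finset.subset_insert _ _) }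

/-- Extend the colourings of all items by vertex `R[51]`. -/
def extendProg : Prog :=
  .seq (.arith .add 55 54 2) (.forLoop 56 55 (.forLoop 57 3 tryExtendProg))

/-- The item `i` of `s` has been extended by `v` in colour `j + 1`. -/
def Extended (D : Fin n → Fin n → Prop) (p : Fin k → Fin n → ℕ) (v : Fin n) (s s' : State) (i : ℕ)
    (j : Fin k) : Prop :=
  MayFollow D (s.arr 9 i) v j → HasItem s' (nextLast n (s.arr 9 i) v j)
    (nextProfit (maxTotalProfit p) (s.arr 10 i) (p j v) j)

/-- Register `55` freezes the number of items, so those pushed during the loop are not extended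
again. For completeness, delete `v` from a colouring and take an item representing the rest. Its
stored colouring may differ, but the extended codes are the same. -/
theorem runs_extendProg {W : ℕ} {s : State} (hB : Bounds W n k (maxTotalProfit p))
    (hD : IsTransitiveOrientation Gᶜ D) (hp : Prepared D p s)
    {U : Finset (Fin n)} {X : ℕ → Fin n → ℕ} (v : Fin n) (hvU : v ∉ U) (hU : ∀ u ∈ U, ¬ D v u)
    (hI : Items G D p U X s) (hC : Complete G D p U s) (hv : s.reg 51 = v) :
    Runs W extendProg s fun t s' =>
      t ≤ ((n + 1) ^ k * (maxTotalProfit p + 1) ^ k) * (k * 38 + 4) + 3 ∧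
      ∃ X', Items G D p (insert v U) X' s' ∧ Complete G D p (insert v U) s' := by
  have hcnt := hI.count_le
  have hb5 := hB.code
  have hkW := hB.k_lt
  rw [extendProg, runs_seq, runs_arith]
  simp only [ArithOp.eval, hp.reg2, add_zero]
  refine ⟨by omega, ?_⟩
  refine Runs.mono (runs_forLoop (s.reg 54) (k * 38 + 2) (fun m s' => ∃ X',
    Items G D p (Insert.insert v U) X' s' ∧ ItemsExt X X' s s' ∧ ∀ i < m, ∀ j, Extended D p v s s' i j)
    ?_ ?_ (by omega) rfl rfl rfl (by decide) (by decide) ?_ ?_) ?_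
  · simpa using hp.reg1
  · simp
  · exact ⟨X, ((hI.insert v).setReg (by decide)).setReg (by decide), .of_eq (by simp) rfl rfl,
      by omega⟩
  · rintro i s1 hi hF1 hi1 ⟨X1, hI1, hE1, hext1⟩
    have hp1 : Prepared D p s1 := by
      refine Prepared.of_frame ?_ hF1 rfl rfl
      exact hp.of_frame (P := .arith .add 55 54 2) ⟨fun r hr => by
        simp [Prog.writesReg] at hr; simp [hr], fun _ _ => rfl⟩ rfl rfl
    have v1 : s1.reg 51 = v := by rw [hF1.reg 51]; simpa using hv
    refine Runs.mono (runs_forLoop k 36 (fun m s' => ∃ X',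
      Items G D p (Insert.insert v U) X' s' ∧ ItemsExt X X' s s' ∧
      (∀ i' < i, ∀ j, Extended D p v s s' i' j) ∧ ∀ j : Fin k, j < m → Extended D p v s s' i j)
      hp1.reg1 hp1.reg3 hkW.le rfl rfl rfl (by decide) (by decide) ?_ ?_) ?_
    · exact ⟨X1, hI1.setReg (by decide), hE1.setReg (by decide),
        fun i' hi' j h => (hext1 i' hi' j h).setReg (by decide), by omega⟩
    · rintro j s2 hj hF2 hj2 ⟨X2, hI2, hE2, hext2, hext2'⟩
      have hp2 := hp1.of_frame hF2 rfl rfl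
      obtain ⟨x1, x2, x3⟩ := hE2.eq i hi
      refine (runs_tryExtendProg (i := i) hB hD hp2 v hvU hI2 (by rw [hF2.reg 56, hi1])
        (hi.trans_le hE2.le) (by rw [x1]; exact hI.coloring i hi) (by rw [hF2.reg 51, v1])
        ⟨j, hj⟩ hj2).mono ?_
      rintro t s3 ⟨ht, X3, hI3, hE3, hnew⟩
      rw [x2, x3] at hnew
      refine ⟨ht, X3, hI3.setReg (by decide), (hE2.trans hE3).setReg (by decide),
        fun i' hi' j h => ((hext2 i' hi' j h).ext hE3).setReg (by decide), fun j' hj' h => ?_⟩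
      by_cases hjj : (j' : ℕ) < j
      · exact ((hext2' j' hjj h).ext hE3).setReg (by decide)
      · have : j' = ⟨j, hj⟩ := Fin.ext (by simp; omega)
        subst this
        exact (hnew h).setReg (by decide)
    · rintro t s2 ⟨ht, X2, hI2, hE2, hext2, hext2'⟩
      refine ⟨by omega, X2, hI2.setReg (by decide), hE2.setReg (by decide), fun i' hi' j h => ?_⟩
      by_cases hii : i' < i
      · exact (hext2 i' hii j h).setReg (by decide)
      · have : i' = i := by omega
        subst this
        exact (hext2' j j.2 h).setReg (by decide)
  · rintro t s' ⟨ht, X', hI', hE, hext⟩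
    refine ⟨?_, X', hI', ?_⟩
    · have := Nat.mul_le_mul_right (k * 38 + 4) hcnt
      have e : s.reg 54 * (k * 38 + 2 + 2) = s.reg 54 * (k * 38 + 4) := rfl
      omega
    · intro χ hχ
      obtain ⟨i, hi, hr⟩ := hC _ hχ.restrict
      by_cases hv0 : χ v = 0
      · have : Function.update χ v 0 = χ := by rw [← hv0]; simp
        rw [this] at hr
        obtain ⟨-, e1, e2⟩ := hE.eq i hi
        exact ⟨i, hi.trans_le hE.le, by rwa [e1, e2]⟩
      · have hle := hχ.le v
        obtain ⟨j, hj⟩ : ∃ j : Fin k, χ v = j + 1 := ⟨⟨χ v - 1, by omega⟩, by simp; omega⟩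
        have hmay := hχ.mayFollow hD hU hr hj
        obtain ⟨i', hi', e1, e2⟩ := hext i hi j hmay
        have hr' := hr.extend hD hχ.restrict hvU j hmay
        refine ⟨i', hi', ?_⟩
        rw [e1, e2]
        rw [← hj] at hr'
        simpa using hr'

/-- The dynamic program: extend the colourings by the vertices in the order of their in-degrees. -/
def dynamicProg : Prog :=
  .seq (.store 11 2 1) <| .seq (.const 54 1) <| .forLoop 50 0 <| .forLoop 51 0 <|
    .seq (.load 52 6 51) <| .seq (.arith .sub 53 52 50) <| .seq (.arith .sub 52 50 52) <|
    .seq (.arith .add 52 52 53) <| .ite 2 52 .nop extendProg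

/-- The vertices that precede `(d, v)` in the lexicographic order by `g` and by number. -/
def verticesBelow (g : Fin n → ℕ) (d v : ℕ) : Finset (Fin n) :=
  Finset.univ.filter fun u => g u < d ∨ (g u = d ∧ u < v)

theorem verticesBelow_zero_zero (g : Fin n → ℕ) : verticesBelow g 0 0 = ∅ := by
  simp [verticesBelow]

theorem verticesBelow_last (g : Fin n → ℕ) (d : ℕ) :
    verticesBelow g d n = verticesBelow g (d + 1) 0 := by
  ext u
  simp [verticesBelow]
  omega

theorem verticesBelow_succ_of_ne (g : Fin n → ℕ) {d : ℕ} (v : Fin n) (h : g v ≠ d) :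
    verticesBelow g d (v + 1) = verticesBelow g d v := by
  ext u
  simp only [verticesBelow, Finset.mem_filter, Finset.mem_univ, true_and]
  by_cases huv : u = v
  · subst huv; omega
  · have : (u : ℕ) ≠ v := fun h => huv (Fin.ext h)
    omega

theorem verticesBelow_succ (g : Fin n → ℕ) (v : Fin n) :
    verticesBelow g (g v) (v + 1) = insert v (verticesBelow g (g v) v) := by
  ext u
  simp only [verticesBelow, Finset.mem_filter, Finset.mem_univ, true_and, Finset.mem_insert]
  by_cases huv : u = v
  · subst huv; simp
  · have : (u : ℕ) ≠ v := fun h => huv (Fin.ext h)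
    simp only [huv, false_or]
    omega

theorem items_init {s : State} (h54 : s.reg 54 = 1) (h9 : ∀ i, s.arr 9 i = 0)
    (h10 : ∀ i, s.arr 10 i = 0) (h11 : ∀ i, s.arr 11 i = if i = 0 then 1 else 0) :
    Items G D p ∅ (fun _ _ => 0) s where
  pos := by omega
  zero := rfl
  coloring i _ := ⟨fun _ => Nat.zero_le _, fun _ _ => rfl, fun _ _ _ h => absurd rfl h⟩
  rep i _ := by rw [h9, h10]; exact represents_zero
  parent i hi h := by omega
  visited_le c := by rw [h11]; split_ifs <;> omega
  visited c := by
    rw [h11, h54]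
    simp [h9, h10]
    omega
  inj i hi i' hi' _ _ := by omega

/-- Vertices are sorted by sweeping over all pairs `(d, v)` and acting when `g v = d`. The bound
charges a full extension to each of the `n * n` pairs, although each vertex is extended only once;
this gives the exponent `k + 2`. -/
theorem runs_dynamicProg {W : ℕ} {s : State} (hB : Bounds W n k (maxTotalProfit p))
    (hD : IsTransitiveOrientation Gᶜ D) (hp : Prepared D p s) (g : Fin n → ℕ)
    (hg : ∀ v, g v < n) (hgD : ∀ u v, D u v → g u < g v) (h6 : ∀ v : Fin n, s.arr 6 v = g v)
    (h9 : ∀ i, s.arr 9 i = 0) (h10 : ∀ i, s.arr 10 i = 0) (h11 : ∀ i, s.arr 11 i = 0) :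
    Runs W dynamicProg s fun t s' =>
      t ≤ n * (n * ((n + 1) ^ k * (maxTotalProfit p + 1) ^ k * (k * 38 + 4) + 10) + 4) + 4 ∧
      ∃ X, Items G D p Finset.univ X s' ∧ Complete G D p Finset.univ s' := by
  have hnW := hB.n_lt
  set T := (n + 1) ^ k * (maxTotalProfit p + 1) ^ k * (k * 38 + 4) with hT
  have hp0 : Prepared D p ((s.setCell 11 0 1).setReg 54 1) := by
    refine hp.of_frame (P := .seq (.store 11 2 1) (.const 54 1)) ⟨fun r hr => ?_, fun r hr => ?_⟩
      rfl rfl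
    · simp [Prog.writesReg] at hr; simp [hr]
    · simp [Prog.writesArr] at hr; simp [hr]
  simp only [dynamicProg, runs_seq, runs_store, runs_const, hp.reg1, hp.reg2]
  refine ⟨by omega, by omega, ?_⟩
  refine Runs.mono (runs_forLoop n (n * (T + 10) + 2) (fun m s' => ∃ X,
    Items G D p (verticesBelow g m 0) X s' ∧ Complete G D p (verticesBelow g m 0) s')
    hp0.reg1 hp0.reg0 hnW.le rfl rfl rfl (by decide) (by decide) ?_ ?_) ?_
  · rw [verticesBelow_zero_zero]
    refine ⟨fun _ _ => 0, (items_init (by simp) (by simpa using h9) (by simpa using h10)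
      fun i => ?_).setReg (by decide), ?_⟩
    · simp [Function.update_apply, h11]
    · intro χ hχ
      have : χ = fun _ => 0 := funext fun v => hχ.zero v (Finset.notMem_empty v)
      subst this
      exact ⟨0, by simp, by simpa [h9, h10] using represents_zero⟩
  · rintro d s1 hd hF1 hd1 ⟨X1, hI1, hC1⟩
    have hp1 := hp0.of_frame hF1 rfl rfl
    refine Runs.mono (runs_forLoop n (T + 8) (fun m s' => ∃ X,
      Items G D p (verticesBelow g d m) X s' ∧ Complete G D p (verticesBelow g d m) s')
      hp1.reg1 hp1.reg0 hnW.le rfl rfl rfl (by decide) (by decide) ?_ ?_) ?_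
    · exact ⟨X1, hI1.setReg (by decide), hC1.setReg (by decide)⟩
    · rintro v s2 hv hF2 hv2 ⟨X2, hI2, hC2⟩
      have hp2 := hp1.of_frame hF2 rfl rfl
      have e50 : s2.reg 50 = d := by rw [hF2.reg 50, hd1]
      have e6 : s2.arr 6 v = g ⟨v, hv⟩ := by
        rw [hF2.arr 6, hF1.arr 6, ← h6]; simp
      have hgv := hg ⟨v, hv⟩
      simp only [runs_seq, runs_load, runs_arith, runs_ite, runs_nop, ArithOp.eval, State.reg_setReg]
      simp only [Nat.reduceEqDiff, if_true, if_false, hv2, e6, e50, hp2.reg2]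
      -- Register `52` is the sum of both truncated differences of `d` and `g v`, which vanishes
      -- exactly when they are equal.
      refine ⟨by omega, by omega, by omega, by omega, fun hne => ?_, fun heq => ?_⟩
      · have h' : verticesBelow g d (v + 1) = verticesBelow g d v :=
          verticesBelow_succ_of_ne g ⟨v, hv⟩ (by omega)
        rw [h']
        refine ⟨by omega, X2, ?_, ?_⟩
        · exact ((((hI2.setReg (by decide)).setReg (by decide)).setReg (by decide)).setReg
            (by decide)).setReg (by decide)
        · exact ((((hC2.setReg (by decide)).setReg (by decide)).setReg (by decide)).setReg
            (by decide)).setReg (by decide)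
      · have hgd : g ⟨v, hv⟩ = d := by omega
        have h' : verticesBelow g d (v + 1) = insert ⟨v, hv⟩ (verticesBelow g d v) := by
          have := verticesBelow_succ g ⟨v, hv⟩
          rwa [hgd] at this
        refine Runs.mono (runs_extendProg (U := verticesBelow g d v) (X := X2) hB hD ?_ ⟨v, hv⟩
          ?_ ?_ ?_ ?_ ?_) ?_
        -- A stand-in program writing the relevant registers; a `Frame` depends only on the write
        -- targets.
        · refine hp2.of_frame (P := .seq (.load 52 6 51) (.load 53 6 51))
            ⟨fun r hr => ?_, fun r hr => rfl⟩ rfl rfl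
          simp [Prog.writesReg] at hr; simp [hr]
        · simp [verticesBelow, hgd]
        · intro u hu hD'
          have := hgD _ _ hD'
          simp only [verticesBelow, Finset.mem_filter, Finset.mem_univ, true_and] at hu
          omega
        · exact (((hI2.setReg (by decide)).setReg (by decide)).setReg (by decide)).setReg
            (by decide)
        · exact (((hC2.setReg (by decide)).setReg (by decide)).setReg (by decide)).setReg
            (by decide)
        · simpa using hv2
        · rintro t s3 ⟨ht, X3, hI3, hC3⟩
          rw [h']
          exact ⟨by omega, X3, hI3.setReg (by decide), hC3.setReg (by decide)⟩
    · rintro t s2 ⟨ht, X2, hI2, hC2⟩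
      rw [verticesBelow_last] at hI2 hC2
      exact ⟨by omega, X2, hI2.setReg (by decide), hC2.setReg (by decide)⟩
  · rintro t s' ⟨ht, X, hI, hC⟩
    have : verticesBelow g n 0 = Finset.univ := by
      ext u
      simp [verticesBelow, hg u]
    rw [this] at hI hC
    refine ⟨?_, X, hI, hC⟩
    have e : n * (n * (T + 10) + 2 + 2) = n * (n * (T + 10) + 4) := rfl
    omega

end DynamicProgramLoops

/-! ### Output -/

section Output

variable {n k : ℕ} {G : SimpleGraph (Fin n)} {D : Fin n → Fin n → Prop} {p : Fin k → Fin n → ℕ}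

/-- Write digit `R[77]` of `R[74]` to the list of tuples, and update the minimum `R[76]`. -/
def outputDigitProg : Prog :=
  .seq (.load 78 8 77) <| .seq (.arith .div 79 74 78) <| .seq (.arith .mod 79 79 42) <|
  .seq (.arith .add 81 80 77) <| .seq (.store 2 81 79) <| .ite 79 76 (.arith .add 76 79 2) .nop

/-- Append the tuple with code `R[74]` to the list of tuples, with its minimum in `R[76]`. -/
def outputTupleProg : Prog :=
  .seq (.arith .mul 80 70 3) <| .seq (.arith .sub 76 42 1) <| .forLoop 77 3 outputDigitProg

/-- The running minimum starts at `Q`, an upper bound for all digits; hence the restriction to `x ≤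
Q` in the last clause. -/
theorem runs_outputTupleProg {W c r cap : ℕ} {s : State} (hk0 : k ≠ 0) (hB : Bounds W n k (maxTotalProfit p))
    (hW : cap * k ≤ W) (hp : Prepared D p s) (hc : c < (maxTotalProfit p + 1) ^ k)
    (h74 : s.reg 74 = c) (hr : s.reg 70 = r) (hr' : r < cap) :
    Runs W outputTupleProg s fun t s' => t ≤ k * 9 + 4 ∧
      (∀ r' < r, ∀ j < k, s'.arr 2 (r' * k + j) = s.arr 2 (r' * k + j)) ∧
      (∀ j < k, s'.arr 2 (r * k + j) = digit (maxTotalProfit p + 1) c j) ∧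
      (∀ j < k, s'.reg 76 ≤ digit (maxTotalProfit p + 1) c j) ∧
      ∀ x ≤ maxTotalProfit p, (∀ j < k, x ≤ digit (maxTotalProfit p + 1) c j) → x ≤ s'.reg 76 := by
  have hrk : r * k ≤ cap * k := Nat.mul_le_mul_right _ hr'.le
  have hQW : maxTotalProfit p + 1 ≤ W := (Nat.le_self_pow hk0 _).trans hB.profit
  have hkW := hB.k_lt
  have hP := hB.profit
  simp only [outputTupleProg, runs_seq, runs_arith, ArithOp.eval, State.reg_setReg]
  simp only [Nat.reduceEqDiff, if_false, hr, hp.reg3, hp.reg42, hp.reg1]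
  refine ⟨by omega, by omega, ?_⟩
  refine Runs.mono (runs_forLoop k 7 (fun m s' =>
      (∀ r' < r, ∀ j < k, s'.arr 2 (r' * k + j) = s.arr 2 (r' * k + j)) ∧
      (∀ j < m, s'.arr 2 (r * k + j) = digit (maxTotalProfit p + 1) c j) ∧
      (∀ j < m, s'.reg 76 ≤ digit (maxTotalProfit p + 1) c j) ∧
      (∀ x ≤ maxTotalProfit p, (∀ j < m, x ≤ digit (maxTotalProfit p + 1) c j) → x ≤ s'.reg 76))
    ?_ ?_ hkW.le rfl rfl rfl (by decide) (by decide) ?_ ?_) ?_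
  · simpa using hp.reg1
  · simpa using hp.reg3
  · simp
  · rintro j s1 hj hF hj1 ⟨i1, i2, i3, i4⟩
    have e74 : s1.reg 74 = c := by rw [hF.reg 74]; simpa using h74
    have e42 : s1.reg 42 = maxTotalProfit p + 1 := by rw [hF.reg 42]; simpa using hp.reg42
    have e80 : s1.reg 80 = r * k := by rw [hF.reg 80]; simp
    have e2 : s1.reg 2 = 0 := by rw [hF.reg 2]; simpa using hp.reg2
    have e8 : s1.arr 8 j = (maxTotalProfit p + 1) ^ j := by rw [hF.arr 8]; simpa using hp.arr8 j hj
    have b2 : (maxTotalProfit p + 1) ^ j ≤ (maxTotalProfit p + 1) ^ k :=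
      Nat.pow_le_pow_right (Nat.succ_pos _) hj.le
    have b3 : c / (maxTotalProfit p + 1) ^ j ≤ c := Nat.div_le_self _ _
    have b4 : digit (maxTotalProfit p + 1) c j < maxTotalProfit p + 1 := digit_lt (Nat.succ_pos _)
    have b5 := mul_add_lt_mul hr' hj
    have ed : c / (maxTotalProfit p + 1) ^ j % (maxTotalProfit p + 1) =
      digit (maxTotalProfit p + 1) c j := rfl
    simp only [outputDigitProg, runs_seq, runs_arith, runs_load, runs_store, runs_ite, runs_nop,
      ArithOp.eval, State.reg_setReg, State.arr_setReg, State.reg_setCell, State.arr_setCell]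
    simp only [Nat.reduceEqDiff, if_true, if_false, hj1, e74, e42, e80, e2, e8, ed]
    have k1 : ∀ r' < r, ∀ j' < k, Function.update (s1.arr 2) (r * k + j)
        (digit (maxTotalProfit p + 1) c j) (r' * k + j') = s.arr 2 (r' * k + j') := by
      intro r' h1 j' h2
      have := mul_add_lt_mul h1 h2
      rw [Function.update_of_ne (by omega), i1 r' h1 j' h2]
    have k2 : ∀ j' < j + 1, Function.update (s1.arr 2) (r * k + j)
        (digit (maxTotalProfit p + 1) c j) (r * k + j') = digit (maxTotalProfit p + 1) c j' := by
      intro j' h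
      by_cases h' : j' = j
      · rw [h', Function.update_self]
      · rw [Function.update_of_ne (by omega), i2 j' (by omega)]
    refine ⟨by omega, by omega, by omega, by omega, by omega, fun h => ?_, fun h => ?_⟩
    · refine ⟨by omega, by omega, k1, k2, fun j' hj' => ?_, fun x hx h' => ?_⟩
      · by_cases hjj : j' = j
        · rw [hjj]; omega
        · have := i3 j' (by omega); omega
      · have := h' j (by omega); omega
    · refine ⟨by omega, k1, k2, fun j' hj' => ?_, fun x hx h' => ?_⟩
      · by_cases hjj : j' = j
        · rw [hjj]; omega
        · have := i3 j' (by omega); omega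
      · exact i4 x hx fun j' hj' => h' j' (by omega)
  · rintro t s' ⟨ht, i1, i2, i3, i4⟩
    exact ⟨by omega, i1, i2, i3, i4⟩

/-- The invariant of the output loop: the profit profiles of the first `m` items have been listed,
and register `72` holds the best of these items. -/
structure OutputInv (k Q m : ℕ) (s : State) : Prop where
  queue : Queue (fun c => ∃ i < m, s.arr 10 i = c) (s.arr 15) (s.arr 16) (s.reg 70)
  all : ∀ i < m, s.arr 15 (s.arr 10 i) = 1
  le : s.reg 70 ≤ m
  tuples : ∀ r < s.reg 70, ∀ j < k, s.arr 2 (r * k + j) = digit (Q + 1) (s.arr 16 r) j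
  best_lt : s.reg 72 < s.reg 54
  best_le : ∀ j < k, s.reg 71 ≤ digit (Q + 1) (s.arr 10 (s.reg 72)) j
  le_best : ∀ i < m, ∀ x ≤ Q, (∀ j < k, x ≤ digit (Q + 1) (s.arr 10 i) j) → x ≤ s.reg 71

/-- List the profit profile of item `R[73]` if it is new. -/
def outputItemProg : Prog :=
  .seq (.load 74 10 73) <| .seq (.load 75 15 74) <| .ite 75 1
    (.seq (.store 15 74 1) <| .seq (.store 16 70 74) <| .seq outputTupleProg <|
      .seq (.arith .add 70 70 1) <|
      .ite 76 71 .nop (.seq (.arith .add 71 76 2) (.arith .add 72 73 2))) .nop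

theorem runs_outputItemProg {W m cap : ℕ} {s : State} (hk0 : k ≠ 0)
    (hB : Bounds W n k (maxTotalProfit p)) (hW : cap * k ≤ W) (hcW : cap ≤ W)
    (hp : Prepared D p s) (hcap : s.reg 54 ≤ cap) (hm : m < s.reg 54) (h73 : s.reg 73 = m)
    (hq : s.arr 10 m < (maxTotalProfit p + 1) ^ k) (hI : OutputInv k (maxTotalProfit p) m s) :
    Runs W outputItemProg s fun t s' => t ≤ k * 9 + 14 ∧
      OutputInv k (maxTotalProfit p) (m + 1) s' := by
  have hP := hB.profit
  have hkW := hB.k_lt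
  have hle := hI.le
  have hv := hI.queue.le_one (s.arr 10 m)
  simp only [outputItemProg, runs_seq, runs_load, runs_ite, runs_nop, runs_store,
    State.reg_setReg, State.arr_setReg]
  simp only [Nat.reduceEqDiff, if_true, if_false, h73, hp.reg1]
  refine ⟨by omega, by omega, fun hnew => ?_, fun hold => ?_⟩
  · simp only [State.reg_setCell, State.reg_setReg, Nat.reduceEqDiff, if_true, if_false]
    refine ⟨by omega, by omega, ?_⟩
    refine Runs.mono (Runs.frame (runs_outputTupleProg (c := s.arr 10 m) (r := s.reg 70)
      (cap := cap) (D := D) hk0 hB hW ?_ hq ?_ ?_ (by omega))) ?_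
    · refine hp.of_frame (P := .seq (.load 74 10 73) <| .seq (.load 75 15 74) <|
        .seq (.store 15 74 1) (.store 16 70 74)) ⟨fun r hr => ?_, fun r hr => ?_⟩ rfl rfl
      · simp [Prog.writesReg] at hr; simp [hr]
      · simp [Prog.writesArr] at hr; simp [hr]
    · simp
    · simp
    rintro t1 s1 ⟨⟨ht1, i1, i2, i3, i4⟩, hF⟩
    have e70 : s1.reg 70 = s.reg 70 := by rw [hF.reg 70]; simp
    have e71 : s1.reg 71 = s.reg 71 := by rw [hF.reg 71]; simp
    have e72 : s1.reg 72 = s.reg 72 := by rw [hF.reg 72]; simp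
    have e73 : s1.reg 73 = m := by rw [hF.reg 73]; simpa using h73
    have e54 : s1.reg 54 = s.reg 54 := by rw [hF.reg 54]; simp
    have e1 : s1.reg 1 = 1 := by rw [hF.reg 1]; simpa using hp.reg1
    have e2 : s1.reg 2 = 0 := by rw [hF.reg 2]; simpa using hp.reg2
    have a10 : s1.arr 10 = s.arr 10 := by rw [hF.arr 10]; simp
    have a15 : s1.arr 15 = Function.update (s.arr 15) (s.arr 10 m) 1 := by rw [hF.arr 15]; simp
    have a16 : s1.arr 16 = Function.update (s.arr 16) (s.reg 70) (s.arr 10 m) := by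
      rw [hF.arr 16]; simp
    have hQ' : Queue (fun c => ∃ i < m + 1, s.arr 10 i = c) (s1.arr 15) (s1.arr 16)
        (s.reg 70 + 1) := by
      rw [a15, a16]
      refine (hI.queue.weaken ?_).push (by omega) ⟨m, by omega, rfl⟩
      rintro c ⟨i, hi, e⟩
      exact ⟨i, by omega, e⟩
    have hall : ∀ i < m + 1, s1.arr 15 (s.arr 10 i) = 1 := by
      intro i hi
      rw [a15, Function.update_apply]
      split_ifs with h
      · rfl
      · have : i ≠ m := fun h' => h (by rw [h'])
        exact hI.all i (by omega)
    have htup : ∀ r < s.reg 70 + 1, ∀ j < k, s1.arr 2 (r * k + j) =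
        digit (maxTotalProfit p + 1) (s1.arr 16 r) j := by
      intro r hr j hj
      rw [a16]
      by_cases h : r = s.reg 70
      · rw [h, Function.update_self]; exact i2 j hj
      · rw [Function.update_of_ne h, i1 r (by omega) j hj]
        simpa using hI.tuples r (by omega) j hj
    have hk : 0 < k := Nat.pos_of_ne_zero hk0
    have hmnQ : s1.reg 76 ≤ maxTotalProfit p := by
      have h1 := i3 0 hk
      have h2 : digit (maxTotalProfit p + 1) (s.arr 10 m) 0 < maxTotalProfit p + 1 :=
        digit_lt (Nat.succ_pos _)
      omega
    have hQW : maxTotalProfit p + 1 ≤ W := (Nat.le_self_pow hk0 _).trans hP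
    simp only [runs_arith, ArithOp.eval, State.reg_setReg]
    simp only [Nat.reduceEqDiff, if_false, e70, e71, e73, e1, e2, add_zero]
    refine ⟨by omega, fun hlt => ⟨by omega, ?_⟩, fun hge => ⟨by omega, by omega, by omega, ?_⟩⟩
    · constructor
      · simpa [a10] using hQ'
      · simpa [a10] using hall
      · simpa using hle
      · simpa using htup
      · simpa [e72, e54] using hI.best_lt
      · simpa [e71, e72, a10] using hI.best_le
      · intro i hi x hx h
        simp [a10] at h
        simp [e71]
        by_cases him : i = m
        · subst him
          exact (i4 x hx h).trans hlt.le
        · exact hI.le_best i (by omega) x hx h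
    · constructor
      · simpa [a10] using hQ'
      · simpa [a10] using hall
      · simpa using hle
      · simpa using htup
      · simpa [e54] using hm
      · simpa [a10] using i3
      · intro i hi x hx h
        simp [a10] at h
        simp
        by_cases him : i = m
        · subst him
          exact i4 x hx h
        · have := hI.le_best i (by omega) x hx h
          omega
  · have hvis : s.arr 15 (s.arr 10 m) = 1 := by omega
    -- An earlier item has the same profile, so the current best already accounts for this one.
    obtain ⟨⟨i0, hi0, e0⟩, -⟩ := hI.queue.mem _ hvis
    refine ⟨by omega, ?_⟩
    constructor
    · simp
      exact hI.queue.weaken fun c ⟨i, hi, e⟩ => ⟨i, by omega, e⟩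
    · intro i hi
      by_cases him : i = m
      · subst him; simpa using hvis
      · simpa using hI.all i (by omega)
    · simp; omega
    · simpa using hI.tuples
    · simpa using hI.best_lt
    · simpa using hI.best_le
    · intro i hi x hx h
      simp at h ⊢
      by_cases him : i = m
      · subst him
        rw [← e0] at h
        exact hI.le_best i0 hi0 x hx h
      · exact hI.le_best i (by omega) x hx h

/-- List the profit profiles of all items, and find the best one. -/
def outputProg : Prog := .forLoop 73 54 outputItemProg

theorem OutputInv.setReg {Q m : ℕ} {s : State} (h : OutputInv k Q m s) {x : ℕ} :
    OutputInv k Q m (s.setReg 73 x) :=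
  ⟨by simpa using h.queue, by simpa using h.all, by simpa using h.le, by simpa using h.tuples,
    by simpa using h.best_lt, by simpa using h.best_le, by simpa using h.le_best⟩

theorem runs_outputProg {W cap : ℕ} {s : State} (hk0 : k ≠ 0)
    (hB : Bounds W n k (maxTotalProfit p)) (hW : cap * k ≤ W) (hcW : cap ≤ W)
    (hp : Prepared D p s) (hcap : s.reg 54 ≤ cap) (hpos : 0 < s.reg 54)
    (hq : ∀ i < s.reg 54, s.arr 10 i < (maxTotalProfit p + 1) ^ k)
    (h15 : ∀ c, s.arr 15 c = 0) (h70 : s.reg 70 = 0) (h71 : s.reg 71 = 0) (h72 : s.reg 72 = 0) :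
    Runs W outputProg s fun t s' => t ≤ cap * (k * 9 + 16) + 2 ∧
      OutputInv k (maxTotalProfit p) (s.reg 54) s' := by
  refine (runs_forLoop (s.reg 54) (k * 9 + 14) (fun m s' => OutputInv k (maxTotalProfit p) m s')
    hp.reg1 rfl (hcap.trans hcW) rfl rfl rfl (by decide) (by decide) ?_ ?_).mono ?_
  · refine OutputInv.setReg ⟨⟨fun c => by simp [h15], by omega, fun c hc => ?_, by omega⟩,
      by omega, by omega, by omega, by omega, fun j _ => by omega, by omega⟩
    rw [h15] at hc; omega
  · rintro m s1 hm hF hi hI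
    have e54 : s1.reg 54 = s.reg 54 := hF.reg 54
    have a10 : s1.arr 10 = s.arr 10 := hF.arr 10
    refine (runs_outputItemProg hk0 hB hW hcW (hp.of_frame hF rfl rfl) (by rwa [e54])
      (by rwa [e54]) hi (by rw [a10]; exact hq m hm) hI).mono ?_
    rintro t s2 ⟨ht, hI2⟩
    exact ⟨ht, hI2.setReg⟩
  · rintro t s' ⟨ht, hI⟩
    have := Nat.mul_le_mul_right (k * 9 + 16) hcap
    have e : s.reg 54 * (k * 9 + 14 + 2) = s.reg 54 * (k * 9 + 16) := rfl
    exact ⟨by omega, hI⟩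

/-- Write the colouring of item `R[72]` to array `3`. -/
def traceProg : Prog :=
  .seq (.arith .add 82 72 2) <| .loop 2 82 <| .seq (.load 83 13 82) <| .seq (.load 84 14 82) <|
    .seq (.store 3 83 84) (.load 82 12 82)

/-- Parents have smaller numbers, so the item number is the loop measure. Each vertex either has its
final entry and is uncoloured in the current item, or is unwritten and has its final colour there;
item `0` is uncoloured everywhere. -/
theorem runs_traceProg {W b : ℕ} {U : Finset (Fin n)} {X : ℕ → Fin n → ℕ} {s : State}
    (hn : n ≤ W) (hk : k ≤ W) (hI : Items G D p U X s) (hcW : s.reg 54 ≤ W) (h2 : s.reg 2 = 0)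
    (hb : s.reg 72 = b) (hb' : b < s.reg 54) (h3 : ∀ i, s.arr 3 i = 0) :
    Runs W traceProg s fun t s' => t ≤ b * 5 + 2 ∧ ∀ v : Fin n, s'.arr 3 v = X b v := by
  rw [traceProg, runs_seq, runs_arith]
  simp only [ArithOp.eval, h2, hb, add_zero]
  refine ⟨by omega, ?_⟩
  refine Runs.mono (runs_loop 4 (fun m s' => s'.reg 82 = m ∧ m < s.reg 54 ∧ s'.reg 2 = 0 ∧
    s'.arr 12 = s.arr 12 ∧ s'.arr 13 = s.arr 13 ∧ s'.arr 14 = s.arr 14 ∧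
    ∀ v : Fin n, (s'.arr 3 v = X b v ∧ X m v = 0) ∨ (s'.arr 3 v = 0 ∧ X m v = X b v))
    ?_ b _ ?_) ?_
  · rintro m s1 ⟨e82, hm, e2, a12, a13, a14, h⟩ hc
    obtain ⟨p1, p2, p3, v, p4, p5, p6⟩ := hI.parent m hm (by omega)
    have hv := v.2
    simp only [runs_seq, runs_load, runs_store, State.reg_setReg, State.arr_setReg,
      State.reg_setCell, State.arr_setCell]
    simp only [Nat.reduceEqDiff, if_true, if_false, e82, a12, a13, a14, p4]
    refine ⟨by omega, by omega, by omega, by omega, by omega, _, p1, rfl, by omega, e2, trivial, trivial,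
      trivial, ?_⟩
    intro u
    have hu := h u
    rw [p6] at hu
    by_cases huv : u = v
    · subst huv
      rw [Function.update_self] at hu ⊢
      left
      rcases hu with ⟨-, hu⟩ | ⟨-, hu⟩
      · omega
      · exact ⟨hu, p5⟩
    · have hne : (u : ℕ) ≠ v := fun h => huv (Fin.ext h)
      rw [Function.update_of_ne huv] at hu
      rw [Function.update_of_ne hne]
      exact hu
  · simp [hb', h2, h3]
  · rintro t s' ⟨ht, hc, m, e82, hm, e2, -, -, -, h⟩
    have hm0 : m = 0 := by omega
    subst hm0
    refine ⟨by omega, fun v => ?_⟩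
    rcases h v with ⟨h1, -⟩ | ⟨h1, h2⟩
    · exact h1
    · rw [h1, ← h2, hI.zero]

end Output

/-! ### The whole algorithm -/

section Correctness

variable {n k : ℕ} {G : SimpleGraph (Fin n)} {D : Fin n → Fin n → Prop} {p : Fin k → Fin n → ℕ}

/-- Listed codes come from colourings, `Complete` shows that none is missing, and distinct codes
below `(Q + 1) ^ k` have distinct digit tuples. -/
theorem outputsTuples_of_outputInv {U : Finset (Fin n)} {X : ℕ → Fin n → ℕ} {s s' : State}
    (hI : Items G D p U X s) (hC : Complete G D p Finset.univ s) (h10 : s'.arr 10 = s.arr 10)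
    (hO : OutputInv k (maxTotalProfit p) (s.reg 54) s') :
    Set.BijOn (fun (i : ℕ) (j : Fin k) => s'.arr 2 (i * k + j)) (Set.Iio (s'.reg 70))
      (profitProfiles G p) := by
  have hrow : ∀ r < s'.reg 70, ∃ i < s.reg 54, s.arr 10 i = s'.arr 16 r := by
    intro r hr
    obtain ⟨⟨i, hi, e⟩, -⟩ := hO.queue.mem _ (hO.queue.marked r hr)
    exact ⟨i, hi, by rw [← e, h10]⟩
  refine ⟨fun r hr => ?_, fun r hr r' hr' h => ?_, ?_⟩
  · obtain ⟨i, hi, e⟩ := hrow r hr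
    refine ⟨colorClasses k (X i), (hI.coloring i hi).isPartialColoring, ?_⟩
    rw [profitProfile_colorClasses]
    ext j
    dsimp only
    rw [hO.tuples r hr j j.2, ← e, (hI.rep i hi).profit]
  · obtain ⟨i, hi, e⟩ := hrow r hr
    obtain ⟨i', hi', e'⟩ := hrow r' hr'
    refine hO.queue.inj r hr r' hr' ?_
    rw [← e, ← e']
    refine digit_ext (hI.rep i hi).q_lt (hI.rep i' hi').q_lt fun j hj => ?_
    rw [e, e', ← hO.tuples r hr j hj, ← hO.tuples r' hr' j hj]
    exact congrFun h ⟨j, hj⟩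
  · rintro q ⟨Y, hY, rfl⟩
    obtain ⟨χ, hχ, rfl⟩ := exists_isColoringOn hY
    obtain ⟨i, hi, hr⟩ := hC χ hχ
    have hm := hO.all i hi
    rw [h10] at hm
    obtain ⟨-, r, hr', e⟩ := hO.queue.mem _ hm
    refine ⟨r, hr', ?_⟩
    ext j
    dsimp only
    rw [hO.tuples r hr' j j.2, e, hr.profit, profitProfile_colorClasses]

theorem satisfactionLevel_le (Y : Fin k → Finset (Fin n)) (j : Fin k) :
    satisfactionLevel p Y ≤ profitProfile p Y j :=
  ciInf_le (OrderBot.bddBelow _) j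

/-- Any colouring shares its profile with some item. Register `71` is at least the minimum of every
item and at most that of the item in register `72`. -/
theorem isOptimalColoring_of_outputInv (hk : k ≠ 0) {U : Finset (Fin n)} {X : ℕ → Fin n → ℕ}
    {s s' : State} (hI : Items G D p U X s) (hC : Complete G D p Finset.univ s)
    (h10 : s'.arr 10 = s.arr 10) (h54 : s'.reg 54 = s.reg 54)
    (hO : OutputInv k (maxTotalProfit p) (s.reg 54) s') :
    IsOptimalColoring G p (colorClasses k (X (s'.reg 72))) := by
  have hb : s'.reg 72 < s.reg 54 := h54 ▸ hO.best_lt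
  have : Nonempty (Fin k) := ⟨⟨0, Nat.pos_of_ne_zero hk⟩⟩
  refine ⟨(hI.coloring _ hb).isPartialColoring, fun Y hY => ?_⟩
  obtain ⟨χ, hχ, rfl⟩ := exists_isColoringOn hY
  obtain ⟨i, hi, hr⟩ := hC χ hχ
  have h1 : satisfactionLevel p (colorClasses k χ) ≤ s'.reg 71 := by
    refine hO.le_best i hi _ ?_ fun j hj => ?_
    · refine (satisfactionLevel_le _ ⟨0, Nat.pos_of_ne_zero hk⟩).trans ?_
      rw [profitProfile_colorClasses]
      exact colorProfit_le _ _
    · have := satisfactionLevel_le (p := p) (colorClasses k χ) ⟨j, hj⟩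
      rw [profitProfile_colorClasses, ← hr.profit] at this
      rwa [h10]
  refine h1.trans (le_ciInf fun j => ?_)
  rw [profitProfile_colorClasses, ← (hI.rep _ hb).profit, ← h10]
  exact hO.best_le j j.2

theorem outputsColoring_of_eq {χ : Fin n → ℕ} {U : Finset (Fin n)} (hχ : IsColoringOn G k U χ)
    {s : State} (h : ∀ v : Fin n, s.arr 3 v = χ v) : OutputsColoring s (colorClasses k χ) := by
  intro v
  rw [h]
  exact ⟨hχ.le v, fun j => by simp [colorClasses]⟩

theorem sup_rowSum_eq_maxTotalProfit {f : ℕ → ℕ} (hf : f = matrixCells p) :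
    (Finset.range k).sup (fun j => ∑ v ∈ Finset.range n, f (j * n + v)) = maxTotalProfit p := by
  have hrow : ∀ j : Fin k, ∑ v ∈ Finset.range n, f (j * n + v) = ∑ v, p j v := by
    intro j
    rw [Finset.sum_range]
    refine Finset.sum_congr rfl fun v _ => ?_
    rw [hf, matrixCells_apply]
  apply le_antisymm
  · refine Finset.sup_le fun j hj => ?_
    have hj' := Finset.mem_range.1 hj
    have := hrow ⟨j, hj'⟩
    dsimp only at this
    rw [this]
    exact Finset.le_sup (f := fun j => ∑ v, p j v) (Finset.mem_univ _)
  · refine Finset.sup_le fun j _ => ?_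
    rw [← hrow j]
    exact Finset.le_sup (f := fun j => ∑ v ∈ Finset.range n, f (j * n + v))
      (Finset.mem_range.2 j.2)

/-- The column sums are in-degrees. An arc from `u` to `v` makes the predecessors of `u`
predecessors of `v`, and `u` itself is an additional one; no vertex precedes itself, which gives the
bound `n`. -/
theorem columnSum_lt {H : SimpleGraph (Fin n)} (hD : IsTransitiveOrientation H D) {f : ℕ → ℕ}
    (hf : ∀ x : Fin n × Fin n, f (pairCode x) ≤ 1 ∧ (f (pairCode x) = 1 ↔ D x.1 x.2))
    (v : Fin n) :
    ∑ a ∈ Finset.range n, f (a * n + v) < n ∧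
      ∀ u, D u v → ∑ a ∈ Finset.range n, f (a * n + u) < ∑ a ∈ Finset.range n, f (a * n + v) := by
  have hsum : ∀ v : Fin n, ∑ a ∈ Finset.range n, f (a * n + v) = ∑ a : Fin n, f (pairCode (a, v)) :=
    fun v => Finset.sum_range _
  have hirr : ∀ v : Fin n, f (pairCode (v, v)) = 0 := by
    intro v
    have h1 := hf (v, v)
    have : ¬ D v v := fun h => hD.asymm h h
    have : f (pairCode (v, v)) ≠ 1 := fun h => this (h1.2.1 h)
    omega
  constructor
  · rw [hsum]
    calc _ < ∑ a : Fin n, 1 :=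
          Finset.sum_lt_sum (fun a _ => (hf (a, v)).1) ⟨v, Finset.mem_univ _, by simp [hirr]⟩
      _ = n := by simp
  · intro u hu
    rw [hsum, hsum]
    refine Finset.sum_lt_sum (fun a _ => ?_) ⟨u, Finset.mem_univ _, ?_⟩
    · by_cases h : f (pairCode (a, u)) = 1
      · rw [h, (hf (a, v)).2.2 (hD.trans _ _ _ ((hf (a, u)).2.1 h) hu)]
      · have := (hf (a, u)).1; omega
    · rw [hirr, (hf (u, v)).2.2 hu]; omega

/-- The algorithm for `k` colours. -/
def fairDivisionProg (k : ℕ) : Prog :=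
  .seq (.const 1 1) <| .seq (.const 3 k) <| .seq diagProg <| .seq orientProg <|
  .seq columnSumProg <| .seq maxRowSumProg <| .seq powProg <| .seq dynamicProg <|
  .seq outputProg <| .seq traceProg (.arith .add 0 70 2)

/-- An upper bound for the running time. -/
def timeBound (n k cap : ℕ) : ℕ :=
  2 + (n * 5 + 2) + (2 * (n * n) * (n * 26 + 25) + 5) + (n * (n * 8 + 4) + 2) +
    (k * (n * 6 + 7) + 2) + (k * 6 + 6) + (n * (n * (cap * (k * 38 + 4) + 10) + 4) + 4) +
    (cap * (k * 9 + 16) + 2) + (cap * 5 + 2) + 1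

-- The phases work on disjoint registers and arrays, so the composed frames carry the initial zeros
-- and earlier results to where they are needed.
open Classical in
theorem runs_fairDivisionProg {W : ℕ} (hk : k ≠ 0) (hG : IsCocomparabilityGraph G)
    (hB : Bounds W n k (maxTotalProfit p)) (hW1 : 2 * (n * n) + n + 3 ≤ W)
    (hW2 : (n + 1) ^ k * (maxTotalProfit p + 1) ^ k * k ≤ W) :
    Runs W (fairDivisionProg k) (inputState G p) fun t s =>
      t ≤ timeBound n k ((n + 1) ^ k * (maxTotalProfit p + 1) ^ k) ∧
      OutputsTuples s (profitProfiles G p) ∧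
      ∃ X : Fin k → Finset (Fin n), OutputsColoring s X ∧ IsOptimalColoring G p X := by
  have hD := lexArc_isTransitiveOrientation hG
  have hkW := hB.k_lt
  have hcode := hB.code
  have hQW : maxTotalProfit p + 1 ≤ W := (Nat.le_self_pow hk _).trans hB.profit
  have hnkW : (n + 1) ^ k ≤ W :=
    (Nat.le_mul_of_pos_left _ (Nat.succ_pos n)).trans hB.last
  set cap := (n + 1) ^ k * (maxTotalProfit p + 1) ^ k with hcap
  simp only [fairDivisionProg, runs_seq, runs_const]
  refine ⟨by omega, hkW.le, ?_⟩
  set s0 := ((inputState G p).setReg 1 1).setReg 3 k with hs0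
  have r0 : s0.reg 0 = n := by simp [hs0, inputState]
  have r1 : s0.reg 1 = 1 := by simp [hs0]
  have r2 : s0.reg 2 = 0 := by simp [hs0, inputState]
  have r3 : s0.reg 3 = k := by simp [hs0]
  have rz : ∀ r, 4 ≤ r → s0.reg r = 0 := by
    intro r hr
    simp [hs0, inputState, show r ≠ 3 by omega, show r ≠ 1 by omega, show r ≠ 0 by omega]
  have az : ∀ a, 2 ≤ a → ∀ c, s0.arr a c = 0 := by
    intro a ha c
    simp [hs0, inputState, show a ≠ 0 by omega, show a ≠ 1 by omega]
  have a0 : s0.arr 0 = matrixCells fun u v : Fin n => if G.Adj u v then 1 else 0 := by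
    simp [hs0, inputState]
  have a1 : s0.arr 1 = matrixCells p := by simp [hs0, inputState]
  clear_value s0
  refine (runs_diagProg G (by omega) r0 r1 a0).frame.mono ?_
  rintro t1 s1 ⟨⟨ht1, hA⟩, hF1⟩
  refine (runs_orientProg hG (by omega) (by rw [hF1.reg 0, r0]) (by rw [hF1.reg 1, r1])
    (by rw [hF1.reg 2, r2]) hA (by rw [hF1.reg 10, rz 10 (by decide)])
    (by rw [hF1.reg 11, rz 11 (by decide)]) (by rw [hF1.reg 12, rz 12 (by decide)])
    (by rw [hF1.arr 4]; exact az 4 (by decide))).frame.mono ?_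
  rintro t2 s2 ⟨⟨ht2, hM⟩, hF2⟩
  have hF12 := hF1.seq hF2
  refine (runs_columnSumProg (n := n) (by omega) (by rw [hF12.reg 0, r0]) (by rw [hF12.reg 1, r1])
    (fun a ha b hb => (hM (⟨a, ha⟩, ⟨b, hb⟩)).1)
    (by rw [hF12.arr 6]; exact az 6 (by decide))).frame.mono ?_
  rintro t3 s3 ⟨⟨ht3, h6⟩, hF3⟩
  have hF13 := hF12.seq hF3
  refine (runs_maxRowSumProg (n := n) (k := k) (Q := maxTotalProfit p) (by omega) hkW.le hB.k_mul
    (by omega) (by rw [hF13.reg 0, r0]) (by rw [hF13.reg 1, r1]) (by rw [hF13.reg 2, r2])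
    (by rw [hF13.reg 3, r3]) (by rw [hF13.reg 40, rz 40 (by decide)])
    (sup_rowSum_eq_maxTotalProfit (by rw [hF13.arr 1, a1]))).frame.mono ?_
  rintro t4 s4 ⟨⟨ht4, h40⟩, hF4⟩
  have hF14 := hF13.seq hF4
  refine (runs_powProg (n := n) (k := k) (Q := maxTotalProfit p) (by omega) hkW.le hQW hnkW
    hB.profit (by rw [hF14.reg 0, r0]) (by rw [hF14.reg 1, r1]) (by rw [hF14.reg 3, r3])
    h40).frame.mono ?_
  rintro t5 s5 ⟨⟨ht5, h41, h42, h44, h7, h8⟩, hF5⟩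
  have hF15 := hF14.seq hF5
  have hF35 := (hF3.seq hF4).seq hF5
  have hF45 := hF4.seq hF5
  have hp5 : Prepared (LexArc Gᶜ) p s5 := by
    refine ⟨?_, ?_, ?_, ?_, h41, h42, h44, ?_, ?_, ?_, h7, h8⟩
    · rw [hF15.reg 0, r0]
    · rw [hF15.reg 1, r1]
    · rw [hF15.reg 2, r2]
    · rw [hF15.reg 3, r3]
    · rw [hF15.arr 1, a1]
    · rw [hF35.arr 4]; exact fun x => (hM x).1
    · rw [hF35.arr 4]; exact fun x => (hM x).2
  refine (runs_dynamicProg hB hD hp5 (fun v => ∑ a ∈ Finset.range n, s2.arr 4 (a * n + v))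
    (fun v => (columnSum_lt hD hM v).1) (fun u v => (columnSum_lt hD hM v).2 u)
    (fun v => by rw [hF45.arr 6, h6 v v.2]) (by rw [hF15.arr 9]; exact az 9 (by decide))
    (by rw [hF15.arr 10]; exact az 10 (by decide))
    (by rw [hF15.arr 11]; exact az 11 (by decide))).frame.mono ?_
  rintro t6 s6 ⟨⟨ht6, X, hI, hC⟩, hF6⟩
  rw [← hcap] at ht6
  have hF16 := hF15.seq hF6
  have hp6 := hp5.of_frame hF6 rfl rfl
  have hcnt := hI.count_le
  refine (runs_outputProg hk hB hW2 hcode.le hp6 hcnt hI.pos (fun i hi => (hI.rep i hi).q_lt)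
    (by rw [hF16.arr 15]; exact az 15 (by decide)) (by rw [hF16.reg 70, rz 70 (by decide)])
    (by rw [hF16.reg 71, rz 71 (by decide)])
    (by rw [hF16.reg 72, rz 72 (by decide)])).frame.mono ?_
  rintro t7 s7 ⟨⟨ht7, hO⟩, hF7⟩
  have hp7 := hp6.of_frame hF7 rfl rfl
  have hF17 := hF16.seq hF7
  have e54 : s7.reg 54 = s6.reg 54 := hF7.reg 54
  have hI7 : Items G (LexArc Gᶜ) p Finset.univ X s7 := hI.congr e54 (hF7.arr 9) (hF7.arr 10)
    (hF7.arr 11) (hF7.arr 12) (hF7.arr 13) (hF7.arr 14)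
  have hb := hO.best_lt
  refine (runs_traceProg (by omega) hkW.le hI7 (by omega) hp7.reg2 rfl hb
    (by rw [hF17.arr 3]; exact az 3 (by decide))).frame.mono ?_
  rintro t8 s8 ⟨⟨ht8, h3⟩, hF8⟩
  have e70 : s8.reg 70 = s7.reg 70 := hF8.reg 70
  have e2 : s8.reg 2 = 0 := by rw [hF8.reg 2, hp7.reg2]
  have f2 : s8.arr 2 = s7.arr 2 := hF8.arr 2
  have hnum := hO.le
  simp only [runs_arith, ArithOp.eval, e70, e2, add_zero]
  refine ⟨by omega, ?_, ?_, colorClasses k (X (s7.reg 72)), ?_, ?_⟩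
  · rw [timeBound]
    have : s7.reg 72 * 5 ≤ cap * 5 := Nat.mul_le_mul_right _ (by omega)
    omega
  · have := outputsTuples_of_outputInv hI hC (hF7.arr 10) hO
    rw [← f2] at this
    simpa [OutputsTuples] using this
  · exact outputsColoring_of_eq (hI7.coloring _ hb) (by simpa using h3)
  · exact isOptimalColoring_of_outputInv hk hI hC (hF7.arr 10) e54 hO

/-! ### Word size and running time estimates. -/

theorem le_pow_of_le {a B i c : ℕ} (h : a ≤ B ^ i) (hB : 0 < B) (hic : i ≤ c) : a ≤ B ^ c :=
  h.trans (Nat.pow_le_pow_right hB hic)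

/-- The exponent is generous: `k ≤ 2 ^ k ≤ B ^ k` puts the number of states times `k` below `B ^ (3
* k)`, and the extra `5` covers the quadratic terms and the strict inequalities. -/
theorem bounds_pow (n k Q : ℕ) :
    Bounds ((n + Q + 2) ^ (3 * k + 5)) n k Q ∧
      2 * (n * n) + n + 3 ≤ (n + Q + 2) ^ (3 * k + 5) ∧
      (n + 1) ^ k * (Q + 1) ^ k * k ≤ (n + Q + 2) ^ (3 * k + 5) := by
  set B := n + Q + 2 with hB
  have hpos : 0 < B := by omega
  have h1 : 1 < B := by omega
  have hlt : ∀ {a i : ℕ}, a ≤ B ^ i → i < 3 * k + 5 → a < B ^ (3 * k + 5) := fun h hi =>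
    h.trans_lt (Nat.pow_lt_pow_right h1 hi)
  have hkB : k ≤ B ^ k := (Nat.lt_two_pow_self.le).trans (Nat.pow_le_pow_left (by omega) k)
  have hnB : n ≤ B ^ 1 := by rw [pow_one]; omega
  have hn1 : (n + 1) ^ k ≤ B ^ k := Nat.pow_le_pow_left (by omega) k
  have hQ1 : (Q + 1) ^ k ≤ B ^ k := Nat.pow_le_pow_left (by omega) k
  have hcap : (n + 1) ^ k * (Q + 1) ^ k ≤ B ^ (k + k) := by
    rw [pow_add]; exact Nat.mul_le_mul hn1 hQ1
  refine ⟨⟨hlt hnB (by omega), hlt hkB (by omega), ?_, ?_, ?_, ?_, hlt hcap (by omega)⟩, ?_, ?_⟩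
  · exact le_pow_of_le (i := 2) (by rw [pow_two]; exact Nat.mul_le_mul (by omega) (by omega)) hpos
      (by omega)
  · exact le_pow_of_le (i := k + 1) (by rw [pow_add]; exact Nat.mul_le_mul hkB hnB) hpos (by omega)
  · exact le_pow_of_le (i := 1 + k)
      (by rw [pow_add, pow_one]; exact Nat.mul_le_mul (by omega) hn1) hpos (by omega)
  · exact le_pow_of_le hQ1 hpos (by omega)
  · refine le_pow_of_le (i := 3) ?_ hpos (by omega)
    have h2 : (n + 2) ^ 3 ≤ B ^ 3 := Nat.pow_le_pow_left (by omega) 3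
    refine le_trans ?_ h2
    have : (n + 2) ^ 3 = n * n * n + 6 * (n * n) + 12 * n + 8 := by ring
    rw [this]
    have := Nat.zero_le (n * n * n)
    omega
  · exact le_pow_of_le (i := k + k + k) (by rw [pow_add]; exact Nat.mul_le_mul hcap hkB) hpos
      (by omega)

/-- The coefficients of the terms with a factor `k` add up to `66`, all others to less than `300`;
`2 ^ k` comes from `(n + 1) ^ k ≤ (2 * n) ^ k` for `n > 0`. The cubic phase needs `k ≥ 1`. For `n =
0` the state count is `(Q + 1) ^ k`, bounded only because `Q = 0`. -/
theorem timeBound_le (n Q : ℕ) {k : ℕ} (hk : 1 ≤ k) (hQ : n = 0 → Q = 0) :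
    timeBound n k ((n + 1) ^ k * (Q + 1) ^ k) ≤
      2 ^ k * (66 * k + 300) * (n ^ (k + 2) * (Q + 1) ^ k + 1) := by
  set Z := n ^ (k + 2) * (Q + 1) ^ k with hZ
  set cap := (n + 1) ^ k * (Q + 1) ^ k with hcap
  set Y := 2 ^ k * (Z + 1) with hY
  have h2 : 1 ≤ 2 ^ k := Nat.one_le_two_pow
  have hZY : Z + 1 ≤ Y := Nat.le_mul_of_pos_left _ h2
  have hn3 : n * n * n ≤ Z := by
    rcases Nat.eq_zero_or_pos n with h | h
    · simp [h]
    · calc n * n * n = n ^ 3 * 1 := by ring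
        _ ≤ n ^ (k + 2) * (Q + 1) ^ k :=
          Nat.mul_le_mul (Nat.pow_le_pow_right h (by omega)) (Nat.one_le_pow _ _ (by omega))
  have hn2 : n * n ≤ n * n * n := by
    rcases Nat.eq_zero_or_pos n with h | h
    · simp [h]
    · exact Nat.le_mul_of_pos_right _ h
  have hn1 : n ≤ n * n := Nat.le_mul_self n
  have hcapZ : n * n * cap ≤ 2 ^ k * Z := by
    rcases Nat.eq_zero_or_pos n with h | h
    · simp [h]
    · have : (n + 1) ^ k ≤ 2 ^ k * n ^ k := by
        rw [← mul_pow]; exact Nat.pow_le_pow_left (by omega) k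
      calc n * n * cap = n * n * (n + 1) ^ k * (Q + 1) ^ k := by rw [hcap]; ring
        _ ≤ n * n * (2 ^ k * n ^ k) * (Q + 1) ^ k := by gcongr
        _ = 2 ^ k * Z := by rw [hZ]; ring
  have hcapY : cap ≤ Y := by
    rcases Nat.eq_zero_or_pos n with h | h
    · have : cap = 1 := by rw [hcap, h, hQ h]; simp
      omega
    · have : cap ≤ n * n * cap := Nat.le_mul_of_pos_left _ (Nat.mul_pos h h)
      have : 2 ^ k * Z ≤ Y := by rw [hY]; gcongr; omega
      omega
  have hcap2Y : n * n * cap ≤ Y := hcapZ.trans (by rw [hY]; gcongr; omega)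
  have e : 2 ^ k * (66 * k + 300) * (Z + 1) = 66 * (k * Y) + 300 * Y := by rw [hY]; ring
  rw [e, timeBound]
  have k1 : k * n ≤ k * Y := Nat.mul_le_mul_left _ (by omega)
  have k2 : k * (n * n * cap) ≤ k * Y := Nat.mul_le_mul_left _ hcap2Y
  have k3 : k * cap ≤ k * Y := Nat.mul_le_mul_left _ hcapY
  have k4 : k * 1 ≤ k * Y := Nat.mul_le_mul_left _ (by omega)
  clear_value Y cap Z
  ring_nf at *
  omega

end Correctness

/-! ### Independent sets as directed paths -/

section Paths

variable {V : Type*} {G : SimpleGraph V} {D : V → V → Prop}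

/-- The reflexive closure of `D` is a partial order; a linear extension of it enumerates the
vertices. -/
theorem exists_isTopologicalSort [Fintype V] {H : SimpleGraph V} (hD : IsTransitiveOrientation H D) :
    ∃ e : Fin (Fintype.card V) ≃ V, IsTopologicalSort D e := by
  classical
  let _ : PartialOrder V :=
    { le := fun u v => u = v ∨ D u v
      le_refl := fun u => .inl rfl
      le_trans := by
        rintro u v w (rfl | h) (rfl | h')
        · exact .inl rfl
        · exact .inr h'
        · exact .inr h
        · exact .inr (hD.trans _ _ _ h h')
      le_antisymm := by
        rintro u v (rfl | h) (h' | h')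
        · rfl
        · rfl
        · exact h'.symm
        · exact absurd h' (hD.asymm h) }
  let _ : Fintype (LinearExtension V) := inferInstanceAs (Fintype V)
  let e := Fintype.orderIsoFinOfCardEq (LinearExtension V) (k := Fintype.card V) rfl
  refine ⟨e.toEquiv, fun i j h => ?_⟩
  have hle : e i ≤ e j := (toLinearExtension (α := V)).monotone (Or.inr h)
  have hle' := e.le_iff_le.1 hle
  refine lt_of_le_of_ne hle' ?_
  rintro rfl
  exact hD.asymm h h

/-- Transitivity of `D` turns the condition on consecutive entries into one on all pairs, and for a
pair an arc means non-adjacency in `G` together with the right order of indices. -/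
theorem isChain_map_iff (hD : IsTransitiveOrientation Gᶜ D) {m : ℕ} {e : Fin m ≃ V}
    (he : IsTopologicalSort D e) (I : List (Fin m)) :
    (I.map e).IsChain D ↔ I.Pairwise (· < ·) ∧ G.IsIndepSet {v | v ∈ I.map e} := by
  have : IsTrans V D := ⟨hD.trans⟩
  rw [List.isChain_iff_pairwise, List.pairwise_map]
  constructor
  · intro h
    refine ⟨h.imp fun hij => he _ _ hij, ?_⟩
    have h' : (I.map e).Pairwise fun u v => ¬ G.Adj u v := by
      rw [List.pairwise_map]
      exact h.imp fun hij => ((SimpleGraph.compl_adj _ _ _).1 (hD.adj_of_arc _ _ hij)).2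
    intro u hu v hv huv
    have : Std.Symm fun u v => ¬ G.Adj u v := ⟨fun _ _ h h' => h h'.symm⟩
    exact h'.forall_of_forall (fun _ _ => G.irrefl) hu hv
  · rintro ⟨h, hS⟩
    refine h.imp_of_mem fun {i j} hi hj hij => ?_
    have hne : e i ≠ e j := fun h => hij.ne (e.injective h)
    have hadj : Gᶜ.Adj (e i) (e j) := (SimpleGraph.compl_adj _ _ _).2
      ⟨hne, hS (List.mem_map_of_mem hi) (List.mem_map_of_mem hj) hne⟩
    exact (hD.arc_or_arc hadj).resolve_right fun h => lt_asymm hij (he _ _ h)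

end Paths

end FairDivision

open FairDivision
theorem theorem5 (k : ℕ) (hk : 1 ≤ k) :
    -- running time `O(n^(k+2) (Q+1)^k)` on words of `O(log (n+Q))` bits, for fixed `k`
    (∃ (P : Prog) (C c : ℕ), ∀ (n : ℕ) (G : SimpleGraph (Fin n)) (p : Fin k → Fin n → ℕ),
      IsCocomparabilityGraph G →
      ∃ (t : ℕ) (s : State),
        Exec ((n + maxTotalProfit p + 2) ^ c) P (inputState G p) t s ∧
        t ≤ C * (n ^ (k + 2) * (maxTotalProfit p + 1) ^ k + 1) ∧
        OutputsTuples s (profitProfiles G p) ∧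
        ∃ X : Fin k → Finset (Fin n), OutputsColoring s X ∧ IsOptimalColoring G p X) ∧
    -- independent sets are the directed paths, in every topological order of every
    -- transitive orientation of the complement
    (∀ (V : Type*) [Fintype V] (G : SimpleGraph V) (D : V → V → Prop),
      IsTransitiveOrientation Gᶜ D →
      (∃ e : Fin (Fintype.card V) ≃ V, IsTopologicalSort D e) ∧
      ∀ e : Fin (Fintype.card V) ≃ V, IsTopologicalSort D e →
        ∀ I : List (Fin (Fintype.card V)),
          (I.map e).IsChain D ↔
            I.Pairwise (· < ·) ∧ G.IsIndepSet {v | v ∈ I.map e}) := by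
  refine ⟨⟨fairDivisionProg k, 2 ^ k * (66 * k + 300), 3 * k + 5, fun n G p hG => ?_⟩,
    fun V _ G D hD => ⟨exists_isTopologicalSort hD, fun e he I => isChain_map_iff hD he I⟩⟩
  obtain ⟨hB, hW1, hW2⟩ := bounds_pow n k (maxTotalProfit p)
  obtain ⟨t, s, he, ht, hT, hX⟩ := runs_fairDivisionProg (by omega) hG hB hW1 hW2
  refine ⟨t, s, he, ht.trans (timeBound_le n _ hk ?_), hT, hX⟩
  rintro rfl
  simp [maxTotalProfit]
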